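/- **Setting.** Alice has a finite non-empty action set $\mathcal A$, her opponent a finite action set $\mathcal B$. A parameter $\theta\in\Theta$ is drawn from a prior under which the family of mean rewards $(f_\theta(a,b))_{(a,b)\in\mathcal A\times\mathcal B}$ is jointly Gaussian (this includes matrix games, linear games and kernelized games), with $v\le \operatorname{Var} f_\theta(a,b)\le 1$ for all $(a,b)$ and some $v>0$. The opponent plays an arbitrary fixed sequence $B_0,B_1,\dots$ in $\mathcal B$. In round $t=0,\dots,T-1$ Alice plays $A_t$ and observes $B_t$ and $Y_{t+1}=f_\theta(A_t,B_t)+W_{t+1}$, where the $W_t$ are i.i.d. $N(0,\sigma_w^2)$, $\sigma_w>0$. Put $H_t=((A_s,B_s,Y_{s+1}))_{s<t}$, and let $\mu_t(a,b),\sigma_t(a,b)$ be the mean and standard deviation of the Gaussian posterior of $f_\theta(a,b)$ given $H_t$. Rewards are counted in $[0,1]$: $r_\theta(a,b)=\operatorname{clip}_{[0,1]}(f_\theta(a,b))$, which is $f_\theta(a,b)$ whenever $f_\theta(a,b)\in[0,1]$. **Algorithm.** Optimistic Thompson sampling (OTS) draws, for every action $a$, independent samples $\tilde f^{\,j}_{t+1}(a,B_t)\sim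 N(\mu_t(a,B_t),\sigma_t^2(a,B_t))$, $j=1,\dots,M_{t+1}$, and sets $\tilde R_{t+1}(a)=\operatorname{clip}_{[0,1]}\big(\max_{j}\tilde f^{\,j}_{t+1}(a,B_t)\big)$. A full-information adversarial algorithm $\mathrm{adv}$ is any rule that gives the law of $A_t$ as a measurable function of $A_0,\dots,A_{t-1}$ and $\tilde R_1,\dots,\tilde R_t$. With $\Phi$ the standard normal distribution function and $$m(s)=\max\Big\{1,\Big\lceil \frac{\log(|\mathcal A|\sqrt s)}{\log\big(1/\Phi(\sqrt{2\log(|\mathcal A|\sqrt s)})\big)}\Big\rceil\Big\},$$ the numbers of samples satisfy $m(t+1)\le M_{t+1}\le m(T)$ for $0\le t<T$ (for example $M_{t+1}=m(T)$ for all $t$). **Regret.** Given $\theta$, put $$\Re(T,\theta)=\max_{a}\sum_{t<T}\mathbb E[r_\theta(a,B_t)-r_\theta(A_t,B_t)\mid\theta],\qquad \Re_{\rm full}(T,\mathrm{adv},\tilde R^{\rm OTS}\mid\theta)=\max_{a}\mathbb E\Big[\sum_{t<T}\big(\tilde R_{t+1}(a)-\tilde R_{t+1}(A_t)\big)\,\Big|\,\theta\Big].$$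 **Theorem.** There is a constant $C$ depending only on $\sigma_w$ and $v$ such that, for all such games, all opponent sequences, all $T$ and all $(M_{t})$ as above: 1. For every $\mathrm{adv}$, the mutual information $I(\theta;H_T)$ is finite, and for every measurable set $S\subseteq\Theta$ of parameters $$\mathbb E\big[\mathbf 1_S(\theta)\,\Re(T,\theta)\big]\le \mathbb E\big[\mathbf 1_S(\theta)\,\Re_{\rm full}(T,\mathrm{adv},\tilde R^{\rm OTS}\mid\theta)\big]+C\sqrt{\log(|\mathcal A|T)\,I(\theta;H_T)\,T}.$$ In particular ($S=\Theta$) this bounds the Bayesian regret; if $S$ is contained in the set of $\theta$ with $f_\theta\in[0,1]^{\mathcal A\times\mathcal B}$, then $r_\theta=f_\theta$ on $S$. 2. If $\mathrm{adv}$ is Hedge with uniform initial weights and step size $\sqrt{8\log|\mathcal A|/T}$, then $\Re_{\rm full}(T,\mathrm{adv},\tilde R^{\rm OTS}\mid\theta)\le C\sqrt{T\log|\mathcal A|}$ for every $\theta$, and $\mathbb E[\Re(T,\theta)]\le C\big(\sqrt{T\log|\mathcal A|}+\sqrt{\log(|\mathcal A|T)\,I(\theta;H_T)\,T}\big)$.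 3. If $\mathrm{adv}$ is Regret Matching (play with probabilities proportional to $\max(0,\sum_{s<t}(\tilde R_{s+1}(a)-\tilde R_{s+1}(A_s)))$, uniformly if these all vanish), then the same holds with $\sqrt{T|\mathcal A|}$ in place of $\sqrt{T\log|\mathcal A|}$. -/

import Mathlib

open MeasureTheory ProbabilityTheory
open scoped NNReal ENNReal

noncomputable section

namespace UnknownGame

/-- Evaluating a measurable family of functions at a measurable random index of a countable
discrete type is measurable. -/
theorem measurable_eval_index {α ι γ : Type*} [MeasurableSpace α] [MeasurableSpace ι]
    [Countable ι] [MeasurableSingletonClass ι] [MeasurableSpace γ] {g : α → ι → γ} {z : α → ι}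
    (hg : ∀ i, Measurable fun x => g x i) (hz : Measurable z) :
    Measurable fun x => g x (z x) :=
  (measurable_from_prod_countable_left (f := fun p : α × ι => g p.1 p.2) hg).comp
    (measurable_id.prodMk hz)

/-! ### Full-information adversarial algorithms -/

/-- A full-information adversarial algorithm on the action set `A`: in round `t`, given the actions
`A_0, …, A_{t-1}` already played and the reward vectors `r_0, …, r_{t-1}` already revealed, it
returns a probability vector on `A`, measurably in the past. -/
structure FullInfoAlgorithm (A : Type*) [Fintype A] [MeasurableSpace A] where
  prob : (t : ℕ) → (Fin t → A × (A → ℝ)) → A → ℝ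
  prob_nonneg : ∀ t h a, 0 ≤ prob t h a
  prob_sum : ∀ t h, ∑ a, prob t h a = 1
  measurable_prob : ∀ t a, Measurable fun h => prob t h a

section Algorithms

variable {A : Type*} [Fintype A] [MeasurableSpace A]

/-- The probability vector `P_X` proportional to the weights `X`
(the uniform vector if all the weights vanish). -/
def proportional (X : A → ℝ) (a : A) : ℝ :=
  if ∑ j, X j = 0 then 1 / (Fintype.card A : ℝ) else X a / ∑ j, X j

/-- The algorithm that plays in round `t` from `P_{X_t}`, where the nonnegative weights `X_t` are a
function of the past. -/
def FullInfoAlgorithm.ofWeights [Nonempty A] (X : (t : ℕ) → (Fin t → A × (A → ℝ)) → A → ℝ)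
    (hX : ∀ t h a, 0 ≤ X t h a) (hm : ∀ t a, Measurable fun h => X t h a) :
    FullInfoAlgorithm A where
  prob t h := proportional (X t h)
  prob_nonneg t h a := by
    unfold proportional
    split_ifs
    · positivity
    · exact div_nonneg (hX t h a) (Finset.sum_nonneg fun j _ => hX t h j)
  prob_sum t h := by
    unfold proportional
    split_ifs with h0
    · simp
    · rw [← Finset.sum_div, div_self h0]
  measurable_prob t a := by
    have hs : Measurable fun h => ∑ j, X t h j := Finset.measurable_sum _ fun j _ => hm t j
    exact Measurable.ite (hs (measurableSet_singleton 0)) measurable_const ((hm t a).div hs)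

/-- The algorithm Hedge with step sizes `η_0, η_1, …`: `X_0 = 1` and
`X_{t+1}(a) = X_t(a) exp (η_t r_t(a))`. -/
def hedge (A : Type*) [Fintype A] [MeasurableSpace A] [Nonempty A] (η : ℕ → ℝ) :
    FullInfoAlgorithm A :=
  FullInfoAlgorithm.ofWeights (fun t h a => ∏ s : Fin t, Real.exp (η s * (h s).2 a))
    (fun _ _ _ => Finset.prod_nonneg fun _ _ => (Real.exp_pos _).le)
    (fun t a => Finset.measurable_prod _ fun s _ => by fun_prop)

/-- The algorithm Regret Matching: `X_t(a) = max (0, ∑_{s<t} (r_s(a) - r_s(A_s)))`. -/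
def regretMatching (A : Type*) [Fintype A] [MeasurableSpace A] [MeasurableSingletonClass A]
    [Nonempty A] : FullInfoAlgorithm A :=
  FullInfoAlgorithm.ofWeights
    (fun t h a => max 0 (∑ s : Fin t, ((h s).2 a - (h s).2 (h s).1)))
    (fun _ _ _ => le_max_left _ _)
    (fun t a => by
      refine measurable_const.max (Finset.measurable_sum _ fun s _ => Measurable.sub ?_ ?_)
      · fun_prop
      · exact measurable_eval_index (g := fun (h : Fin t → A × (A → ℝ)) i => (h s).2 i)
          (fun i => by fun_prop) (by fun_prop))

/-- The law of the action played in round `t`, given the past. -/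
def FullInfoAlgorithm.actionKernel (adv : FullInfoAlgorithm A) (t : ℕ) :
    Kernel (Fin t → A × (A → ℝ)) A where
  toFun h := ∑ a, ENNReal.ofReal (adv.prob t h a) • Measure.dirac a
  measurable' := by
    refine Measure.measurable_of_measurable_coe _ fun s _ => ?_
    simp only [Measure.coe_finsetSum, Finset.sum_apply, Measure.smul_apply, smul_eq_mul]
    exact Finset.measurable_sum _ fun a _ =>
      ((adv.measurable_prob t a).ennreal_ofReal).mul_const _

instance (adv : FullInfoAlgorithm A) (t : ℕ) : IsMarkovKernel (adv.actionKernel t) where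
  isProbabilityMeasure h := by
    constructor
    change (∑ a, ENNReal.ofReal (adv.prob t h a) • Measure.dirac a : Measure A) Set.univ = 1
    simp only [Measure.coe_finsetSum, Finset.sum_apply, Measure.smul_apply, smul_eq_mul,
      measure_univ, mul_one]
    rw [← ENNReal.ofReal_sum_of_nonneg fun a _ => adv.prob_nonneg t h a, adv.prob_sum,
      ENNReal.ofReal_one]

end Algorithms

/-! ### Games with Gaussian prior -/

/-- The mean rewards `f_θ(a, b)` of a repeated game, with unknown parameter `θ ∈ Θ`, together with a
prior on `Θ` under which the family `(f_θ(a, b))_{a, b}` is jointly Gaussian. This comprises matrix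
games, linear games with a Gaussian parameter, and kernelized games. -/
structure GaussianGame (A B Θ : Type*) [Fintype A] [Fintype B] [DecidableEq A] [DecidableEq B]
    [MeasurableSpace Θ] where
  prior : Measure Θ
  isProbabilityMeasure_prior : IsProbabilityMeasure prior
  f : Θ → EuclideanSpace ℝ (A × B)
  measurable_f : Measurable f
  mean : EuclideanSpace ℝ (A × B)
  cov : Matrix (A × B) (A × B) ℝ
  posSemidef_cov : cov.PosSemidef
  map_prior : prior.map f = multivariateGaussian mean cov

/-- One entry `(A_t, B_t, Y_{t+1})` of Alice's history. -/
abbrev Obs (A B : Type*) := A × B × ℝ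

/-- One round of play: the entry `(A_t, B_t, Y_{t+1})` of Alice's history and the imagined reward
vector `R̃_{t+1}`. -/
abbrev Round (A B : Type*) := Obs A B × (A → ℝ)

/-- Clipping to `[0, 1]`. -/
def clip01 (x : ℝ) : ℝ := max 0 (min x 1)

theorem measurable_clip01 : Measurable clip01 :=
  measurable_const.max (measurable_id.min measurable_const)

section Posterior

variable {X : Type*}

/-- Conditioning a Gaussian family with mean function `s.1` and covariance function `s.2` on the
value `y` of its member at `x₀`, observed with independent centred Gaussian noise of standard
deviation `σ`. -/
def gaussianUpdate (σ : ℝ≥0) (s : (X → ℝ) × (X → X → ℝ)) (x₀ : X) (y : ℝ) :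
    (X → ℝ) × (X → X → ℝ) :=
  (fun x => s.1 x + s.2 x x₀ / ((σ : ℝ) ^ 2 + s.2 x₀ x₀) * (y - s.1 x₀),
   fun x x' => s.2 x x' - s.2 x x₀ * s.2 x₀ x' / ((σ : ℝ) ^ 2 + s.2 x₀ x₀))

end Posterior

attribute [instance] GaussianGame.isProbabilityMeasure_prior

namespace GaussianGame

variable {A B Θ : Type*} [Fintype A] [Fintype B] [DecidableEq A] [DecidableEq B]
  [MeasurableSpace A] [MeasurableSingletonClass A] [MeasurableSpace B] [MeasurableSingletonClass B]
  [MeasurableSpace Θ] (G : GaussianGame A B Θ) (σ : ℝ≥0)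

/-- Mean and covariance function of the Gaussian posterior of `f_θ` given the history `H_n`. -/
def posterior : (n : ℕ) → (Fin n → Obs A B) → (A × B → ℝ) × (A × B → A × B → ℝ)
  | 0, _ => (fun x => G.mean x, G.cov)
  | n + 1, h => gaussianUpdate σ (posterior n fun i => h i.castSucc)
      ((h (Fin.last n)).1, (h (Fin.last n)).2.1) (h (Fin.last n)).2.2

/-- The posterior mean `μ_n(a, b)`. -/
def postMean (n : ℕ) (h : Fin n → Obs A B) (a : A) (b : B) : ℝ := (G.posterior σ n h).1 (a, b)

/-- The posterior standard deviation `σ_n(a, b)`. -/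
def postStd (n : ℕ) (h : Fin n → Obs A B) (a : A) (b : B) : ℝ :=
  √((G.posterior σ n h).2 (a, b) (a, b))

/-- The imagined reward vector of optimistic Thompson sampling against the opponent's action `b`,
computed from independent standard normal variables `z j a`: the entry for the action `a` is the
maximum of the `m` posterior samples `μ_n(a, b) + σ_n(a, b) z_j(a)`, clipped to `[0, 1]`. -/
def imagined (n m : ℕ) (h : Fin n → Obs A B) (b : B) (z : Fin m → A → ℝ) (a : A) : ℝ :=
  clip01 (⨆ j : Fin m, (G.postMean σ n h a b + G.postStd σ n h a b * z j a))

theorem measurable_posterior (n : ℕ) :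
    (∀ x, Measurable fun h : Fin n → Obs A B => (G.posterior σ n h).1 x) ∧
      ∀ x y, Measurable fun h : Fin n → Obs A B => (G.posterior σ n h).2 x y := by
  induction n with
  | zero => exact ⟨fun _ => measurable_const, fun _ _ => measurable_const⟩
  | succ n ih =>
    have hr : Measurable fun (h : Fin (n + 1) → Obs A B) (i : Fin n) => h i.castSucc := by fun_prop
    have hz : Measurable fun h : Fin (n + 1) → Obs A B =>
        ((h (Fin.last n)).1, (h (Fin.last n)).2.1) := by fun_prop
    have hy : Measurable fun h : Fin (n + 1) → Obs A B => (h (Fin.last n)).2.2 := by fun_prop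
    have h1 : ∀ x, Measurable fun h : Fin (n + 1) → Obs A B =>
        (G.posterior σ n fun i => h i.castSucc).1 x := fun x => (ih.1 x).comp hr
    have h2 : ∀ x y, Measurable fun h : Fin (n + 1) → Obs A B =>
        (G.posterior σ n fun i => h i.castSucc).2 x y := fun x y => (ih.2 x y).comp hr
    have m1 := measurable_eval_index h1 hz
    have m2 := fun x => measurable_eval_index (h2 x) hz
    have m3 := fun y => measurable_eval_index
      (g := fun (h : Fin (n + 1) → Obs A B) x => (G.posterior σ n fun i => h i.castSucc).2 x y)
      (fun x => h2 x y) hz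
    have m4 := measurable_eval_index
      (g := fun (h : Fin (n + 1) → Obs A B) x => (G.posterior σ n fun i => h i.castSucc).2 x x)
      (fun x => h2 x x) hz
    exact ⟨fun x => (h1 x).add (((m2 x).div (measurable_const.add m4)).mul (hy.sub m1)),
      fun x y => (h2 x y).sub (((m2 x).mul (m3 y)).div (measurable_const.add m4))⟩

/-- The joint law of the action and of all the noise of round `n`, given the past: the action is
drawn by `adv` fed with the past actions and imagined rewards; independently of it, the observation
noise is `N(0, σ²)` and the variables of the sampling step are independent `N(0, 1)`. -/
def noiseKernel (adv : FullInfoAlgorithm A) (n m : ℕ) :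
    Kernel (Θ × (Fin n → Round A B)) (A × ℝ × (Fin m → A → ℝ)) :=
  ((adv.actionKernel n).comap (fun p i => ((p.2 i).1.1, (p.2 i).2)) (by fun_prop)) ×ₖ
    Kernel.const _ ((gaussianReal 0 (σ ^ 2)).prod
      (Measure.pi fun _ => Measure.pi fun _ => gaussianReal 0 1))

instance (adv : FullInfoAlgorithm A) (n m : ℕ) :
    IsMarkovKernel (noiseKernel (B := B) (Θ := Θ) σ adv n m) := by
  unfold noiseKernel
  infer_instance

/-- Appends round `n` to the past `q.2.1`: with `q.1 = θ` and `q.2.2 = (a, w, z)`, the new round has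
`A_n = a`, `B_n = b`, `Y_{n+1} = f_θ(a, b) + w`, and the vector `R̃_{n+1}` computed by optimistic
Thompson sampling from the history `H_n` and the opponent's action `b`. -/
def extend (n m : ℕ) (b : B) (q : Θ × ((Fin n → Round A B) × (A × ℝ × (Fin m → A → ℝ)))) :
    Fin (n + 1) → Round A B :=
  Fin.snoc q.2.1
    ((q.2.2.1, b, G.f q.1 (q.2.2.1, b) + q.2.2.2.1),
      G.imagined σ n m (fun i => (q.2.1 i).1) b q.2.2.2.2)

theorem measurable_extend (n m : ℕ) (b : B) : Measurable (G.extend σ n m b) := by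
  refine measurable_pi_lambda _ fun i => ?_
  refine Fin.lastCases ?_ (fun j => ?_) i
  · simp only [extend, Fin.snoc_last]
    have hh : Measurable fun (q : Θ × ((Fin n → Round A B) × (A × ℝ × (Fin m → A → ℝ))))
        (i : Fin n) => (q.2.1 i).1 := by fun_prop
    have hf : Measurable fun (q : Θ × ((Fin n → Round A B) × (A × ℝ × (Fin m → A → ℝ)))) =>
        G.f q.1 (q.2.2.1, b) := by
      have h0 := G.measurable_f
      exact measurable_eval_index
        (g := fun (q : Θ × ((Fin n → Round A B) × (A × ℝ × (Fin m → A → ℝ)))) a => G.f q.1 (a, b))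
        (fun a => by fun_prop) (by fun_prop)
    refine Measurable.prodMk (Measurable.prodMk (by fun_prop) (Measurable.prodMk measurable_const
      (hf.add (by fun_prop)))) (measurable_pi_lambda _ fun a => measurable_clip01.comp
        (Measurable.iSup fun j => ?_))
    have h1 := ((G.measurable_posterior σ n).1 (a, b)).comp hh
    have h2 := (((G.measurable_posterior σ n).2 (a, b) (a, b)).comp hh).sqrt
    exact h1.add (h2.mul (by fun_prop))
  · simp only [extend, Fin.snoc_castSucc]
    fun_prop

/-- The law, given `θ`, of the first `n` rounds when Alice runs `adv` on the imagined rewards of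
optimistic Thompson sampling, with `M t` samples per action in round `t`, and the opponent plays the
fixed action sequence `b`. -/
def law (adv : FullInfoAlgorithm A) (M : ℕ → ℕ) (b : ℕ → B) :
    (n : ℕ) → Kernel Θ (Fin n → Round A B)
  | 0 => Kernel.const Θ (Measure.dirac Fin.elim0)
  | n + 1 => (Kernel.id ×ₖ (law adv M b n ⊗ₖ noiseKernel σ adv n (M n))).map
      (G.extend σ n (M n) (b n))

instance (adv : FullInfoAlgorithm A) (M : ℕ → ℕ) (b : ℕ → B) (n : ℕ) :
    IsMarkovKernel (G.law σ adv M b n) := by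
  induction n with
  | zero => unfold law; infer_instance
  | succ n ih =>
    unfold law
    exact Kernel.IsMarkovKernel.map _ (G.measurable_extend σ n (M n) (b n))

/-! ### Regret and information -/

/-- The mean reward of the action pair `(a, b)` as a value in `[0, 1]`. It is `f_θ(a, b)` itself
whenever `f_θ(a, b) ∈ [0, 1]`. -/
def meanReward (θ : Θ) (a : A) (b : B) : ℝ := clip01 (G.f θ (a, b))

/-- The adversarial regret given `θ`,
`max_a ∑_{t<T} E[r_θ(a, B_t) - r_θ(A_t, B_t) | θ]`, against the action sequence `b`. -/
def regret (adv : FullInfoAlgorithm A) (M : ℕ → ℕ) (b : ℕ → B) (T : ℕ) (θ : Θ) : ℝ :=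
  ⨆ a : A, ∑ t : Fin T,
    ∫ h, (G.meanReward θ a (b t) - G.meanReward θ (h t).1.1 (b t)) ∂(G.law σ adv M b T θ)

/-- The full-information regret, given `θ`, of `adv` on the sequence of imagined rewards,
`max_a E[∑_{t<T} (R̃_{t+1}(a) - R̃_{t+1}(A_t)) | θ]`. -/
def fullRegret (adv : FullInfoAlgorithm A) (M : ℕ → ℕ) (b : ℕ → B) (T : ℕ) (θ : Θ) : ℝ :=
  ⨆ a : A, ∫ h, ∑ t : Fin T, ((h t).2 a - (h t).2 (h t).1.1) ∂(G.law σ adv M b T θ)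

/-- The joint law of `θ` and of Alice's history `H_T = (A_t, B_t, Y_{t+1})_{t<T}`. -/
def jointLaw (adv : FullInfoAlgorithm A) (M : ℕ → ℕ) (b : ℕ → B) (T : ℕ) :
    Measure (Θ × (Fin T → Obs A B)) :=
  G.prior ⊗ₘ (G.law σ adv M b T).map fun h t => (h t).1

end GaussianGame

/-- The mutual information of the two components of a random pair with law `μ`. -/
def mutualInfo {X Y : Type*} [MeasurableSpace X] [MeasurableSpace Y] (μ : Measure (X × Y)) :
    ℝ≥0∞ :=
  InformationTheory.klDiv μ (μ.fst.prod μ.snd)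

/-- The mutual information `I(θ; H_T)`. -/
def GaussianGame.information {A B Θ : Type*} [Fintype A] [Fintype B] [DecidableEq A]
    [DecidableEq B] [MeasurableSpace A] [MeasurableSingletonClass A] [MeasurableSpace B]
    [MeasurableSingletonClass B] [MeasurableSpace Θ] (G : GaussianGame A B Θ) (σ : ℝ≥0)
    (adv : FullInfoAlgorithm A) (M : ℕ → ℕ) (b : ℕ → B) (T : ℕ) : ℝ≥0∞ :=
  mutualInfo (G.jointLaw σ adv M b T)

/-- The number of samples per action of optimistic Thompson sampling with `k` actions for the
horizon `s`: with `β = 2 log (k √s)` and `Φ` the standard normal distribution function, the least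
positive integer `m` with `m ≥ log (k √s) / log (1 / Φ(√β))`. -/
def sampleSize (k s : ℕ) : ℕ :=
  max 1 ⌈Real.log (k * √s) /
    Real.log (1 / cdf (gaussianReal 0 1) (√(2 * Real.log (k * √s))))⌉₊

end UnknownGame

end

/-!
The regret against the opponent is compared, round by round, with the regret on the imagined
rewards. For one round, the difference of the two is at most a *gap*: the amounts by which the true
rewards of the actions exceed the imagined ones, summed over all actions, plus the amount by which
the imagined reward of the action played exceeds its true reward (`sub_le_gap`). The theorem is a
bound for the expected sum of the gaps.

Given the history, the mean rewards have the Gaussian posterior (`lintegral_posterior`, by induction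
from Bayes' rule `map_prod_gaussian_observation`), while the action and the posterior samples are
drawn independently of them. Hence each part of the gap is an integral over a Gaussian variable and
independent Gaussian samples with the same mean and variance.
* Optimism (`lintegral_clip_sub_imagined_le`): the sample size makes it unlikely that all samples of
  an action stay below the level `√(2 log (|A| √(t + 1)))` standard deviations above the mean, and
  the true mean reward rarely exceeds this level. The first part of the gap of round `t` is at most
  `2 / √(t + 1)`, and these terms add up to `4 √T`.
* Accuracy (`lintegral_imagined_sub_clip_le`): the maximum of `M` samples is on average at most
  `√(2 log M) + 1` standard deviations above the mean, and `log M` is at most a multiple of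
  `log (|A| T)` (`log_le_of_le_sampleSize`). The second part of the gap is at most a multiple of
  `√(log (|A| T))` times the posterior standard deviation at the action pair played.

By the Cauchy–Schwarz inequality, the posterior standard deviations sum to at most `√T` times the
square root of the expected sum of the posterior variances, and `log (1 + u) ≥ u / (1 + u)` bounds a
posterior variance by the information `log (1 + postVar / σ²) / 2` gained in its round. These
informations add up to the mutual information (`information_eq`): the log-density of the joint law
of parameter and history with respect to the product of its marginals is a sum of log-ratios of
likelihoods to predictive densities, in which the quadratic terms have equal expectations. Finally
`4 √T` is absorbed into the information term, since the prior variance `v` bounds the sum of the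
posterior variances from below.

For Hedge and Regret Matching the regret on the imagined rewards is bounded by the classical
potential arguments (`hedge_potential_step`, `regretMatching_potential_step`); they apply because
the action of a round is drawn independently of its imagined rewards, given the past.
-/

noncomputable section

namespace UnknownGame

/-! ### Bayes' rule for a noisy coordinate of a Gaussian vector -/

section GaussianBayes

variable {ι : Type*} [Fintype ι] [DecidableEq ι]

/-- The covariance matrix of a Gaussian vector with covariance `S` after its coordinate `i` has
been observed with independent Gaussian noise of standard deviation `σ`. -/
def condCov (σ : ℝ≥0) (S : Matrix ι ι ℝ) (i : ι) : Matrix ι ι ℝ :=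
  Matrix.of fun x x' => S x x' - S x i * S i x' / ((σ : ℝ) ^ 2 + S i i)

theorem dotProduct_mulVec_single {S : Matrix ι ι ℝ} (hS : S.PosSemidef) (i : ι) (u : ι → ℝ)
    (c : ℝ) : u ⬝ᵥ S.mulVec (Pi.single i c) = S.mulVec u i * c := by
  have hsym : ∀ x, S x i = S i x := fun x => by simpa using hS.1.apply i x
  rw [Matrix.mulVec_single]
  simp only [dotProduct, Matrix.mulVec, Pi.smul_apply, Matrix.col_apply,
    MulOpposite.smul_eq_mul_unop, MulOpposite.unop_op, Finset.sum_mul, hsym]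
  exact Finset.sum_congr rfl fun j _ => by ring

theorem dotProduct_condCov (σ : ℝ≥0) {S : Matrix ι ι ℝ} (hS : S.PosSemidef) (i : ι) (u : ι → ℝ) :
    u ⬝ᵥ (condCov σ S i).mulVec u =
      u ⬝ᵥ S.mulVec u - (S.mulVec u i) ^ 2 / ((σ : ℝ) ^ 2 + S i i) := by
  have hsym : ∀ x, S x i = S i x := fun x => by simpa using hS.1.apply i x
  have h1 : ∀ x, (condCov σ S i).mulVec u x =
      S.mulVec u x - S i x * (S.mulVec u i / ((σ : ℝ) ^ 2 + S i i)) := by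
    intro x
    simp only [Matrix.mulVec, dotProduct, condCov, Matrix.of_apply, hsym x, sub_mul,
      Finset.sum_sub_distrib]
    rw [Finset.sum_div, Finset.mul_sum]
    congr 1
    exact Finset.sum_congr rfl fun j _ => by ring
  simp only [dotProduct, h1, mul_sub, Finset.sum_sub_distrib]
  congr 1
  have : S.mulVec u i = ∑ x, u x * S i x := by
    simp only [Matrix.mulVec, dotProduct]
    exact Finset.sum_congr rfl fun j _ => by ring
  have h2 : S.mulVec u i ^ 2 / ((σ : ℝ) ^ 2 + S i i) =
      (∑ x, u x * S i x) * (S.mulVec u i / ((σ : ℝ) ^ 2 + S i i)) := by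
    rw [← this]; ring
  rw [h2, Finset.sum_mul]
  exact Finset.sum_congr rfl fun j _ => by ring

theorem posSemidef_condCov {σ : ℝ≥0} (hσ : 0 < σ) {S : Matrix ι ι ℝ} (hS : S.PosSemidef) (i : ι) :
    (condCov σ S i).PosSemidef := by
  have hsym : ∀ x y, S x y = S y x := fun x y => by simpa using hS.1.apply y x
  refine Matrix.PosSemidef.of_dotProduct_mulVec_nonneg ?_ fun u => ?_
  · ext x y
    simp only [Matrix.conjTranspose_apply, condCov, Matrix.of_apply, star_trivial]
    rw [hsym y x, hsym y i, hsym i x]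
    ring
  rw [star_trivial, dotProduct_condCov σ hS]
  have hii : 0 ≤ S i i := hS.diag_nonneg
  have hs : 0 < (σ : ℝ) ^ 2 + S i i := by positivity
  set s := (σ : ℝ) ^ 2 + S i i with hs_def
  set c := S.mulVec u i with hc
  -- nonnegativity of the quadratic form at `u - (c / s) e_i`
  have h := hS.dotProduct_mulVec_nonneg (u - Pi.single i (c / s))
  have e1 : u ⬝ᵥ S.mulVec (Pi.single i (c / s)) = c * (c / s) := dotProduct_mulVec_single hS i u _
  rw [star_trivial, Matrix.mulVec_sub, sub_dotProduct, dotProduct_sub, dotProduct_sub, e1] at h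
  simp only [single_dotProduct, Matrix.mulVec_single, Pi.smul_apply, Matrix.col_apply,
    MulOpposite.smul_eq_mul_unop, MulOpposite.unop_op] at h
  rw [← hc] at h
  have h2 : c / s * (S i i * (c / s)) ≤ c ^ 2 / s := by
    have : c ^ 2 / s = c / s * (s * (c / s)) := by field_simp
    rw [this]
    have hd : (c / s) * (s * (c / s)) - c / s * (S i i * (c / s)) = (σ : ℝ) ^ 2 * (c / s) ^ 2 := by
      rw [hs_def]; ring
    nlinarith [mul_nonneg (sq_nonneg (σ : ℝ)) (sq_nonneg (c / s))]
  have h3 : c * (c / s) = c ^ 2 / s := by ring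
  have h4 : c / s * c = c ^ 2 / s := by ring
  rw [h3, h4] at h
  linarith

theorem multivariateGaussian_eq_map_add (m : EuclideanSpace ℝ ι) (S : Matrix ι ι ℝ) :
    multivariateGaussian m S = (multivariateGaussian 0 S).map (fun x => m + x) := by
  unfold multivariateGaussian
  rw [Measure.map_map (by fun_prop) (by fun_prop)]
  congr 1
  ext x
  simp

/-- Bayes' rule for one noisy observation of a coordinate of a Gaussian vector, as an equality of
joint laws: drawing the vector and then the observation is the same as drawing the observation from
its marginal law and then the vector from the Gaussian posterior. Both sides have the same
characteristic function. -/
theorem map_prod_gaussian_observation {σ : ℝ≥0} (hσ : 0 < σ) (μ : EuclideanSpace ℝ ι)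
    {S : Matrix ι ι ℝ} (hS : S.PosSemidef) (i : ι) :
    ((multivariateGaussian μ S).prod (gaussianReal 0 (σ ^ 2))).map
        (fun p => (p.1, p.1 i + p.2)) =
      ((gaussianReal (μ i) (σ ^ 2 + (S i i).toNNReal)).prod
        (multivariateGaussian 0 (condCov σ S i))).map
        (fun q => (μ + ((q.1 - μ i) / ((σ : ℝ) ^ 2 + S i i)) • WithLp.toLp 2 (fun x => S x i) + q.2,
          q.1)) := by
  have hii : 0 ≤ S i i := hS.diag_nonneg
  have hs : 0 < (σ : ℝ) ^ 2 + S i i := by positivity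
  have hsym : ∀ x, S x i = S i x := fun x => by simpa using hS.1.apply i x
  have m1 : Measurable fun p : EuclideanSpace ℝ ι × ℝ => (p.1, p.1 i + p.2) := by fun_prop
  have m2 : Measurable fun q : ℝ × EuclideanSpace ℝ ι =>
    (μ + ((q.1 - μ i) / ((σ : ℝ) ^ 2 + S i i)) • WithLp.toLp 2 (fun x => S x i) + q.2, q.1) := by
    fun_prop
  have := Measure.isProbabilityMeasure_map (μ := (multivariateGaussian μ S).prod
    (gaussianReal 0 (σ ^ 2))) m1.aemeasurable
  have := Measure.isProbabilityMeasure_map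
    (μ := (gaussianReal (μ i) (σ ^ 2 + (S i i).toNNReal)).prod
        (multivariateGaussian 0 (condCov σ S i))) m2.aemeasurable
  refine Measure.ext_of_charFunDual ?_
  ext L
  -- the continuous linear functionals on the product
  obtain ⟨u, c, hL⟩ : ∃ (u : EuclideanSpace ℝ ι) (c : ℝ),
      ∀ x y, L (x, y) = inner ℝ x u + y * c := by
    refine ⟨(InnerProductSpace.toDual ℝ _).symm (L.comp (ContinuousLinearMap.inl ℝ _ _)),
      L (0, 1), fun x y => ?_⟩
    have : ((x, y) : EuclideanSpace ℝ ι × ℝ) = (x, 0) + y • (0, 1) := by simp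
    rw [this, map_add, map_smul, real_inner_comm, InnerProductSpace.toDual_symm_apply]
    simp
  rw [charFunDual_apply, charFunDual_apply,
    integral_map m1.aemeasurable (by fun_prop), integral_map m2.aemeasurable (by fun_prop)]
  simp only [hL]
  set s := (σ : ℝ) ^ 2 + S i i with hs_def
  have hk : ∀ x : EuclideanSpace ℝ ι, x i = inner ℝ x (EuclideanSpace.single i (1 : ℝ)) := by
    intro x; simp [EuclideanSpace.inner_single_right]
  set d : ℝ := S.mulVec u i with hd
  have hcol : inner ℝ (WithLp.toLp 2 (fun x => S x i)) u = d := by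
    rw [hd]
    simp only [PiLp.inner_apply, Matrix.mulVec, dotProduct]
    exact Finset.sum_congr rfl fun j _ => by simp [hsym j]; ring
  have f1 : ∀ p : EuclideanSpace ℝ ι × ℝ,
      Complex.exp (((inner ℝ p.1 u + (p.1 i + p.2) * c : ℝ) : ℂ) * Complex.I) =
      Complex.exp (((inner ℝ p.1 (u + c • EuclideanSpace.single i (1 : ℝ)) : ℝ) : ℂ) * Complex.I) *
      Complex.exp ((c : ℂ) * (p.2 : ℂ) * Complex.I) := by
    intro p
    rw [← Complex.exp_add, inner_add_right, inner_smul_right, ← hk]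
    congr 1
    push_cast
    ring
  have f2 : ∀ q : ℝ × EuclideanSpace ℝ ι,
      Complex.exp (((inner ℝ (μ + ((q.1 - μ i) / s) • WithLp.toLp 2 (fun x => S x i) + q.2) u +
        q.1 * c : ℝ) : ℂ) * Complex.I) =
      Complex.exp (((inner ℝ μ u - μ i / s * d : ℝ) : ℂ) * Complex.I) *
      (Complex.exp (((d / s + c : ℝ) : ℂ) * (q.1 : ℂ) * Complex.I) *
      Complex.exp (((inner ℝ q.2 u : ℝ) : ℂ) * Complex.I)) := by
    intro q
    rw [← Complex.exp_add, ← Complex.exp_add, inner_add_left, inner_add_left,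
      real_inner_smul_left, hcol]
    congr 1
    push_cast
    ring
  simp only [f1, f2]
  rw [integral_prod_mul (fun x : EuclideanSpace ℝ ι => Complex.exp (((inner ℝ x
      (u + c • EuclideanSpace.single i (1 : ℝ)) : ℝ) : ℂ) * Complex.I))
      (fun w : ℝ => Complex.exp ((c : ℂ) * (w : ℂ) * Complex.I)),
    integral_const_mul,
    integral_prod_mul (fun y : ℝ => Complex.exp (((d / s + c : ℝ) : ℂ) * (y : ℂ) * Complex.I))
      (fun x : EuclideanSpace ℝ ι => Complex.exp (((inner ℝ x u : ℝ) : ℂ) * Complex.I)),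
    ← charFun_apply_real, ← charFun_apply_real, ← charFun_apply, ← charFun_apply,
    charFun_multivariateGaussian hS, charFun_multivariateGaussian (posSemidef_condCov hσ hS i),
    charFun_gaussianReal, charFun_gaussianReal, ← Complex.exp_add, ← Complex.exp_add,
    ← Complex.exp_add, dotProduct_condCov σ hS]
  have q1 : (u + c • EuclideanSpace.single i (1 : ℝ)).ofLp ⬝ᵥ
      S.mulVec (u + c • EuclideanSpace.single i (1 : ℝ)).ofLp =
      u.ofLp ⬝ᵥ S.mulVec u.ofLp + 2 * c * d + c ^ 2 * S i i := by
    have e0 : (u + c • EuclideanSpace.single i (1 : ℝ)).ofLp = u.ofLp + Pi.single i c := by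
      ext j
      by_cases hj : j = i
      · subst hj; simp
      · simp [hj]
    have e1 : u.ofLp ⬝ᵥ S.mulVec (Pi.single i c) = d * c := dotProduct_mulVec_single hS i _ c
    rw [e0, Matrix.mulVec_add, add_dotProduct, dotProduct_add, dotProduct_add, e1]
    simp only [single_dotProduct, Matrix.mulVec_single, Pi.smul_apply, Matrix.col_apply,
      MulOpposite.smul_eq_mul_unop, MulOpposite.unop_op]
    rw [← hd]
    ring
  rw [q1, inner_add_left, real_inner_smul_left, real_inner_comm μ u,
    real_inner_comm μ, ← hk, ← hd]
  have hS' : (((σ ^ 2 + (S i i).toNNReal : ℝ≥0) : ℝ) : ℂ) = (s : ℂ) := by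
    rw [hs_def]; simp [hii]
  have hsc : (s : ℂ) ≠ 0 := by exact_mod_cast hs.ne'
  rw [hS']
  congr 1
  have hss : (S i i : ℂ) = s - (σ : ℂ) ^ 2 := by rw [hs_def]; push_cast; ring
  push_cast
  rw [hss]
  simp only [inner_zero_right, Complex.ofReal_zero]
  rw [add_sub_cancel]
  field_simp
  ring

/-- Bayes' rule for one noisy observation, for iterated integrals. -/
theorem lintegral_gaussian_observation {σ : ℝ≥0} (hσ : 0 < σ) (μ : EuclideanSpace ℝ ι)
    {S : Matrix ι ι ℝ} (hS : S.PosSemidef) (i : ι) {g : EuclideanSpace ℝ ι × ℝ → ℝ≥0∞}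
    (hg : Measurable g) :
    ∫⁻ x, ∫⁻ w, g (x, x i + w) ∂gaussianReal 0 (σ ^ 2) ∂multivariateGaussian μ S =
      ∫⁻ y, ∫⁻ x, g (x, y)
        ∂multivariateGaussian
          (μ + ((y - μ i) / ((σ : ℝ) ^ 2 + S i i)) • WithLp.toLp 2 (fun x => S x i)) (condCov σ S i)
        ∂gaussianReal (μ i) (σ ^ 2 + (S i i).toNNReal) := by
  have h := congrArg (fun ν => ∫⁻ p, g p ∂ν) (map_prod_gaussian_observation hσ μ hS i)
  simp only at h
  rw [lintegral_map hg (by fun_prop), lintegral_map hg (by fun_prop),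
    lintegral_prod _ (by fun_prop), lintegral_prod _ (by fun_prop)] at h
  rw [h]
  refine lintegral_congr fun y => ?_
  rw [multivariateGaussian_eq_map_add (μ + _), lintegral_map (by fun_prop) (by fun_prop)]

end GaussianBayes

/-! ### The law of the play, round by round -/

theorem clip01_mem (x : ℝ) : clip01 x ∈ Set.Icc (0 : ℝ) 1 := by
  unfold clip01
  exact ⟨le_max_left _ _, max_le zero_le_one (min_le_right _ _)⟩

theorem FullInfoAlgorithm.lintegral_actionKernel {A : Type*} [Fintype A] [MeasurableSpace A]
    [MeasurableSingletonClass A] (adv : FullInfoAlgorithm A) (t : ℕ) (h : Fin t → A × (A → ℝ))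
    (g : A → ℝ≥0∞) :
    ∫⁻ a, g a ∂adv.actionKernel t h = ∑ a, ENNReal.ofReal (adv.prob t h a) * g a := by
  change ∫⁻ a, g a ∂(∑ a, ENNReal.ofReal (adv.prob t h a) • Measure.dirac a : Measure A) = _
  rw [lintegral_finsetSum_measure]
  simp [lintegral_smul_measure, lintegral_dirac]

theorem FullInfoAlgorithm.sum_ofReal_prob {A : Type*} [Fintype A] [MeasurableSpace A]
    (adv : FullInfoAlgorithm A) (t : ℕ) (h : Fin t → A × (A → ℝ)) :
    ∑ a, ENNReal.ofReal (adv.prob t h a) = 1 := by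
  rw [← ENNReal.ofReal_sum_of_nonneg fun a _ => adv.prob_nonneg t h a, adv.prob_sum,
    ENNReal.ofReal_one]

/-- The law of the `m` standard normal variables per action used in one sampling step. -/
abbrev sampleLaw (A : Type*) [Fintype A] (m : ℕ) : Measure (Fin m → A → ℝ) :=
  Measure.pi fun _ => Measure.pi fun _ => gaussianReal 0 1

/-- Alice's history `H_n` as part of the full record of the first `n` rounds. -/
abbrev obsOf {A B : Type*} {n : ℕ} (h : Fin n → Round A B) : Fin n → Obs A B := fun i => (h i).1

/-- The past actions and imagined reward vectors, i.e. the input of the adversarial algorithm. -/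
abbrev advPast {A B : Type*} {n : ℕ} (h : Fin n → Round A B) : Fin n → A × (A → ℝ) :=
  fun i => ((h i).1.1, (h i).2)

namespace GaussianGame

variable {A B Θ : Type*} [Fintype A] [Fintype B] [DecidableEq A] [DecidableEq B]
  [MeasurableSpace A] [MeasurableSingletonClass A] [MeasurableSpace B] [MeasurableSingletonClass B]
  [MeasurableSpace Θ] (G : GaussianGame A B Θ) (σ : ℝ≥0)

/-- The record `h` of `n` rounds, extended by a round with actions `a` and `b`, observation `y` and
sampling variables `z`. -/
def appendRound (n m : ℕ) (b : B) (h : Fin n → Round A B) (a : A) (y : ℝ) (z : Fin m → A → ℝ) :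
    Fin (n + 1) → Round A B :=
  Fin.snoc h ((a, b, y), G.imagined σ n m (obsOf h) b z)

@[simp]
theorem appendRound_castSucc (n m : ℕ) (b : B) (h : Fin n → Round A B) (a : A) (y : ℝ)
    (z : Fin m → A → ℝ) (i : Fin n) : G.appendRound σ n m b h a y z i.castSucc = h i := by
  simp [appendRound]

@[simp]
theorem appendRound_last (n m : ℕ) (b : B) (h : Fin n → Round A B) (a : A) (y : ℝ)
    (z : Fin m → A → ℝ) : G.appendRound σ n m b h a y z (Fin.last n) =
      ((a, b, y), G.imagined σ n m (obsOf h) b z) := by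
  simp [appendRound]

theorem advPast_appendRound (n m : ℕ) (b : B) (h : Fin n → Round A B) (a : A) (y : ℝ)
    (z : Fin m → A → ℝ) : advPast (G.appendRound σ n m b h a y z) =
      Fin.snoc (advPast h) (a, G.imagined σ n m (obsOf h) b z) := by
  funext i
  refine Fin.lastCases ?_ (fun j => ?_) i <;> simp

theorem measurable_imagined (n m : ℕ) (b : B) {α : Type*} [MeasurableSpace α]
    {h : α → Fin n → Round A B} {z : α → Fin m → A → ℝ} (hh : Measurable h) (hz : Measurable z) :
    Measurable fun x => G.imagined σ n m (obsOf (h x)) b (z x) := by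
  refine measurable_pi_lambda _ fun a => ?_
  unfold imagined
  refine measurable_clip01.comp (Measurable.iSup fun j => ?_)
  have ho : Measurable fun x => obsOf (h x) := by unfold obsOf; fun_prop
  have h1 : Measurable fun x => G.postMean σ n (obsOf (h x)) a b :=
    ((G.measurable_posterior σ n).1 (a, b)).comp ho
  have h2 : Measurable fun x => G.postStd σ n (obsOf (h x)) a b :=
    (((G.measurable_posterior σ n).2 (a, b) (a, b)).comp ho).sqrt
  fun_prop

@[fun_prop]
theorem measurable_appendRound (n m : ℕ) (b : B) {α : Type*} [MeasurableSpace α]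
    {h : α → Fin n → Round A B} {a : α → A} {y : α → ℝ} {z : α → Fin m → A → ℝ}
    (hh : Measurable h) (ha : Measurable a) (hy : Measurable y) (hz : Measurable z) :
    Measurable fun x => G.appendRound σ n m b (h x) (a x) (y x) (z x) := by
  refine measurable_pi_lambda _ fun i => ?_
  refine Fin.lastCases ?_ (fun j => ?_) i
  · simp only [appendRound_last]
    have h2 := G.measurable_imagined σ n m b hh hz
    exact Measurable.prodMk (by fun_prop) h2
  · simp only [appendRound_castSucc]
    fun_prop

theorem extend_eq_appendRound (n m : ℕ) (b : B) (θ : Θ) (h : Fin n → Round A B)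
    (q : A × ℝ × (Fin m → A → ℝ)) :
    G.extend σ n m b (θ, h, q) =
      G.appendRound σ n m b h q.1 (G.f θ (q.1, b) + q.2.1) q.2.2 := rfl

theorem lintegral_noiseKernel (adv : FullInfoAlgorithm A) (n m : ℕ) (p : Θ × (Fin n → Round A B))
    {g : A × ℝ × (Fin m → A → ℝ) → ℝ≥0∞} (hg : Measurable g) :
    ∫⁻ q, g q ∂noiseKernel σ adv n m p =
      ∑ a, ENNReal.ofReal (adv.prob n (advPast p.2) a) *
        ∫⁻ z, ∫⁻ w, g (a, w, z) ∂gaussianReal 0 (σ ^ 2) ∂sampleLaw A m := by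
  unfold noiseKernel
  rw [Kernel.lintegral_prod _ _ _ hg, Kernel.comap_apply, adv.lintegral_actionKernel]
  refine Finset.sum_congr rfl fun a _ => ?_
  rw [Kernel.const_apply, lintegral_prod_symm _ (by fun_prop)]

variable (adv : FullInfoAlgorithm A) (M : ℕ → ℕ) (b : ℕ → B)

theorem lintegral_law_succ_noise (n : ℕ) (θ : Θ) {g : (Fin (n + 1) → Round A B) → ℝ≥0∞}
    (hg : Measurable g) :
    ∫⁻ h, g h ∂G.law σ adv M b (n + 1) θ =
      ∫⁻ h, ∫⁻ q, g (G.extend σ n (M n) (b n) (θ, h, q)) ∂noiseKernel σ adv n (M n) (θ, h)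
        ∂G.law σ adv M b n θ := by
  have he := G.measurable_extend σ n (M n) (b n)
  rw [law, Kernel.lintegral_map _ he _ hg,
    Kernel.lintegral_id_prod (f := fun p => g (G.extend σ n (M n) (b n) p)) (by fun_prop),
    Kernel.lintegral_compProd _ _ _ (f := fun p => g (G.extend σ n (M n) (b n) (θ, p)))
      (by fun_prop)]

/-- One round of play: the law of the first `n + 1` rounds in terms of that of the first `n`. -/
theorem lintegral_law_succ (n : ℕ) (θ : Θ) {g : (Fin (n + 1) → Round A B) → ℝ≥0∞}
    (hg : Measurable g) :
    ∫⁻ h, g h ∂G.law σ adv M b (n + 1) θ =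
      ∫⁻ h, ∑ a, ENNReal.ofReal (adv.prob n (advPast h) a) *
        ∫⁻ z, ∫⁻ w, g (G.appendRound σ n (M n) (b n) h a (G.f θ (a, b n) + w) z)
          ∂gaussianReal 0 (σ ^ 2) ∂sampleLaw A (M n) ∂G.law σ adv M b n θ := by
  have he := G.measurable_extend σ n (M n) (b n)
  rw [lintegral_law_succ_noise _ _ _ _ _ _ _ hg]
  refine lintegral_congr fun h => ?_
  rw [lintegral_noiseKernel _ _ _ _ _ (by fun_prop)]
  rfl

/-- The last round can be forgotten. -/
theorem lintegral_law_succ_init (n : ℕ) (θ : Θ) {g : (Fin n → Round A B) → ℝ≥0∞}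
    (hg : Measurable g) :
    ∫⁻ h, g (fun i => h i.castSucc) ∂G.law σ adv M b (n + 1) θ =
      ∫⁻ h, g h ∂G.law σ adv M b n θ := by
  rw [lintegral_law_succ_noise _ _ _ _ _ _ _ (by fun_prop)]
  simp [extend_eq_appendRound]

/-- The joint law of the parameter and of the record of the first `n` rounds. -/
def playLaw (n : ℕ) : Measure (Θ × (Fin n → Round A B)) := G.prior ⊗ₘ G.law σ adv M b n

instance (n : ℕ) : IsProbabilityMeasure (G.playLaw σ adv M b n) := by
  unfold playLaw; infer_instance

theorem lintegral_playLaw (n : ℕ) {g : Θ × (Fin n → Round A B) → ℝ≥0∞} (hg : Measurable g) :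
    ∫⁻ p, g p ∂G.playLaw σ adv M b n = ∫⁻ θ, ∫⁻ h, g (θ, h) ∂G.law σ adv M b n θ ∂G.prior := by
  rw [playLaw, Measure.lintegral_compProd hg]

theorem lintegral_playLaw_succ (n : ℕ) {g : Θ × (Fin (n + 1) → Round A B) → ℝ≥0∞}
    (hg : Measurable g) :
    ∫⁻ p, g p ∂G.playLaw σ adv M b (n + 1) =
      ∫⁻ p, ∑ a, ENNReal.ofReal (adv.prob n (advPast p.2) a) *
        ∫⁻ z, ∫⁻ w, g (p.1, G.appendRound σ n (M n) (b n) p.2 a (G.f p.1 (a, b n) + w) z)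
          ∂gaussianReal 0 (σ ^ 2) ∂sampleLaw A (M n) ∂G.playLaw σ adv M b n := by
  have he := G.measurable_extend σ n (M n) (b n)
  rw [lintegral_playLaw _ _ _ _ _ _ hg]
  have hk : ∀ p : Θ × (Fin n → Round A B),
      ∑ a, ENNReal.ofReal (adv.prob n (advPast p.2) a) *
        ∫⁻ z, ∫⁻ w, g (p.1, G.appendRound σ n (M n) (b n) p.2 a (G.f p.1 (a, b n) + w) z)
          ∂gaussianReal 0 (σ ^ 2) ∂sampleLaw A (M n) =
      ∫⁻ q, g (p.1, G.extend σ n (M n) (b n) (p.1, p.2, q)) ∂noiseKernel σ adv n (M n) p := by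
    intro p
    rw [lintegral_noiseKernel _ _ _ _ _ (by fun_prop)]
    rfl
  simp only [hk]
  have hm : Measurable fun p : Θ × (Fin n → Round A B) =>
      ∫⁻ q, g (p.1, G.extend σ n (M n) (b n) (p.1, p.2, q)) ∂noiseKernel σ adv n (M n) p :=
    Measurable.lintegral_kernel_prod_right' (κ := noiseKernel σ adv n (M n))
      (f := fun r : (Θ × (Fin n → Round A B)) × _ =>
        g (r.1.1, G.extend σ n (M n) (b n) (r.1.1, r.1.2, r.2))) (by fun_prop)
  rw [lintegral_playLaw _ _ _ _ _ _ hm]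
  refine lintegral_congr fun θ => ?_
  rw [lintegral_law_succ_noise _ _ _ _ _ _ _ (by fun_prop)]

theorem map_init_playLaw (n : ℕ) :
    (G.playLaw σ adv M b (n + 1)).map (fun p => (p.1, fun i : Fin n => p.2 i.castSucc)) =
      G.playLaw σ adv M b n := by
  refine Measure.ext_of_lintegral _ fun g hg => ?_
  rw [lintegral_map hg (by fun_prop), lintegral_playLaw _ _ _ _ _ _ (by fun_prop),
    lintegral_playLaw _ _ _ _ _ _ hg]
  exact lintegral_congr fun θ => G.lintegral_law_succ_init σ adv M b n θ
    (g := fun h => g (θ, h)) (by fun_prop)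

/-- Almost surely all imagined rewards lie in `[0, 1]`. -/
theorem ae_imagined_mem (n : ℕ) (θ : Θ) :
    ∀ᵐ h ∂G.law σ adv M b n θ, ∀ t a, (h t).2 a ∈ Set.Icc (0 : ℝ) 1 := by
  have hms : ∀ n : ℕ,
      MeasurableSet {h : Fin n → Round A B | ∀ t a, (h t).2 a ∈ Set.Icc (0 : ℝ) 1} := by
    intro n
    simp only [Set.ofPred_forall]
    exact MeasurableSet.iInter fun t => MeasurableSet.iInter fun a =>
      (by fun_prop : Measurable fun h : Fin n → Round A B => (h t).2 a) measurableSet_Icc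
  induction n with
  | zero => exact Filter.Eventually.of_forall fun h t => t.elim0
  | succ n ih =>
    rw [ae_iff, ← Set.compl_ofPred, ← lintegral_indicator_one (hms _).compl,
      lintegral_law_succ_noise _ _ _ _ _ _ _ (measurable_one.indicator (hms _).compl)]
    rw [← lintegral_zero (μ := G.law σ adv M b n θ)]
    refine lintegral_congr_ae ?_
    filter_upwards [ih] with h hh
    rw [← lintegral_zero (μ := noiseKernel σ adv n (M n) (θ, h))]
    refine lintegral_congr fun q => ?_
    rw [Set.indicator_of_notMem]
    simp only [Set.mem_compl_iff, Set.mem_ofPred_eq, not_not, extend_eq_appendRound]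
    intro t
    refine Fin.lastCases ?_ (fun j => ?_) t
    · intro a
      rw [appendRound_last]
      exact clip01_mem _
    · simpa using hh j

end GaussianGame

/-! ### Hedge and Regret Matching against the imagined rewards -/

/-- The realized regret against the fixed action `a` of the past actions and reward vectors `x`. -/
def regretOf {A : Type*} {n : ℕ} (x : Fin n → A × (A → ℝ)) (a : A) : ℝ :=
  ∑ s, ((x s).2 a - (x s).2 (x s).1)

theorem regretOf_snoc {A : Type*} {n : ℕ} (x : Fin n → A × (A → ℝ)) (c : A) (r : A → ℝ) (a : A) :
    regretOf (Fin.snoc x (c, r) : Fin (n + 1) → A × (A → ℝ)) a = regretOf x a + (r a - r c) := by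
  simp [regretOf, Fin.sum_univ_castSucc]
  ring

@[fun_prop]
theorem measurable_regretOf {A : Type*} [Fintype A] [MeasurableSpace A]
    [MeasurableSingletonClass A] {n : ℕ} (a : A) :
    Measurable fun x : Fin n → A × (A → ℝ) => regretOf x a := by
  unfold regretOf
  refine Finset.measurable_sum _ fun s _ => Measurable.sub (by fun_prop) ?_
  exact measurable_eval_index (g := fun (x : Fin n → A × (A → ℝ)) i => (x s).2 i)
    (fun i => by fun_prop) (by fun_prop)

theorem abs_sub_le_one_of_mem_Icc {x y : ℝ} (hx : x ∈ Set.Icc (0 : ℝ) 1)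
    (hy : y ∈ Set.Icc (0 : ℝ) 1) : |x - y| ≤ 1 := by
  rw [abs_le]; constructor <;> linarith [hx.1, hx.2, hy.1, hy.2]

section Supermartingales

variable {A : Type*} [Fintype A]

/-- Symmetrized Hoeffding lemma: exchanging `a` and `c` turns the exponential into `cosh`. -/
theorem sum_sum_mul_exp_le {p r : A → ℝ} (hp : ∀ a, 0 ≤ p a) (hs : ∑ a, p a = 1)
    (hr : ∀ a, r a ∈ Set.Icc (0 : ℝ) 1) (η : ℝ) :
    ∑ c, ∑ a, p c * p a * Real.exp (η * (r a - r c)) ≤ Real.exp (η ^ 2 / 2) := by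
  have h1 : ∑ c, ∑ a, p c * p a * Real.exp (η * (r a - r c)) =
      ∑ c, ∑ a, p c * p a * Real.cosh (η * (r a - r c)) := by
    have h2 : ∑ c, ∑ a, p c * p a * Real.exp (η * (r a - r c)) =
        ∑ c, ∑ a, p c * p a * Real.exp (-(η * (r a - r c))) := by
      rw [Finset.sum_comm]
      refine Finset.sum_congr rfl fun c _ => Finset.sum_congr rfl fun a _ => ?_
      rw [mul_comm (p a)]
      congr 2
      ring
    have h3 : ∑ c, ∑ a, p c * p a * Real.cosh (η * (r a - r c)) =
        (∑ c, ∑ a, p c * p a * Real.exp (η * (r a - r c)) +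
          ∑ c, ∑ a, p c * p a * Real.exp (-(η * (r a - r c)))) / 2 := by
      rw [← Finset.sum_add_distrib, Finset.sum_div]
      refine Finset.sum_congr rfl fun c _ => ?_
      rw [← Finset.sum_add_distrib, Finset.sum_div]
      refine Finset.sum_congr rfl fun a _ => ?_
      rw [Real.cosh_eq]
      ring
    rw [h3, ← h2]
    ring
  rw [h1]
  calc ∑ c, ∑ a, p c * p a * Real.cosh (η * (r a - r c))
      ≤ ∑ c, ∑ a, p c * p a * Real.exp (η ^ 2 / 2) := by
        refine Finset.sum_le_sum fun c _ => Finset.sum_le_sum fun a _ => ?_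
        refine mul_le_mul_of_nonneg_left ?_ (mul_nonneg (hp c) (hp a))
        refine (Real.cosh_le_exp_half_sq _).trans (Real.exp_le_exp.2 ?_)
        have := (sq_le_one_iff_abs_le_one _).2 (abs_sub_le_one_of_mem_Icc (hr a) (hr c))
        rw [mul_pow]
        nlinarith [sq_nonneg η]
    _ = Real.exp (η ^ 2 / 2) := by
        simp only [← Finset.sum_mul, ← Finset.mul_sum, hs, mul_one, one_mul]

variable [MeasurableSpace A] [Nonempty A]

/-- This also holds if all weights vanish. -/
theorem proportional_mul_sum {X : A → ℝ} (hX : ∀ a, 0 ≤ X a) (a : A) :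
    proportional X a * ∑ j, X j = X a := by
  unfold proportional
  split_ifs with h
  · rw [h, mul_zero]
    exact ((Finset.sum_eq_zero_iff_of_nonneg fun j _ => hX j).1 h a (Finset.mem_univ a)).symm
  · exact div_mul_cancel₀ _ h

/-- The probabilities of Hedge are proportional to the exponentials of the regrets: these differ
from the weights of the algorithm by a factor that is common to all actions. -/
theorem hedge_prob_mul_sum (η : ℝ) {n : ℕ} (x : Fin n → A × (A → ℝ)) (a : A) :
    (hedge A fun _ => η).prob n x a * ∑ j, Real.exp (η * regretOf x j) =
      Real.exp (η * regretOf x a) := by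
  have h1 : ∀ j, Real.exp (η * regretOf x j) =
      Real.exp (-(η * ∑ s, (x s).2 (x s).1)) * ∏ s : Fin n, Real.exp (η * (x s).2 j) := by
    intro j
    rw [← Real.exp_sum, ← Real.exp_add, regretOf, Finset.sum_sub_distrib, ← Finset.mul_sum]
    congr 1
    ring
  simp only [h1]
  rw [← Finset.mul_sum, mul_left_comm]
  congr 1
  exact proportional_mul_sum (fun j => Finset.prod_nonneg fun _ _ => (Real.exp_pos _).le) a

/-- Under Hedge, the exponential potential of the regrets grows in expectation by a factor of at
most `exp (η² / 2)` per round. -/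
theorem hedge_potential_step (η : ℝ) {n : ℕ} (x : Fin n → A × (A → ℝ)) {r : A → ℝ}
    (hr : ∀ a, r a ∈ Set.Icc (0 : ℝ) 1) :
    ∑ c, (hedge A fun _ => η).prob n x c *
        ∑ a, Real.exp (η * regretOf (Fin.snoc x (c, r) : Fin (n + 1) → A × (A → ℝ)) a) ≤
      Real.exp (η ^ 2 / 2) * ∑ a, Real.exp (η * regretOf x a) := by
  set p := (hedge A fun _ => η).prob n x with hp
  set Z := ∑ a, Real.exp (η * regretOf x a) with hZ
  have h1 : ∀ c, p c * ∑ a, Real.exp (η * regretOf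
      (Fin.snoc x (c, r) : Fin (n + 1) → A × (A → ℝ)) a) =
      Z * ∑ a, p c * p a * Real.exp (η * (r a - r c)) := by
    intro c
    rw [Finset.mul_sum, Finset.mul_sum]
    refine Finset.sum_congr rfl fun a _ => ?_
    rw [regretOf_snoc, mul_add, Real.exp_add, ← hedge_prob_mul_sum η x a]
    ring
  simp only [h1]
  rw [← Finset.mul_sum, mul_comm]
  exact mul_le_mul_of_nonneg_right (sum_sum_mul_exp_le
    ((hedge A fun _ => η).prob_nonneg n x) ((hedge A fun _ => η).prob_sum n x) hr η)
    (Finset.sum_nonneg fun _ _ => (Real.exp_pos _).le)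

variable [MeasurableSingletonClass A]

/-- Under Regret Matching, the squared positive regrets grow in expectation by at most `|A|` per
round: by the choice of the probabilities, the vector of instantaneous regrets is orthogonal in
expectation to the vector of positive regrets. -/
theorem regretMatching_potential_step {n : ℕ} (x : Fin n → A × (A → ℝ)) {r : A → ℝ}
    (hr : ∀ a, r a ∈ Set.Icc (0 : ℝ) 1) :
    ∑ c, (regretMatching A).prob n x c *
        ∑ a, (max 0 (regretOf (Fin.snoc x (c, r) : Fin (n + 1) → A × (A → ℝ)) a)) ^ 2 ≤
      ∑ a, (max 0 (regretOf x a)) ^ 2 + Fintype.card A := by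
  set p := (regretMatching A).prob n x with hp
  have hp0 : ∀ c, 0 ≤ p c := (regretMatching A).prob_nonneg n x
  have hp1 : ∑ c, p c = 1 := (regretMatching A).prob_sum n x
  set X : A → ℝ := fun a => max 0 (regretOf x a) with hX
  have hpX : ∀ a, p a * ∑ j, X j = X a :=
    proportional_mul_sum (X := X) (fun a => le_max_left _ _)
  -- the orthogonality of instantaneous and positive regrets
  have horth : ∑ c, p c * ∑ a, X a * (r a - r c) = 0 := by
    have : ∀ c, p c * ∑ a, X a * (r a - r c) = p c * (∑ a, X a * r a) - X c * r c := by
      intro c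
      rw [← hpX c]
      simp only [mul_sub, Finset.sum_sub_distrib, ← Finset.sum_mul]
      ring
    simp only [this, Finset.sum_sub_distrib, ← Finset.sum_mul, hp1]
    ring
  have hterm : ∀ c, p c * ∑ a, (max 0 (regretOf (Fin.snoc x (c, r) :
      Fin (n + 1) → A × (A → ℝ)) a)) ^ 2 ≤
      p c * (∑ a, X a ^ 2 + Fintype.card A) + 2 * (p c * ∑ a, X a * (r a - r c)) := by
    intro c
    have : ∑ a, (max 0 (regretOf (Fin.snoc x (c, r) : Fin (n + 1) → A × (A → ℝ)) a)) ^ 2 ≤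
        ∑ a, (X a ^ 2 + 1 + 2 * (X a * (r a - r c))) := by
      refine Finset.sum_le_sum fun a _ => ?_
      rw [regretOf_snoc]
      have hg := (sq_le_one_iff_abs_le_one _).2 (abs_sub_le_one_of_mem_Icc (hr a) (hr c))
      have hd : regretOf x a ≤ X a := le_max_right _ _
      rcases le_total (regretOf x a + (r a - r c)) 0 with h | h
      · rw [max_eq_left h]
        nlinarith [sq_nonneg (X a + (r a - r c)), sq_nonneg (X a), sq_nonneg (r a - r c)]
      · rw [max_eq_right h]
        nlinarith [mul_self_le_mul_self h (by linarith : regretOf x a + (r a - r c) ≤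
          X a + (r a - r c))]
    refine (mul_le_mul_of_nonneg_left this (hp0 c)).trans (le_of_eq ?_)
    rw [Finset.sum_add_distrib, Finset.sum_add_distrib, ← Finset.mul_sum]
    simp
    ring
  refine (Finset.sum_le_sum fun c _ => hterm c).trans (le_of_eq ?_)
  rw [Finset.sum_add_distrib, ← Finset.mul_sum, horth, ← Finset.sum_mul, hp1]
  ring

end Supermartingales

namespace GaussianGame

variable {A B Θ : Type*} [Fintype A] [Fintype B] [DecidableEq A] [DecidableEq B]
  [MeasurableSpace A] [MeasurableSingletonClass A] [MeasurableSpace B] [MeasurableSingletonClass B]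
  [MeasurableSpace Θ] (G : GaussianGame A B Θ) (σ : ℝ≥0)
  (adv : FullInfoAlgorithm A) (M : ℕ → ℕ) (b : ℕ → B)

/-- A potential that grows in expectation at most affinely against every reward vector does so
along the play, because the action is drawn independently of the current imagined rewards. -/
theorem lintegral_potential_succ_le (n : ℕ) (θ : Θ) {F : (Fin n → A × (A → ℝ)) → ℝ}
    {F' : (Fin (n + 1) → A × (A → ℝ)) → ℝ} (hF : Measurable F) (hF' : Measurable F')
    (hF0 : ∀ x, 0 ≤ F x) (hF'0 : ∀ x, 0 ≤ F' x) {α β : ℝ} (hα : 0 ≤ α) (hβ : 0 ≤ β)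
    (h : ∀ x (r : A → ℝ), (∀ a, r a ∈ Set.Icc (0 : ℝ) 1) →
      ∑ c, adv.prob n x c * F' (Fin.snoc x (c, r) : Fin (n + 1) → A × (A → ℝ)) ≤ α * F x + β) :
    ∫⁻ h, ENNReal.ofReal (F' (advPast h)) ∂G.law σ adv M b (n + 1) θ ≤
      ENNReal.ofReal α * ∫⁻ h, ENNReal.ofReal (F (advPast h)) ∂G.law σ adv M b n θ +
        ENNReal.ofReal β := by
  have hp : ∀ n : ℕ, Measurable fun h : Fin n → Round A B => advPast h := by
    intro n; unfold advPast; fun_prop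
  have m1 : Measurable fun h : Fin n → Round A B => F (advPast h) := hF.comp (hp n)
  have m2 : Measurable fun h : Fin (n + 1) → Round A B => F' (advPast h) := hF'.comp (hp (n + 1))
  rw [lintegral_law_succ _ _ _ _ _ _ _ m2.ennreal_ofReal]
  have hβ' : ENNReal.ofReal β = ∫⁻ _, ENNReal.ofReal β ∂G.law σ adv M b n θ := by simp
  rw [hβ', ← lintegral_const_mul _ m1.ennreal_ofReal, ← lintegral_add_right _ measurable_const]
  refine lintegral_mono fun x => ?_
  have hm : ∀ c, Measurable fun z : Fin (M n) → A → ℝ =>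
      F' (advPast (G.appendRound σ n (M n) (b n) x c 0 z)) := fun c => m2.comp (by fun_prop)
  have h0 : ∀ c (z : Fin (M n) → A → ℝ) (y : ℝ),
      ENNReal.ofReal (F' (advPast (G.appendRound σ n (M n) (b n) x c y z))) =
      ENNReal.ofReal (F' (advPast (G.appendRound σ n (M n) (b n) x c 0 z))) := by
    intro c z y
    rw [advPast_appendRound, advPast_appendRound]
  simp only [h0, lintegral_const, measure_univ, mul_one]
  simp only [← lintegral_const_mul _ (hm _).ennreal_ofReal]
  rw [← lintegral_finsetSum _ fun c _ => ((hm c).ennreal_ofReal).const_mul _]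
  calc _ ≤ ∫⁻ _, (ENNReal.ofReal α * ENNReal.ofReal (F (advPast x)) + ENNReal.ofReal β)
        ∂sampleLaw A (M n) := by
        refine lintegral_mono fun z => ?_
        simp only [← ENNReal.ofReal_mul (adv.prob_nonneg _ _ _)]
        rw [← ENNReal.ofReal_sum_of_nonneg
          fun c _ => mul_nonneg (adv.prob_nonneg _ _ _) (hF'0 _),
          ← ENNReal.ofReal_mul hα, ← ENNReal.ofReal_add (mul_nonneg hα (hF0 _)) hβ]
        refine ENNReal.ofReal_le_ofReal ?_
        simp only [advPast_appendRound]
        exact h _ _ fun a => clip01_mem _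
    _ = _ := by simp

theorem ae_abs_regretOf_le (n : ℕ) (θ : Θ) (a : A) :
    ∀ᵐ h ∂G.law σ adv M b n θ, |regretOf (advPast h) a| ≤ n := by
  filter_upwards [G.ae_imagined_mem σ adv M b n θ] with h hh
  refine (Finset.abs_sum_le_sum_abs _ _).trans ?_
  refine (Finset.sum_le_sum fun s _ => abs_sub_le_one_of_mem_Icc (hh s a) (hh s _)).trans ?_
  simp

theorem measurable_regretOf_advPast (n : ℕ) (a : A) :
    Measurable fun h : Fin n → Round A B => regretOf (advPast h) a :=
  (measurable_regretOf a).comp (by unfold advPast; fun_prop)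

theorem integrable_regretOf (n : ℕ) (θ : Θ) (a : A) :
    Integrable (fun h => regretOf (advPast h) a) (G.law σ adv M b n θ) :=
  Integrable.of_bound (measurable_regretOf_advPast n a).aestronglyMeasurable n
    (G.ae_abs_regretOf_le σ adv M b n θ a)

/-- The regret of Hedge at an arbitrary step size, from the exponential potential. -/
theorem integral_regretOf_hedge_le [Nonempty A] (n : ℕ) (θ : Θ) (a : A) {η : ℝ} (hη : 0 < η) :
    ∫ h, regretOf (advPast h) a ∂G.law σ (hedge A fun _ => η) M b n θ ≤
      (Real.log (Fintype.card A) + n * (η ^ 2 / 2)) / η := by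
  set y := Real.log (Fintype.card A) + n * (η ^ 2 / 2) with hy
  have hk : (0 : ℝ) < Fintype.card A := by exact_mod_cast Fintype.card_pos
  have hpot : ∀ n : ℕ, ∫⁻ h, ENNReal.ofReal (∑ a, Real.exp (η * regretOf (advPast h) a))
      ∂G.law σ (hedge A fun _ => η) M b n θ ≤
      ENNReal.ofReal (Fintype.card A * Real.exp (n * (η ^ 2 / 2))) := by
    intro n
    induction n with
    | zero => simp [regretOf]
    | succ n ih =>
      refine (G.lintegral_potential_succ_le σ _ M b n θ
        (F := fun x => ∑ a, Real.exp (η * regretOf x a))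
        (F' := fun x => ∑ a, Real.exp (η * regretOf x a)) (by fun_prop) (by fun_prop)
        (fun x => Finset.sum_nonneg fun _ _ => (Real.exp_pos _).le)
        (fun x => Finset.sum_nonneg fun _ _ => (Real.exp_pos _).le)
        (Real.exp_pos (η ^ 2 / 2)).le le_rfl
        (fun x r hr => by simpa using hedge_potential_step η x hr)).trans ?_
      rw [ENNReal.ofReal_zero, add_zero]
      refine (mul_le_mul_right ih _).trans ?_
      rw [← ENNReal.ofReal_mul (Real.exp_pos _).le]
      refine ENNReal.ofReal_le_ofReal (le_of_eq ?_)
      rw [mul_left_comm, ← Real.exp_add]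
      push_cast
      ring_nf
  have hexp : ∫⁻ h, ENNReal.ofReal (Real.exp (η * regretOf (advPast h) a))
      ∂G.law σ (hedge A fun _ => η) M b n θ ≤ ENNReal.ofReal (Real.exp y) := by
    rw [hy, Real.exp_add, Real.exp_log hk]
    refine le_trans (lintegral_mono fun h => ENNReal.ofReal_le_ofReal ?_) (hpot n)
    exact Finset.single_le_sum (f := fun a => Real.exp (η * regretOf (advPast h) a))
      (fun _ _ => (Real.exp_pos _).le) (Finset.mem_univ a)
  have hmeas : Measurable fun h : Fin n → Round A B => Real.exp (η * regretOf (advPast h) a) :=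
    ((measurable_regretOf_advPast n a).const_mul η).exp
  have hint : Integrable (fun h => Real.exp (η * regretOf (advPast h) a))
      (G.law σ (hedge A fun _ => η) M b n θ) := by
    refine ⟨hmeas.aestronglyMeasurable, ?_⟩
    rw [hasFiniteIntegral_iff_ofReal (Filter.Eventually.of_forall fun _ => (Real.exp_pos _).le)]
    exact hexp.trans_lt ENNReal.ofReal_lt_top
  have hle : ∫ h, Real.exp (η * regretOf (advPast h) a)
      ∂G.law σ (hedge A fun _ => η) M b n θ ≤ Real.exp y := by
    rw [integral_eq_lintegral_of_nonneg_ae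
      (Filter.Eventually.of_forall fun _ => (Real.exp_pos _).le) hmeas.aestronglyMeasurable]
    exact ENNReal.toReal_le_of_le_ofReal (Real.exp_pos _).le hexp
  have hi := G.integrable_regretOf σ (hedge A fun _ => η) M b n θ a
  -- Jensen's inequality, through the tangent line of `exp` at `y`
  have htan : ∫ h, Real.exp y * (η * regretOf (advPast h) a + (1 - y))
      ∂G.law σ (hedge A fun _ => η) M b n θ ≤ Real.exp y := by
    refine le_trans (integral_mono (((hi.const_mul η).add (integrable_const _)).const_mul _) hint
      fun h => ?_) hle
    have := Real.add_one_le_exp (η * regretOf (advPast h) a - y)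
    have h2 : Real.exp (η * regretOf (advPast h) a) =
      Real.exp y * Real.exp (η * regretOf (advPast h) a - y) := by
      rw [← Real.exp_add]; ring_nf
    simp only [h2]
    exact mul_le_mul_of_nonneg_left (by linarith) (Real.exp_pos _).le
  rw [integral_const_mul, integral_add (hi.const_mul η) (integrable_const _), integral_const_mul,
    integral_const] at htan
  simp only [probReal_univ, smul_eq_mul, one_mul] at htan
  rw [le_div_iff₀ hη]
  have := (mul_le_iff_le_one_right (Real.exp_pos y)).1 htan
  linarith

/-- The regret of Regret Matching, from the quadratic potential. -/
theorem integral_regretOf_regretMatching_le [Nonempty A] (n : ℕ) (θ : Θ) (a : A) :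
    ∫ h, regretOf (advPast h) a ∂G.law σ (regretMatching A) M b n θ ≤
      √(n * Fintype.card A) := by
  have hpot : ∀ n : ℕ, ∫⁻ h, ENNReal.ofReal (∑ a, (max 0 (regretOf (advPast h) a)) ^ 2)
      ∂G.law σ (regretMatching A) M b n θ ≤ ENNReal.ofReal (n * Fintype.card A) := by
    intro n
    induction n with
    | zero => simp [regretOf]
    | succ n ih =>
      refine (G.lintegral_potential_succ_le σ _ M b n θ
        (F := fun x => ∑ a, (max 0 (regretOf x a)) ^ 2)
        (F' := fun x => ∑ a, (max 0 (regretOf x a)) ^ 2) (by fun_prop) (by fun_prop)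
        (fun x => Finset.sum_nonneg fun _ _ => sq_nonneg _)
        (fun x => Finset.sum_nonneg fun _ _ => sq_nonneg _)
        zero_le_one (Nat.cast_nonneg _)
        (fun x r hr => by simpa using regretMatching_potential_step x hr)).trans ?_
      rw [ENNReal.ofReal_one, one_mul]
      refine (add_le_add_left ih _).trans (le_of_eq ?_)
      rw [← ENNReal.ofReal_add (by positivity) (by positivity)]
      push_cast
      ring_nf
  rcases Nat.eq_zero_or_pos n with rfl | hn
  · simp [regretOf]
  have hk : (0 : ℝ) < Fintype.card A := by exact_mod_cast Fintype.card_pos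
  have hn' : (0 : ℝ) < n := by exact_mod_cast hn
  set l := √(n * Fintype.card A) with hl
  have hl0 : 0 < l := Real.sqrt_pos.2 (by positivity)
  have hl2 : l ^ 2 = n * Fintype.card A := Real.sq_sqrt (by positivity)
  have hmeas : Measurable fun h : Fin n → Round A B => (max 0 (regretOf (advPast h) a)) ^ 2 :=
    (measurable_const.max (measurable_regretOf_advPast n a)).pow_const 2
  have hsq : ∫⁻ h, ENNReal.ofReal ((max 0 (regretOf (advPast h) a)) ^ 2)
      ∂G.law σ (regretMatching A) M b n θ ≤ ENNReal.ofReal (l ^ 2) := by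
    rw [hl2]
    refine le_trans (lintegral_mono fun h => ENNReal.ofReal_le_ofReal ?_) (hpot n)
    exact Finset.single_le_sum (f := fun a => (max 0 (regretOf (advPast h) a)) ^ 2)
      (fun _ _ => sq_nonneg _) (Finset.mem_univ a)
  have hint : Integrable (fun h => (max 0 (regretOf (advPast h) a)) ^ 2)
      (G.law σ (regretMatching A) M b n θ) := by
    refine ⟨hmeas.aestronglyMeasurable, ?_⟩
    rw [hasFiniteIntegral_iff_ofReal (Filter.Eventually.of_forall fun _ => sq_nonneg _)]
    exact hsq.trans_lt ENNReal.ofReal_lt_top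
  have hle : ∫ h, (max 0 (regretOf (advPast h) a)) ^ 2
      ∂G.law σ (regretMatching A) M b n θ ≤ l ^ 2 := by
    rw [integral_eq_lintegral_of_nonneg_ae
      (Filter.Eventually.of_forall fun _ => sq_nonneg _) hmeas.aestronglyMeasurable]
    exact ENNReal.toReal_le_of_le_ofReal (sq_nonneg _) hsq
  -- Jensen's inequality, through `X ≤ X ^ 2 / (2 l) + l / 2`
  calc ∫ h, regretOf (advPast h) a ∂G.law σ (regretMatching A) M b n θ
      ≤ ∫ h, ((max 0 (regretOf (advPast h) a)) ^ 2 * (1 / (2 * l)) + l / 2)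
        ∂G.law σ (regretMatching A) M b n θ := by
        refine integral_mono (G.integrable_regretOf σ _ M b n θ a)
          ((hint.mul_const _).add (integrable_const _)) fun h => ?_
        have h1 : regretOf (advPast h) a ≤ max 0 (regretOf (advPast h) a) := le_max_right _ _
        generalize max 0 (regretOf (advPast h) a) = X at h1
        refine h1.trans ?_
        have h2 : X ^ 2 * (1 / (2 * l)) + l / 2 - X = (X - l) ^ 2 / (2 * l) := by
          field_simp
          ring
        have h3 : 0 ≤ (X - l) ^ 2 / (2 * l) := by positivity
        linarith
    _ ≤ l ^ 2 * (1 / (2 * l)) + l / 2 := by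
        rw [integral_add (hint.mul_const _) (integrable_const _), integral_mul_const]
        simp only [integral_const, probReal_univ, smul_eq_mul, one_mul]
        gcongr
    _ = l := by field_simp; ring

theorem fullRegret_eq (T : ℕ) (θ : Θ) : G.fullRegret σ adv M b T θ =
    ⨆ a : A, ∫ h, regretOf (advPast h) a ∂G.law σ adv M b T θ := rfl

theorem fullRegret_hedge_le [Nonempty A] (T : ℕ) (θ : Θ) :
    G.fullRegret σ (hedge A fun _ => √(8 * Real.log (Fintype.card A) / T)) M b T θ ≤
      2 * √(T * Real.log (Fintype.card A)) := by
  rw [fullRegret_eq]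
  refine ciSup_le fun a => ?_
  rcases Nat.eq_zero_or_pos T with rfl | hT
  · simp [regretOf]
  have hk1 : 1 ≤ Fintype.card A := Fintype.card_pos
  rcases hk1.eq_or_lt with hk | hk
  -- for a single action the step size vanishes, and so does the regret
  · have : Subsingleton A := Fintype.card_le_one_iff_subsingleton.1 hk.symm.le
    have h0 : ∀ h : Fin T → Round A B, regretOf (advPast h) a = 0 := fun h =>
      Finset.sum_eq_zero fun s _ => by rw [Subsingleton.elim (advPast h s).1 a, sub_self]
    simp only [h0, integral_zero]
    positivity
  have hL : 0 < Real.log (Fintype.card A) := Real.log_pos (by exact_mod_cast hk)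
  have hT' : (0 : ℝ) < T := by exact_mod_cast hT
  set L := Real.log (Fintype.card A) with hLdef
  have hη : 0 < √(8 * L / T) := Real.sqrt_pos.2 (by positivity)
  refine (G.integral_regretOf_hedge_le σ M b T θ a hη).trans ?_
  rw [div_le_iff₀ hη, Real.sq_sqrt (by positivity), mul_assoc, ← Real.sqrt_mul (by positivity)]
  have h1 : T * L * (8 * L / T) = 8 * L ^ 2 := by field_simp
  rw [h1, Real.sqrt_mul (by norm_num), Real.sqrt_sq hL.le]
  have h2 : (2.5 : ℝ) ≤ √8 := Real.le_sqrt_of_sq_le (by norm_num)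
  have h3 : (T : ℝ) * (8 * L / T / 2) = 4 * L := by field_simp; norm_num
  rw [← hLdef, h3]
  nlinarith

theorem fullRegret_regretMatching_le [Nonempty A] (T : ℕ) (θ : Θ) :
    G.fullRegret σ (regretMatching A) M b T θ ≤ √(T * Fintype.card A) := by
  rw [fullRegret_eq]
  exact ciSup_le fun a => G.integral_regretOf_regretMatching_le σ M b T θ a

end GaussianGame

/-! ### The Gaussian posterior given the record of play -/

namespace GaussianGame

variable {A B Θ : Type*} [Fintype A] [Fintype B] [DecidableEq A] [DecidableEq B]
  [MeasurableSpace A] [MeasurableSingletonClass A] [MeasurableSpace B] [MeasurableSingletonClass B]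
  [MeasurableSpace Θ] (G : GaussianGame A B Θ) (σ : ℝ≥0)

/-- The Gaussian posterior law of the mean rewards given the history `o`. -/
def postLaw (n : ℕ) (o : Fin n → Obs A B) : Measure (EuclideanSpace ℝ (A × B)) :=
  multivariateGaussian (WithLp.toLp 2 (G.posterior σ n o).1) (Matrix.of (G.posterior σ n o).2)

instance (n : ℕ) (o : Fin n → Obs A B) : IsProbabilityMeasure (G.postLaw σ n o) := by
  unfold postLaw; infer_instance

/-- The posterior variance `σ_n(a, b)²`. -/
def postVar (n : ℕ) (o : Fin n → Obs A B) (x : A × B) : ℝ := (G.posterior σ n o).2 x x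

/-- The variance of the next observation given the history, if the action pair `x` is played. -/
def predVar (n : ℕ) (o : Fin n → Obs A B) (x : A × B) : ℝ≥0 :=
  σ ^ 2 + (G.postVar σ n o x).toNNReal

/-- The law of the next observation given the history, if the action pair `x` is played. -/
def predLaw (n : ℕ) (o : Fin n → Obs A B) (x : A × B) : Measure ℝ :=
  gaussianReal ((G.posterior σ n o).1 x) (G.predVar σ n o x)

instance (n : ℕ) (o : Fin n → Obs A B) (x : A × B) : IsProbabilityMeasure (G.predLaw σ n o x) := by
  unfold predLaw; infer_instance

theorem posterior_appendRound (n m : ℕ) (b : B) (h : Fin n → Round A B) (a : A) (y : ℝ)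
    (z : Fin m → A → ℝ) : G.posterior σ (n + 1) (obsOf (G.appendRound σ n m b h a y z)) =
      gaussianUpdate σ (G.posterior σ n (obsOf h)) (a, b) y := by
  simp [posterior, obsOf]

variable {σ} in
theorem posSemidef_posterior (hσ : 0 < σ) (n : ℕ) (o : Fin n → Obs A B) :
    (Matrix.of (G.posterior σ n o).2).PosSemidef := by
  induction n with
  | zero => exact G.posSemidef_cov
  | succ n ih =>
    exact posSemidef_condCov hσ (ih fun i => o i.castSucc)
      ((o (Fin.last n)).1, (o (Fin.last n)).2.1)

variable {σ} in
theorem postVar_nonneg (hσ : 0 < σ) (n : ℕ) (o : Fin n → Obs A B) (x : A × B) :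
    0 ≤ G.postVar σ n o x := (G.posSemidef_posterior hσ n o).diag_nonneg

variable {σ} in
theorem postVar_le_cov (hσ : 0 < σ) (n : ℕ) (o : Fin n → Obs A B) (x : A × B) :
    G.postVar σ n o x ≤ G.cov x x := by
  induction n with
  | zero => exact le_rfl
  | succ n ih =>
    refine le_trans ?_ (ih fun i => o i.castSucc)
    have hp := G.posSemidef_posterior hσ n fun i => o i.castSucc
    set S := (G.posterior σ n fun i => o i.castSucc).2 with hS
    set i := ((o (Fin.last n)).1, (o (Fin.last n)).2.1) with hi
    have hii : 0 ≤ S i i := hp.diag_nonneg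
    have hsym : S i x = S x i := by simpa using hp.1.apply x i
    have : 0 ≤ S x i * S i x / ((σ : ℝ) ^ 2 + S i i) := by
      rw [hsym]
      exact div_nonneg (mul_self_nonneg _) (by positivity)
    change S x x - S x i * S i x / ((σ : ℝ) ^ 2 + S i i) ≤ S x x
    linarith

theorem coe_predVar (n : ℕ) (o : Fin n → Obs A B) (x : A × B) (h : 0 ≤ G.postVar σ n o x) :
    (G.predVar σ n o x : ℝ) = (σ : ℝ) ^ 2 + G.postVar σ n o x := by
  simp [predVar, h]

theorem postLaw_appendRound (n m : ℕ) (b : B) (h : Fin n → Round A B) (a : A) (y : ℝ)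
    (z : Fin m → A → ℝ) : G.postLaw σ (n + 1) (obsOf (G.appendRound σ n m b h a y z)) =
      multivariateGaussian (WithLp.toLp 2 (G.posterior σ n (obsOf h)).1 +
          ((y - (G.posterior σ n (obsOf h)).1 (a, b)) /
            ((σ : ℝ) ^ 2 + (Matrix.of (G.posterior σ n (obsOf h)).2) (a, b) (a, b))) •
            WithLp.toLp 2 fun x => Matrix.of (G.posterior σ n (obsOf h)).2 x (a, b))
        (condCov σ (Matrix.of (G.posterior σ n (obsOf h)).2) (a, b)) := by
  rw [postLaw, posterior_appendRound]
  congr 1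
  ext x
  simp [gaussianUpdate]
  ring

/-- The posterior covariance depends on the history only through the actions played. -/
theorem posterior_cov_eq (n : ℕ) (o : Fin n → Obs A B) :
    (G.posterior σ n o).2 = (G.posterior σ n fun i => ((o i).1, (o i).2.1, 0)).2 := by
  induction n with
  | zero => rfl
  | succ n ih =>
    simp only [posterior, gaussianUpdate]
    rw [ih fun i => o i.castSucc]

@[fun_prop]
theorem measurable_posterior_fst (n : ℕ) {α : Type*} [MeasurableSpace α] {o : α → Fin n → Obs A B}
    (ho : Measurable o) (x : A × B) : Measurable fun p => (G.posterior σ n (o p)).1 x :=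
  ((G.measurable_posterior σ n).1 x).comp ho

@[fun_prop]
theorem measurable_postVar (n : ℕ) {α : Type*} [MeasurableSpace α] {o : α → Fin n → Obs A B}
    (ho : Measurable o) (x : A × B) : Measurable fun p => G.postVar σ n (o p) x :=
  ((G.measurable_posterior σ n).2 x x).comp ho

@[fun_prop]
theorem measurable_predVar (n : ℕ) {α : Type*} [MeasurableSpace α] {o : α → Fin n → Obs A B}
    (ho : Measurable o) (x : A × B) : Measurable fun p => G.predVar σ n (o p) x :=
  (G.measurable_postVar σ n ho x).real_toNNReal.const_add _

theorem measurable_lintegral_postLaw (n : ℕ) {α : Type*} [MeasurableSpace α]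
    {o : α → Fin n → Obs A B} (ho : Measurable o) {g : α × EuclideanSpace ℝ (A × B) → ℝ≥0∞}
    (hg : Measurable g) : Measurable fun p => ∫⁻ e, g (p, e) ∂G.postLaw σ n (o p) := by
  -- for each of the finitely many action sequences `c`, the posterior is a fixed centred Gaussian
  -- law, translated by the posterior mean
  let C : (Fin n → A × B) → Matrix (A × B) (A × B) ℝ := fun c =>
    Matrix.of (G.posterior σ n fun i => ((c i).1, (c i).2, 0)).2
  let F : α → (Fin n → A × B) → ℝ≥0∞ := fun p c =>
    ∫⁻ e, g (p, WithLp.toLp 2 (G.posterior σ n (o p)).1 + e) ∂multivariateGaussian 0 (C c)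
  have hmean : Measurable fun p => WithLp.toLp 2 (G.posterior σ n (o p)).1 := by fun_prop
  have hF : ∀ c, Measurable fun p => F p c := fun c => by
    refine Measurable.lintegral_prod_right' (ν := multivariateGaussian 0 (C c))
      (f := fun q : α × EuclideanSpace ℝ (A × B) => g (q.1,
      WithLp.toLp 2 (G.posterior σ n (o q.1)).1 + q.2)) ?_
    fun_prop
  have hz : Measurable fun (p : α) (i : Fin n) => ((o p i).1, (o p i).2.1) := by fun_prop
  convert measurable_eval_index hF hz using 2 with p
  simp only [F, postLaw, C]
  rw [multivariateGaussian_eq_map_add, lintegral_map (by fun_prop) (by fun_prop),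
    G.posterior_cov_eq σ n (o p)]

variable (adv : FullInfoAlgorithm A) (M : ℕ → ℕ) (b : ℕ → B)

@[fun_prop]
theorem measurable_prob_advPast {adv : FullInfoAlgorithm A} (n : ℕ) {α : Type*} [MeasurableSpace α]
    {h : α → Fin n → Round A B} (hh : Measurable h) (a : A) :
    Measurable fun p => adv.prob n (advPast (h p)) a :=
  (adv.measurable_prob n a).comp (by unfold advPast; fun_prop)

/-- The sampling variables and the noise of one round, integrated out, leave a measurable function
of the mean rewards and the past. -/
theorem measurable_lintegral_round {adv : FullInfoAlgorithm A} (n m : ℕ) {α : Type*}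
    [MeasurableSpace α] {h : α → Fin n → Round A B} (hh : Measurable h)
    {g : α → A → (Fin m → A → ℝ) → ℝ → ℝ≥0∞}
    (hg : ∀ a, Measurable fun q : (α × (Fin m → A → ℝ)) × ℝ => g q.1.1 a q.1.2 q.2)
    (ν : Measure ℝ) [SFinite ν] :
    Measurable fun p => ∑ a, ENNReal.ofReal (adv.prob n (advPast (h p)) a) *
      ∫⁻ z, ∫⁻ w, g p a z w ∂ν ∂sampleLaw A m := by
  refine Finset.measurable_sum _ fun a _ => Measurable.mul (by fun_prop) ?_
  exact Measurable.lintegral_prod_right' (f := fun q : α × (Fin m → A → ℝ) =>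
    ∫⁻ w, g q.1 a q.2 w ∂ν) (Measurable.lintegral_prod_right' (hg a))

/-- Inductive step of `lintegral_posterior`: if the mean rewards have the Gaussian posterior given
the first `n` rounds, then a further round can be drawn by first drawing the observation from its
predictive law and then the mean rewards from the updated posterior. -/
theorem lintegral_playLaw_succ_of_posterior {σ : ℝ≥0} (hσ : 0 < σ) (n : ℕ)
    (ih : ∀ g : EuclideanSpace ℝ (A × B) × (Fin n → Round A B) → ℝ≥0∞, Measurable g →
      ∫⁻ p, g (G.f p.1, p.2) ∂G.playLaw σ adv M b n =
        ∫⁻ p, ∫⁻ e, g (e, p.2) ∂G.postLaw σ n (obsOf p.2) ∂G.playLaw σ adv M b n)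
    {g : EuclideanSpace ℝ (A × B) × (Fin (n + 1) → Round A B) → ℝ≥0∞} (hg : Measurable g) :
    ∫⁻ p, g (G.f p.1, p.2) ∂G.playLaw σ adv M b (n + 1) =
      ∫⁻ p, ∑ a, ENNReal.ofReal (adv.prob n (advPast p.2) a) *
        ∫⁻ z, ∫⁻ y, ∫⁻ e, g (e, G.appendRound σ n (M n) (b n) p.2 a y z)
          ∂G.postLaw σ (n + 1) (obsOf (G.appendRound σ n (M n) (b n) p.2 a y z))
          ∂G.predLaw σ n (obsOf p.2) (a, b n) ∂sampleLaw A (M n) ∂G.playLaw σ adv M b n := by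
  have hf := G.measurable_f
  rw [lintegral_playLaw_succ _ _ _ _ _ _ (by fun_prop)]
  have hm : Measurable fun q : EuclideanSpace ℝ (A × B) × (Fin n → Round A B) =>
      ∑ a, ENNReal.ofReal (adv.prob n (advPast q.2) a) *
        ∫⁻ z, ∫⁻ w, g (q.1, G.appendRound σ n (M n) (b n) q.2 a (q.1 (a, b n) + w) z)
          ∂gaussianReal 0 (σ ^ 2) ∂sampleLaw A (M n) :=
    measurable_lintegral_round n (M n) measurable_snd
      (g := fun q a z w => g (q.1, G.appendRound σ n (M n) (b n) q.2 a (q.1 (a, b n) + w) z))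
      (fun a => by fun_prop) _
  rw [ih _ hm]
  refine lintegral_congr fun p => ?_
  have hmz : ∀ a, Measurable fun q : EuclideanSpace ℝ (A × B) × (Fin (M n) → A → ℝ) =>
      ∫⁻ w, g (q.1, G.appendRound σ n (M n) (b n) p.2 a (q.1 (a, b n) + w) q.2)
        ∂gaussianReal 0 (σ ^ 2) := fun a =>
    Measurable.lintegral_prod_right' (ν := gaussianReal 0 (σ ^ 2))
      (f := fun r : (EuclideanSpace ℝ (A × B) × (Fin (M n) → A → ℝ)) × ℝ =>
        g (r.1.1, G.appendRound σ n (M n) (b n) p.2 a (r.1.1 (a, b n) + r.2) r.1.2)) (by fun_prop)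
  have hme : ∀ a, Measurable fun e : EuclideanSpace ℝ (A × B) => ∫⁻ z, ∫⁻ w,
      g (e, G.appendRound σ n (M n) (b n) p.2 a (e (a, b n) + w) z)
        ∂gaussianReal 0 (σ ^ 2) ∂sampleLaw A (M n) := fun a => (hmz a).lintegral_prod_right'
  dsimp only
  rw [lintegral_finsetSum _ fun a _ => (hme a).const_mul _]
  refine Finset.sum_congr rfl fun a _ => ?_
  rw [lintegral_const_mul _ (hme a)]
  congr 1
  rw [lintegral_lintegral_swap (hmz a).aemeasurable]
  refine lintegral_congr fun z => ?_
  have := lintegral_gaussian_observation hσ (WithLp.toLp 2 (G.posterior σ n (obsOf p.2)).1)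
    (G.posSemidef_posterior hσ n (obsOf p.2)) (a, b n)
    (g := fun r => g (r.1, G.appendRound σ n (M n) (b n) p.2 a r.2 z)) (by fun_prop)
  refine this.trans ?_
  refine lintegral_congr fun y => ?_
  rw [postLaw_appendRound]

/-- Given the record of the first `n` rounds, the mean rewards have the law `postLaw`. -/
theorem lintegral_posterior {σ : ℝ≥0} (hσ : 0 < σ) (n : ℕ)
    {g : EuclideanSpace ℝ (A × B) × (Fin n → Round A B) → ℝ≥0∞} (hg : Measurable g) :
    ∫⁻ p, g (G.f p.1, p.2) ∂G.playLaw σ adv M b n =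
      ∫⁻ p, ∫⁻ e, g (e, p.2) ∂G.postLaw σ n (obsOf p.2) ∂G.playLaw σ adv M b n := by
  have hf := G.measurable_f
  have ho : ∀ n : ℕ, Measurable fun h : Fin n → Round A B => obsOf h := by
    intro n; unfold obsOf; fun_prop
  induction n with
  | zero =>
    have hm : Measurable fun p : Θ × (Fin 0 → Round A B) =>
        ∫⁻ e, g (e, p.2) ∂G.postLaw σ 0 (obsOf p.2) :=
      G.measurable_lintegral_postLaw σ 0 ((ho 0).comp measurable_snd)
        (g := fun q => g (q.2, q.1.2)) (by fun_prop)
    rw [lintegral_playLaw _ _ _ _ _ _ (by fun_prop), lintegral_playLaw _ _ _ _ _ _ hm]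
    have h0 : ∀ h : Fin 0 → Round A B, h = Fin.elim0 := fun h => Subsingleton.elim _ _
    have hp : G.postLaw σ 0 (obsOf (Fin.elim0 : Fin 0 → Round A B)) = G.prior.map G.f := by
      rw [G.map_prior]; rfl
    simp only [h0, lintegral_const, measure_univ, mul_one]
    rw [hp, lintegral_map (by fun_prop) hf]
  | succ n ih =>
    rw [G.lintegral_playLaw_succ_of_posterior adv M b hσ n (fun g hg => ih hg) hg]
    have hm := (G.measurable_lintegral_postLaw σ (n + 1) (ho (n + 1))
        (g := fun q => g (q.2, q.1)) (by fun_prop))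
    have := G.lintegral_playLaw_succ_of_posterior adv M b hσ n (fun g hg => ih hg)
      (g := fun q => ∫⁻ e, g (e, q.2) ∂G.postLaw σ (n + 1) (obsOf q.2)) (hm.comp measurable_snd)
    rw [this]
    simp

/-- Given the record of the first `n` rounds and the actions of round `n`, the observation has the
law `predLaw`. -/
theorem lintegral_predictive {σ : ℝ≥0} (hσ : 0 < σ) (n : ℕ) {g : (Fin (n + 1) → Round A B) → ℝ≥0∞}
    (hg : Measurable g) :
    ∫⁻ p, g p.2 ∂G.playLaw σ adv M b (n + 1) =
      ∫⁻ p, ∑ a, ENNReal.ofReal (adv.prob n (advPast p.2) a) *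
        ∫⁻ z, ∫⁻ y, g (G.appendRound σ n (M n) (b n) p.2 a y z)
          ∂G.predLaw σ n (obsOf p.2) (a, b n) ∂sampleLaw A (M n) ∂G.playLaw σ adv M b n := by
  rw [G.lintegral_playLaw_succ_of_posterior adv M b hσ n
    (fun g hg => G.lintegral_posterior adv M b hσ n hg) (g := fun q => g q.2) (by fun_prop)]
  simp

end GaussianGame

/-! ### The mutual information of parameter and history -/

theorem lintegral_gaussian_translate (m : ℝ) (v : ℝ≥0) {g : ℝ → ℝ≥0∞} (hg : Measurable g) :
    ∫⁻ w, g (m + w) ∂gaussianReal 0 v = ∫⁻ y, g y ∂gaussianReal m v := by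
  have := gaussianReal_map_const_add (μ := 0) (v := v) m
  rw [zero_add] at this
  rw [← this, lintegral_map hg (by fun_prop)]

/-- Change of measure between two Gaussian laws, by the ratio of their densities. -/
theorem lintegral_gaussian_change (m₁ m₂ : ℝ) {v₁ v₂ : ℝ≥0} (h₁ : v₁ ≠ 0) (h₂ : v₂ ≠ 0)
    {g : ℝ → ℝ≥0∞} (hg : Measurable g) :
    ∫⁻ y, g y ∂gaussianReal m₁ v₁ =
      ∫⁻ y, ENNReal.ofReal (Real.exp (Real.log (gaussianPDFReal m₁ v₁ y) -
        Real.log (gaussianPDFReal m₂ v₂ y))) * g y ∂gaussianReal m₂ v₂ := by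
  rw [gaussianReal_of_var_ne_zero _ h₁, gaussianReal_of_var_ne_zero _ h₂,
    lintegral_withDensity_eq_lintegral_mul _ (measurable_gaussianPDF _ _) hg,
    lintegral_withDensity_eq_lintegral_mul _ (measurable_gaussianPDF _ _) (by fun_prop)]
  refine lintegral_congr fun y => ?_
  have p1 := gaussianPDFReal_pos m₁ v₁ y h₁
  have p2 := gaussianPDFReal_pos m₂ v₂ y h₂
  simp only [Pi.mul_apply, gaussianPDF]
  rw [← mul_assoc, ← ENNReal.ofReal_mul p2.le, Real.exp_sub, Real.exp_log p1, Real.exp_log p2,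
    mul_div_cancel₀ _ p2.ne']

/-- A standardized Gaussian variable has second moment one. -/
theorem lintegral_gaussian_sq_div (m : ℝ) {v : ℝ≥0} (hv : v ≠ 0) :
    ∫⁻ y, ENNReal.ofReal ((y - m) ^ 2 / v) ∂gaussianReal m v = 1 := by
  have hv' : (v : ℝ) ≠ 0 := by exact_mod_cast hv
  have hvar := variance_fun_id_gaussianReal (μ := m) (v := v)
  rw [variance_eq_integral (by fun_prop), integral_id_gaussianReal] at hvar
  have hint : Integrable (fun y => (y - m) ^ 2) (gaussianReal m v) :=
    ((memLp_id_gaussianReal 2).sub (memLp_const m)).integrable_sq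
  rw [← ofReal_integral_eq_lintegral_ofReal (hint.div_const _)
    (Filter.Eventually.of_forall fun y => by positivity), integral_div, hvar, div_self hv',
    ENNReal.ofReal_one]

theorem integrable_and_integral_eq_one {α : Type*} [MeasurableSpace α] {μ : Measure α} {Q : α → ℝ}
    (hQ : Measurable Q) (h0 : ∀ x, 0 ≤ Q x) (h : ∫⁻ x, ENNReal.ofReal (Q x) ∂μ = 1) :
    Integrable Q μ ∧ ∫ x, Q x ∂μ = 1 := by
  refine ⟨⟨hQ.aestronglyMeasurable, ?_⟩, ?_⟩
  · rw [hasFiniteIntegral_iff_ofReal (Filter.Eventually.of_forall h0), h]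
    exact ENNReal.one_lt_top
  · rw [integral_eq_lintegral_of_nonneg_ae (Filter.Eventually.of_forall h0)
      hQ.aestronglyMeasurable, h, ENNReal.toReal_one]

theorem log_gaussianPDFReal (m : ℝ) {v : ℝ≥0} (hv : v ≠ 0) (y : ℝ) :
    Real.log (gaussianPDFReal m v y) =
      -(Real.log (2 * Real.pi) + Real.log v + (y - m) ^ 2 / v) / 2 := by
  have hv' : (0 : ℝ) < v := by exact_mod_cast pos_iff_ne_zero.2 hv
  have hpi : 0 < 2 * Real.pi := by positivity
  rw [gaussianPDFReal, Real.log_mul (by positivity) (Real.exp_pos _).ne', Real.log_exp,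
    Real.log_inv, Real.log_sqrt (by positivity), Real.log_mul hpi.ne' hv'.ne']
  ring

/-- The relative entropy is the mean of the logarithm of the density. -/
theorem klDiv_of_eq_withDensity_exp {α : Type*} [MeasurableSpace α] {μ ν : Measure α}
    [IsProbabilityMeasure μ] [IsProbabilityMeasure ν] {l : α → ℝ} (hl : Measurable l)
    (h : μ = ν.withDensity fun x => ENNReal.ofReal (Real.exp (l x))) (hint : Integrable l μ) :
    InformationTheory.klDiv μ ν ≠ ∞ ∧ (InformationTheory.klDiv μ ν).toReal = ∫ x, l x ∂μ := by
  have hac : μ ≪ ν := by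
    rw [h]
    exact withDensity_absolutelyContinuous _ _
  have hllr : llr μ ν =ᵐ[μ] l := by
    refine hac.ae_le ?_
    have hr := Measure.rnDeriv_withDensity ν
      (f := fun x => ENNReal.ofReal (Real.exp (l x))) (by fun_prop)
    rw [← h] at hr
    filter_upwards [hr] with q hq
    rw [llr, hq, ENNReal.toReal_ofReal (Real.exp_pos _).le, Real.log_exp]
  exact ⟨InformationTheory.klDiv_ne_top hac (hint.congr hllr.symm),
    (InformationTheory.toReal_klDiv_of_measure_eq hac (by simp)).trans (integral_congr_ae hllr)⟩

/-- The sum over the rounds `t < n` of the terms `φ t (H_t) (A_t, B_t)`. -/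
def histSum {A B : Type*} (φ : (n : ℕ) → (Fin n → Obs A B) → A × B → ℝ) :
    (n : ℕ) → (Fin n → Obs A B) → ℝ
  | 0, _ => 0
  | n + 1, o => histSum φ n (fun i => o i.castSucc) +
      φ n (fun i => o i.castSucc) ((o (Fin.last n)).1, (o (Fin.last n)).2.1)

theorem histSum_le {A B : Type*} {φ ψ : (n : ℕ) → (Fin n → Obs A B) → A × B → ℝ} {α β : ℝ}
    (h : ∀ n o x, φ n o x ≤ α * ψ n o x + β) (n : ℕ) (o : Fin n → Obs A B) :
    histSum φ n o ≤ α * histSum ψ n o + n * β := by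
  induction n with
  | zero => simp [histSum]
  | succ n ih =>
    have h1 := ih fun i => o i.castSucc
    have h2 := h n (fun i => o i.castSucc) ((o (Fin.last n)).1, (o (Fin.last n)).2.1)
    simp only [histSum]
    push_cast
    linarith

theorem histSum_nonneg {A B : Type*} {φ : (n : ℕ) → (Fin n → Obs A B) → A × B → ℝ}
    (h : ∀ n o x, 0 ≤ φ n o x) (n : ℕ) (o : Fin n → Obs A B) : 0 ≤ histSum φ n o := by
  induction n with
  | zero => exact le_rfl
  | succ n ih => exact add_nonneg (ih _) (h _ _ _)

theorem measurable_histSum {A B : Type*} [Finite A] [Finite B] [MeasurableSpace A]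
    [MeasurableSingletonClass A] [MeasurableSpace B] [MeasurableSingletonClass B]
    {φ : (n : ℕ) → (Fin n → Obs A B) → A × B → ℝ}
    (h : ∀ n x, Measurable fun o => φ n o x) (n : ℕ) : Measurable (histSum φ n) := by
  induction n with
  | zero => exact measurable_const
  | succ n ih =>
    refine (ih.comp (by fun_prop)).add ?_
    exact measurable_eval_index (g := fun (o : Fin (n + 1) → Obs A B) x =>
      φ n (fun i => o i.castSucc) x) (fun x => (h n x).comp (by fun_prop)) (by fun_prop)

namespace GaussianGame

variable {A B Θ : Type*} [Fintype A] [Fintype B] [DecidableEq A] [DecidableEq B]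
  [MeasurableSpace A] [MeasurableSingletonClass A] [MeasurableSpace B] [MeasurableSingletonClass B]
  [MeasurableSpace Θ] (G : GaussianGame A B Θ) (σ : ℝ≥0)

/-- The logarithm of the density, at parameter `θ` and history `o`, of the joint law of parameter
and history with respect to the product of its marginals: the log-ratio of the likelihood of the
observations to their predictive densities. -/
def logRatio (θ : Θ) : (n : ℕ) → (Fin n → Obs A B) → ℝ
  | 0, _ => 0
  | n + 1, o => logRatio θ n (fun i => o i.castSucc) +
      (Real.log (gaussianPDFReal (G.f θ ((o (Fin.last n)).1, (o (Fin.last n)).2.1)) (σ ^ 2)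
          (o (Fin.last n)).2.2) -
        Real.log (gaussianPDFReal
          ((G.posterior σ n fun i => o i.castSucc).1 ((o (Fin.last n)).1, (o (Fin.last n)).2.1))
          (G.predVar σ n (fun i => o i.castSucc) ((o (Fin.last n)).1, (o (Fin.last n)).2.1))
          (o (Fin.last n)).2.2))

@[fun_prop]
theorem measurable_logRatio (n : ℕ) {α : Type*} [MeasurableSpace α] {θ : α → Θ}
    {o : α → Fin n → Obs A B} (hθ : Measurable θ) (ho : Measurable o) :
    Measurable fun p => G.logRatio σ (θ p) n (o p) := by
  induction n with
  | zero => exact measurable_const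
  | succ n ih =>
    have hf := G.measurable_f
    have hi : Measurable fun p i => o p (Fin.castSucc i) := by fun_prop
    have hx : Measurable fun p => ((o p (Fin.last n)).1, (o p (Fin.last n)).2.1) := by fun_prop
    have hy : Measurable fun p => (o p (Fin.last n)).2.2 := by fun_prop
    have h1 := measurable_eval_index (g := fun p x => G.f (θ p) x) (fun x => by fun_prop) hx
    have h2 := measurable_eval_index (g := fun p x => (G.posterior σ n fun i => o p i.castSucc).1 x)
      (fun x => by fun_prop) hx
    have h3 := measurable_eval_index (g := fun p x => G.predVar σ n (fun i => o p i.castSucc) x)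
      (fun x => by fun_prop) hx
    have hpdf := measurable_uncurry_gaussianPDFReal
    simp only [logRatio]
    exact (ih hi).add ((hpdf.comp (h1.prodMk (measurable_const.prodMk hy))).log.sub
      (hpdf.comp (h2.prodMk (h3.prodMk hy))).log)

theorem logRatio_appendRound (θ : Θ) (n m : ℕ) (b : B) (h : Fin n → Round A B) (a : A) (y : ℝ)
    (z : Fin m → A → ℝ) : G.logRatio σ θ (n + 1) (obsOf (G.appendRound σ n m b h a y z)) =
      G.logRatio σ θ n (obsOf h) + (Real.log (gaussianPDFReal (G.f θ (a, b)) (σ ^ 2) y) -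
        Real.log (gaussianPDFReal ((G.posterior σ n (obsOf h)).1 (a, b))
          (G.predVar σ n (obsOf h) (a, b)) y)) := by
  simp [logRatio, obsOf]

variable {σ} in
theorem predVar_ne_zero (hσ : 0 < σ) (n : ℕ) (o : Fin n → Obs A B) (x : A × B) :
    G.predVar σ n o x ≠ 0 := by
  unfold predVar; positivity

/-- The information gained in round `n` about the parameter, given the history. -/
def infoTerm (n : ℕ) (o : Fin n → Obs A B) (x : A × B) : ℝ :=
  1 / 2 * Real.log (1 + G.postVar σ n o x / (σ : ℝ) ^ 2)

variable (adv : FullInfoAlgorithm A) (M : ℕ → ℕ) (b : ℕ → B)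

variable {σ}

/-- `exp logRatio` is the density of the joint law of the parameter and of the record of play with
respect to the product of its marginals. -/
theorem lintegral_playLaw_eq_logRatio (hσ : 0 < σ) (n : ℕ)
    {g : Θ × (Fin n → Round A B) → ℝ≥0∞} (hg : Measurable g) :
    ∫⁻ p, g p ∂G.playLaw σ adv M b n =
      ∫⁻ θ, ∫⁻ p, ENNReal.ofReal (Real.exp (G.logRatio σ θ n (obsOf p.2))) * g (θ, p.2)
        ∂G.playLaw σ adv M b n ∂G.prior := by
  have hf := G.measurable_f
  have ho : ∀ n : ℕ, Measurable fun h : Fin n → Round A B => obsOf h := by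
    intro n; unfold obsOf; fun_prop
  induction n with
  | zero =>
    rw [lintegral_playLaw _ _ _ _ _ _ hg]
    have h0 : ∀ h : Fin 0 → Round A B, h = Fin.elim0 := fun h => Subsingleton.elim _ _
    simp [logRatio, h0]
  | succ n ih =>
    have hm : Measurable fun p : Θ × (Fin n → Round A B) =>
        ∑ a, ENNReal.ofReal (adv.prob n (advPast p.2) a) *
        ∫⁻ z, ∫⁻ w, g (p.1, G.appendRound σ n (M n) (b n) p.2 a (G.f p.1 (a, b n) + w) z)
          ∂gaussianReal 0 (σ ^ 2) ∂sampleLaw A (M n) :=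
      measurable_lintegral_round n (M n) measurable_snd (g := fun p a z w =>
        g (p.1, G.appendRound σ n (M n) (b n) p.2 a (G.f p.1 (a, b n) + w) z))
        (fun a => by fun_prop) _
    rw [lintegral_playLaw_succ _ _ _ _ _ _ hg, ih hm]
    refine lintegral_congr fun θ => ?_
    have hθ : Measurable fun h : Fin (n + 1) → Round A B =>
        ENNReal.ofReal (Real.exp (G.logRatio σ θ (n + 1) (obsOf h))) * g (θ, h) := by
      have := ho (n + 1)
      fun_prop
    rw [G.lintegral_predictive adv M b hσ n hθ]
    refine lintegral_congr fun p => ?_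
    rw [Finset.mul_sum]
    refine Finset.sum_congr rfl fun a _ => ?_
    rw [mul_left_comm]
    congr 1
    have hga : Measurable fun q : (Fin (M n) → A → ℝ) × ℝ =>
        g (θ, G.appendRound σ n (M n) (b n) p.2 a (G.f θ (a, b n) + q.2) q.1) := by fun_prop
    rw [← lintegral_const_mul _ hga.lintegral_prod_right']
    refine lintegral_congr fun z => ?_
    rw [lintegral_gaussian_translate (G.f θ (a, b n)) (σ ^ 2)
      (g := fun y => g (θ, G.appendRound σ n (M n) (b n) p.2 a y z)) (by fun_prop),
      lintegral_gaussian_change _ ((G.posterior σ n (obsOf p.2)).1 (a, b n)) (by positivity)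
        (G.predVar_ne_zero hσ n (obsOf p.2) (a, b n)) (by fun_prop),
      ← lintegral_const_mul _ (by fun_prop)]
    refine lintegral_congr fun y => ?_
    rw [logRatio_appendRound, Real.exp_add, ENNReal.ofReal_mul (Real.exp_pos _).le, mul_assoc]

theorem infoTerm_nonneg (hσ : 0 < σ) (n : ℕ) (o : Fin n → Obs A B) (x : A × B) :
    0 ≤ G.infoTerm σ n o x := by
  have := div_nonneg (G.postVar_nonneg hσ n o x) (sq_nonneg (σ : ℝ))
  exact mul_nonneg (by norm_num) (Real.log_nonneg (by linarith))

theorem measurable_infoTerm (n : ℕ) (x : A × B) :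
    Measurable fun o : Fin n → Obs A B => G.infoTerm σ n o x := by
  unfold infoTerm
  exact (((G.measurable_postVar σ n measurable_id x).div_const _).const_add 1).log.const_mul _

theorem infoTerm_le (hσ : 0 < σ) (hcov : ∀ x, G.cov x x ≤ 1) (n : ℕ) (o : Fin n → Obs A B)
    (x : A × B) : G.infoTerm σ n o x ≤ 1 / (σ : ℝ) ^ 2 := by
  have hσ2 : (0 : ℝ) < (σ : ℝ) ^ 2 := by positivity
  have h0 := G.postVar_nonneg hσ n o x
  have h1 := (G.postVar_le_cov hσ n o x).trans (hcov x)
  have h2 : Real.log (1 + G.postVar σ n o x / (σ : ℝ) ^ 2) ≤ G.postVar σ n o x / (σ : ℝ) ^ 2 := by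
    have := Real.log_le_sub_one_of_pos (x := 1 + G.postVar σ n o x / (σ : ℝ) ^ 2) (by positivity)
    linarith
  have h3 : G.postVar σ n o x / (σ : ℝ) ^ 2 ≤ 1 / (σ : ℝ) ^ 2 := by gcongr
  have h4 : 0 ≤ G.postVar σ n o x / (σ : ℝ) ^ 2 := by positivity
  unfold infoTerm
  linarith

theorem integrable_histSum {φ : (n : ℕ) → (Fin n → Obs A B) → A × B → ℝ}
    (h : ∀ n x, Measurable fun o => φ n o x) (h0 : ∀ n o x, 0 ≤ φ n o x) {β : ℝ}
    (hβ : ∀ n o x, φ n o x ≤ β) (n : ℕ) :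
    Integrable (fun p => histSum φ n (obsOf p.2)) (G.playLaw σ adv M b n) := by
  refine Integrable.of_bound ((measurable_histSum h n).comp
    (by unfold obsOf; fun_prop)).aestronglyMeasurable (n * β)
    (Filter.Eventually.of_forall fun p => ?_)
  rw [Real.norm_of_nonneg (histSum_nonneg h0 n _)]
  simpa using histSum_le (φ := φ) (ψ := φ) (α := 0) (β := β) (by simpa using hβ) n (obsOf p.2)

/-- The squared standardized observation noise of the last round. -/
def noiseSq (σ : ℝ≥0) (n : ℕ) (p : Θ × (Fin (n + 1) → Round A B)) : ℝ :=
  ((p.2 (Fin.last n)).1.2.2 - G.f p.1 ((p.2 (Fin.last n)).1.1, (p.2 (Fin.last n)).1.2.1)) ^ 2 /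
    ((σ ^ 2 : ℝ≥0) : ℝ)

/-- The squared standardized prediction error of the last round. -/
def innovationSq (σ : ℝ≥0) (n : ℕ) (h : Fin (n + 1) → Round A B) : ℝ :=
  ((h (Fin.last n)).1.2.2 - (G.posterior σ n fun i => (h i.castSucc).1).1
      ((h (Fin.last n)).1.1, (h (Fin.last n)).1.2.1)) ^ 2 /
    (G.predVar σ n (fun i => (h i.castSucc).1)
      ((h (Fin.last n)).1.1, (h (Fin.last n)).1.2.1) : ℝ)

theorem measurable_noiseSq (n : ℕ) : Measurable (G.noiseSq σ n) := by
  have hf := G.measurable_f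
  have hx : Measurable fun p : Θ × (Fin (n + 1) → Round A B) =>
    ((p.2 (Fin.last n)).1.1, (p.2 (Fin.last n)).1.2.1) := by fun_prop
  have hy : Measurable fun p : Θ × (Fin (n + 1) → Round A B) => (p.2 (Fin.last n)).1.2.2 := by
    fun_prop
  have h1 := measurable_eval_index (g := fun (p : Θ × (Fin (n + 1) → Round A B)) x => G.f p.1 x)
    (fun x => by fun_prop) hx
  exact ((hy.sub h1).pow_const 2).div_const _

theorem measurable_innovationSq (n : ℕ) : Measurable (G.innovationSq σ n) := by
  have hx : Measurable fun h : Fin (n + 1) → Round A B =>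
    ((h (Fin.last n)).1.1, (h (Fin.last n)).1.2.1) := by fun_prop
  have hy : Measurable fun h : Fin (n + 1) → Round A B => (h (Fin.last n)).1.2.2 := by fun_prop
  have h1 := measurable_eval_index (g := fun (h : Fin (n + 1) → Round A B) x =>
    (G.posterior σ n fun i => (h i.castSucc).1).1 x) (fun x => by fun_prop) hx
  have h2 := measurable_eval_index (g := fun (h : Fin (n + 1) → Round A B) x =>
    G.predVar σ n (fun i => (h i.castSucc).1) x) (fun x => by fun_prop) hx
  exact ((hy.sub h1).pow_const 2).div h2.coe_nnreal_real

theorem noiseSq_nonneg (n : ℕ) (p : Θ × (Fin (n + 1) → Round A B)) : 0 ≤ G.noiseSq σ n p := by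
  unfold noiseSq; positivity

theorem innovationSq_nonneg (n : ℕ) (h : Fin (n + 1) → Round A B) : 0 ≤ G.innovationSq σ n h := by
  unfold innovationSq; positivity

theorem lintegral_noiseSq (hσ : 0 < σ) (n : ℕ) :
    ∫⁻ p, ENNReal.ofReal (G.noiseSq σ n p) ∂G.playLaw σ adv M b (n + 1) = 1 := by
  rw [lintegral_playLaw_succ _ _ _ _ _ _ (G.measurable_noiseSq n).ennreal_ofReal]
  have := lintegral_gaussian_sq_div 0 (by positivity : (σ ^ 2 : ℝ≥0) ≠ 0)
  simp only [sub_zero] at this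
  simp only [noiseSq, appendRound_last, add_sub_cancel_left, this]
  simp [adv.sum_ofReal_prob]

theorem lintegral_innovationSq (hσ : 0 < σ) (n : ℕ) :
    ∫⁻ p, ENNReal.ofReal (G.innovationSq σ n p.2) ∂G.playLaw σ adv M b (n + 1) = 1 := by
  rw [G.lintegral_predictive adv M b hσ n (G.measurable_innovationSq n).ennreal_ofReal]
  have : ∀ (p : Θ × (Fin n → Round A B)) a (z : Fin (M n) → A → ℝ),
      ∫⁻ y, ENNReal.ofReal (G.innovationSq σ n (G.appendRound σ n (M n) (b n) p.2 a y z))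
        ∂G.predLaw σ n (obsOf p.2) (a, b n) = 1 := by
    intro p a z
    simp only [innovationSq, appendRound_last, appendRound_castSucc]
    exact lintegral_gaussian_sq_div _ (G.predVar_ne_zero hσ n (obsOf p.2) (a, b n))
  simp only [this]
  simp [adv.sum_ofReal_prob]

/-- The log-ratio of one round is the information gained in it plus a difference of squares. -/
theorem logRatio_succ (hσ : 0 < σ) (n : ℕ) (p : Θ × (Fin (n + 1) → Round A B)) :
    G.logRatio σ p.1 (n + 1) (obsOf p.2) =
      (G.logRatio σ p.1 n (fun i => (p.2 i.castSucc).1) +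
        (histSum (G.infoTerm σ) (n + 1) (obsOf p.2) -
          histSum (G.infoTerm σ) n (fun i => (p.2 i.castSucc).1))) +
        (1 / 2 * G.innovationSq σ n p.2 - 1 / 2 * G.noiseSq σ n p) := by
  have hσ2 : (σ ^ 2 : ℝ≥0) ≠ 0 := by positivity
  simp only [logRatio, histSum, obsOf, noiseSq, innovationSq]
  have hpv := G.predVar_ne_zero hσ n (fun i => (p.2 i.castSucc).1)
    ((p.2 (Fin.last n)).1.1, (p.2 (Fin.last n)).1.2.1)
  rw [log_gaussianPDFReal _ hσ2, log_gaussianPDFReal _ hpv]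
  have hinf : G.infoTerm σ n (fun i => (p.2 i.castSucc).1)
      ((p.2 (Fin.last n)).1.1, (p.2 (Fin.last n)).1.2.1) =
      1 / 2 * (Real.log (G.predVar σ n (fun i => (p.2 i.castSucc).1)
        ((p.2 (Fin.last n)).1.1, (p.2 (Fin.last n)).1.2.1)) -
          Real.log ((σ ^ 2 : ℝ≥0) : ℝ)) := by
    have hs : (0 : ℝ) < ((σ ^ 2 : ℝ≥0) : ℝ) := by positivity
    have h0 := G.postVar_nonneg hσ n (fun i => (p.2 i.castSucc).1)
      ((p.2 (Fin.last n)).1.1, (p.2 (Fin.last n)).1.2.1)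
    rw [← Real.log_div (by exact_mod_cast hpv) hs.ne', G.coe_predVar σ _ _ _ h0, infoTerm]
    congr 2
    push_cast
    field_simp
  rw [hinf]
  ring

/-- The expectation of `logRatio`. The two quadratic terms in the log-ratio of a round have
expectation one each and cancel. -/
theorem integral_logRatio (hσ : 0 < σ) (hcov : ∀ x, G.cov x x ≤ 1) (n : ℕ) :
    Integrable (fun p => G.logRatio σ p.1 n (obsOf p.2)) (G.playLaw σ adv M b n) ∧
      ∫ p, G.logRatio σ p.1 n (obsOf p.2) ∂G.playLaw σ adv M b n =
        ∫ p, histSum (G.infoTerm σ) n (obsOf p.2) ∂G.playLaw σ adv M b n := by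
  induction n with
  | zero => simp [logRatio, histSum]
  | succ n ih =>
    obtain ⟨hI₁, hE₁⟩ := integrable_and_integral_eq_one (G.measurable_noiseSq n)
      (G.noiseSq_nonneg n) (G.lintegral_noiseSq adv M b hσ n)
    obtain ⟨hI₂, hE₂⟩ := integrable_and_integral_eq_one
      ((G.measurable_innovationSq n).comp measurable_snd)
      (fun p => G.innovationSq_nonneg n p.2) (G.lintegral_innovationSq adv M b hσ n)
    simp only [Function.comp_def] at hI₂ hE₂
    have hinit := G.map_init_playLaw σ adv M b n
    have hini : Measurable fun p : Θ × (Fin (n + 1) → Round A B) =>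
      (p.1, fun i : Fin n => p.2 i.castSucc) := by fun_prop
    have hobs : Measurable fun h : Fin n → Round A B => obsOf h := by unfold obsOf; fun_prop
    have hSm : Measurable (histSum (G.infoTerm σ) n) :=
      measurable_histSum (fun n x => G.measurable_infoTerm n x) n
    have hR : Integrable (fun p : Θ × (Fin (n + 1) → Round A B) =>
        G.logRatio σ p.1 n (fun i => (p.2 i.castSucc).1)) (G.playLaw σ adv M b (n + 1)) := by
      have := ih.1
      rw [← hinit] at this
      exact this.comp_measurable hini
    have hRE : ∫ p, G.logRatio σ p.1 n (fun i => (p.2 i.castSucc).1)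
        ∂G.playLaw σ adv M b (n + 1) =
        ∫ p, histSum (G.infoTerm σ) n (fun i => (p.2 i.castSucc).1)
          ∂G.playLaw σ adv M b (n + 1) := by
      have := ih.2
      have m1 : Measurable fun p : Θ × (Fin n → Round A B) => G.logRatio σ p.1 n (obsOf p.2) := by
        fun_prop
      have m2 : Measurable fun p : Θ × (Fin n → Round A B) =>
        histSum (G.infoTerm σ) n (obsOf p.2) := hSm.comp (hobs.comp measurable_snd)
      rw [← hinit, integral_map hini.aemeasurable m1.aestronglyMeasurable,
        integral_map hini.aemeasurable m2.aestronglyMeasurable] at this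
      exact this
    have hIS := G.integrable_histSum (σ := σ) adv M b (φ := G.infoTerm σ)
      (fun n x => G.measurable_infoTerm n x)
      (G.infoTerm_nonneg hσ) (G.infoTerm_le hσ hcov)
    have hS : Integrable (fun p : Θ × (Fin (n + 1) → Round A B) =>
        histSum (G.infoTerm σ) n (fun i => (p.2 i.castSucc).1)) (G.playLaw σ adv M b (n + 1)) := by
      have := hIS n
      rw [← hinit] at this
      exact this.comp_measurable hini
    have k₁ : Integrable (fun p : Θ × (Fin (n + 1) → Round A B) =>
        histSum (G.infoTerm σ) (n + 1) (obsOf p.2) -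
          histSum (G.infoTerm σ) n (fun i => (p.2 i.castSucc).1)) (G.playLaw σ adv M b (n + 1)) :=
      (hIS (n + 1)).sub hS
    have k₂ : Integrable (fun p : Θ × (Fin (n + 1) → Round A B) =>
        G.logRatio σ p.1 n (fun i => (p.2 i.castSucc).1) +
        (histSum (G.infoTerm σ) (n + 1) (obsOf p.2) -
          histSum (G.infoTerm σ) n (fun i => (p.2 i.castSucc).1)))
        (G.playLaw σ adv M b (n + 1)) := hR.add k₁
    have k₃ : Integrable (fun p : Θ × (Fin (n + 1) → Round A B) =>
        1 / 2 * G.innovationSq σ n p.2 - 1 / 2 * G.noiseSq σ n p) (G.playLaw σ adv M b (n + 1)) :=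
      (hI₂.const_mul _).sub (hI₁.const_mul _)
    simp only [G.logRatio_succ hσ n]
    refine ⟨k₂.add k₃, ?_⟩
    rw [integral_add k₂ k₃, integral_add hR k₁, integral_sub (hIS (n + 1)) hS,
      integral_sub (hI₂.const_mul _) (hI₁.const_mul _), integral_const_mul, integral_const_mul,
      hE₁, hE₂, hRE]
    ring

theorem lintegral_jointLaw (T : ℕ) {g : Θ × (Fin T → Obs A B) → ℝ≥0∞} (hg : Measurable g) :
    ∫⁻ q, g q ∂G.jointLaw σ adv M b T =
      ∫⁻ p, g (p.1, obsOf p.2) ∂G.playLaw σ adv M b T := by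
  have ho : Measurable fun (h : Fin T → Round A B) t => (h t).1 := by fun_prop
  have : IsMarkovKernel ((G.law σ adv M b T).map fun h t => (h t).1) :=
    Kernel.IsMarkovKernel.map _ ho
  rw [jointLaw, Measure.lintegral_compProd hg, lintegral_playLaw _ _ _ _ _ _ (by
    unfold obsOf; fun_prop)]
  refine lintegral_congr fun θ => ?_
  rw [Kernel.lintegral_map _ ho _ (by fun_prop)]

instance (T : ℕ) : IsProbabilityMeasure (G.jointLaw σ adv M b T) := by
  have : IsMarkovKernel ((G.law σ adv M b T).map fun h t => (h t).1) :=
    Kernel.IsMarkovKernel.map _ (by fun_prop)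
  unfold jointLaw
  infer_instance

theorem jointLaw_eq_map (T : ℕ) : G.jointLaw σ adv M b T =
    (G.playLaw σ adv M b T).map fun p => (p.1, obsOf p.2) := by
  refine Measure.ext_of_lintegral _ fun g hg => ?_
  rw [lintegral_jointLaw _ _ _ _ _ hg, lintegral_map hg (by unfold obsOf; fun_prop)]

theorem jointLaw_eq_withDensity (hσ : 0 < σ) (T : ℕ) : G.jointLaw σ adv M b T =
    ((G.jointLaw σ adv M b T).fst.prod (G.jointLaw σ adv M b T).snd).withDensity
      fun q => ENNReal.ofReal (Real.exp (G.logRatio σ q.1 T q.2)) := by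
  have ho : Measurable fun h : Fin T → Round A B => obsOf h := by unfold obsOf; fun_prop
  refine Measure.ext_of_lintegral _ fun g hg => ?_
  rw [lintegral_withDensity_eq_lintegral_mul _ (by fun_prop) hg,
    lintegral_prod _ (by fun_prop), Measure.fst, lintegral_map
      (Measurable.lintegral_prod_right' (by fun_prop)) measurable_fst]
  have hfst : (G.jointLaw σ adv M b T).map Prod.fst = G.prior := by
    have : IsMarkovKernel ((G.law σ adv M b T).map fun h t => (h t).1) :=
      Kernel.IsMarkovKernel.map _ (by fun_prop)
    exact Measure.fst_compProd _ _
  rw [← lintegral_map (f := fun θ => ∫⁻ o, ((fun q : Θ × (Fin T → Obs A B) =>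
    ENNReal.ofReal (Real.exp (G.logRatio σ q.1 T q.2))) * g) (θ, o)
      ∂(G.jointLaw σ adv M b T).snd)
      (Measurable.lintegral_prod_right' (by fun_prop)) measurable_fst, hfst,
    lintegral_jointLaw _ _ _ _ _ hg,
    G.lintegral_playLaw_eq_logRatio adv M b hσ T (g := fun p => g (p.1, obsOf p.2)) (by fun_prop)]
  refine lintegral_congr fun θ => ?_
  rw [Measure.snd, lintegral_map (by fun_prop) measurable_snd,
    lintegral_jointLaw _ _ _ _ _ (by fun_prop)]
  rfl

/-- The mutual information of parameter and history is the expected sum of the information gained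
in the rounds. -/
theorem information_eq (hσ : 0 < σ) (hcov : ∀ x, G.cov x x ≤ 1) (T : ℕ) :
    G.information σ adv M b T ≠ ∞ ∧ (G.information σ adv M b T).toReal =
      ∫ p, histSum (G.infoTerm σ) T (obsOf p.2) ∂G.playLaw σ adv M b T := by
  have ho : Measurable fun h : Fin T → Round A B => obsOf h := by unfold obsOf; fun_prop
  have hmap : Measurable fun p : Θ × (Fin T → Round A B) => (p.1, obsOf p.2) := by fun_prop
  have hl : Measurable fun q : Θ × (Fin T → Obs A B) => G.logRatio σ q.1 T q.2 := by fun_prop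
  obtain ⟨hint, heq⟩ := G.integral_logRatio adv M b hσ hcov T
  have hintJ : Integrable (fun q : Θ × (Fin T → Obs A B) => G.logRatio σ q.1 T q.2)
      (G.jointLaw σ adv M b T) := by
    rw [jointLaw_eq_map, integrable_map_measure hl.aestronglyMeasurable hmap.aemeasurable]
    exact hint
  have := klDiv_of_eq_withDensity_exp hl (G.jointLaw_eq_withDensity adv M b hσ T) hintJ
  refine ⟨this.1, this.2.trans ?_⟩
  rw [← heq, jointLaw_eq_map, integral_map hmap.aemeasurable hl.aestronglyMeasurable]

end GaussianGame

/-! ### Optimism and accuracy of the maximum of Gaussian samples -/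

/-- The mean excess of a standard normal variable over `L`, from `y ≤ exp ((L + 1) y - 1)` at
`y = x - L ≥ 0` and the moment generating function at `L + 1`. -/
theorem lintegral_stdNormal_excess_le {L : ℝ} (hL : 0 ≤ L) :
    ∫⁻ x, ENNReal.ofReal (x - L) ∂gaussianReal 0 1 ≤ ENNReal.ofReal (Real.exp (-L ^ 2 / 2)) := by
  have hint := integrable_exp_mul_gaussianReal (μ := 0) (v := 1) (L + 1)
  have hmgf := congrFun (mgf_fun_id_gaussianReal (μ := 0) (v := 1)) (L + 1)
  simp only [mgf] at hmgf
  calc ∫⁻ x, ENNReal.ofReal (x - L) ∂gaussianReal 0 1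
      ≤ ∫⁻ x, ENNReal.ofReal (Real.exp ((L + 1) * x) * Real.exp (-(L + 1) * L - 1))
          ∂gaussianReal 0 1 := by
        refine lintegral_mono fun x => ?_
        rcases le_total (x - L) 0 with h | h
        · rw [ENNReal.ofReal_of_nonpos h]; exact zero_le
        refine ENNReal.ofReal_le_ofReal ?_
        rw [← Real.exp_add]
        have h1 := Real.add_one_le_exp ((L + 1) * x + (-(L + 1) * L - 1))
        nlinarith
    _ = ENNReal.ofReal (Real.exp ((L + 1) ^ 2 / 2) * Real.exp (-(L + 1) * L - 1)) := by
        rw [← ofReal_integral_eq_lintegral_ofReal (hint.mul_const _)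
          (Filter.Eventually.of_forall fun x => by positivity), integral_mul_const, hmgf]
        simp
    _ ≤ _ := by
        refine ENNReal.ofReal_le_ofReal ?_
        rw [← Real.exp_add, Real.exp_le_exp]
        nlinarith

theorem lintegral_stdNormal_abs_le : ∫⁻ x, ENNReal.ofReal |x| ∂gaussianReal 0 1 ≤ 1 := by
  have h := lintegral_gaussian_sq_div 0 (one_ne_zero : (1 : ℝ≥0) ≠ 0)
  simp only [sub_zero, NNReal.coe_one, div_one] at h
  calc ∫⁻ x, ENNReal.ofReal |x| ∂gaussianReal 0 1
      ≤ ∫⁻ x, (ENNReal.ofReal (1 / 2) * ENNReal.ofReal (x ^ 2) + ENNReal.ofReal (1 / 2))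
          ∂gaussianReal 0 1 := by
        refine lintegral_mono fun x => ?_
        rw [← ENNReal.ofReal_mul (by norm_num), ← ENNReal.ofReal_add (by positivity) (by norm_num)]
        refine ENNReal.ofReal_le_ofReal ?_
        rw [← sq_abs x]
        nlinarith [sq_nonneg (|x| - 1)]
    _ = 1 := by
        rw [lintegral_add_right _ measurable_const, lintegral_const_mul _ (by fun_prop), h,
          lintegral_const, measure_univ, mul_one,
          ← ENNReal.ofReal_add (by norm_num) (by norm_num)]
        norm_num

theorem lintegral_gaussian_eq_stdNormal (m s : ℝ) {v : ℝ≥0} (hv : (v : ℝ) = s ^ 2) {g : ℝ → ℝ≥0∞}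
    (hg : Measurable g) :
    ∫⁻ x, g x ∂gaussianReal m v = ∫⁻ x, g (m + s * x) ∂gaussianReal 0 1 := by
  have h1 := gaussianReal_map_const_mul (μ := 0) (v := 1) s
  have h2 : NNReal.mk (s ^ 2) (sq_nonneg s) * 1 = v := by
    ext; simp [hv]
  rw [mul_zero] at h1
  rw [← lintegral_gaussian_translate m v hg, ← h2]
  erw [← h1]
  rw [lintegral_map (by fun_prop) (by fun_prop)]

theorem lintegral_gaussian_excess_le (m : ℝ) {s : ℝ} (hs : 0 ≤ s) {v : ℝ≥0} (hv : (v : ℝ) = s ^ 2)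
    {L : ℝ} (hL : 0 ≤ L) :
    ∫⁻ x, ENNReal.ofReal (x - (m + s * L)) ∂gaussianReal m v ≤
      ENNReal.ofReal (s * Real.exp (-L ^ 2 / 2)) := by
  rw [lintegral_gaussian_eq_stdNormal m s hv (by fun_prop)]
  have : ∀ x, ENNReal.ofReal (m + s * x - (m + s * L)) =
      ENNReal.ofReal s * ENNReal.ofReal (x - L) := by
    intro x
    rw [← ENNReal.ofReal_mul hs]
    congr 1
    ring
  simp only [this]
  rw [lintegral_const_mul _ (by fun_prop), ENNReal.ofReal_mul hs]
  exact mul_le_mul_right (lintegral_stdNormal_excess_le hL) _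

theorem lintegral_gaussian_abs_sub_le (m : ℝ) {s : ℝ} (hs : 0 ≤ s) {v : ℝ≥0}
    (hv : (v : ℝ) = s ^ 2) :
    ∫⁻ x, ENNReal.ofReal |x - m| ∂gaussianReal m v ≤ ENNReal.ofReal s := by
  rw [lintegral_gaussian_eq_stdNormal m s hv (by fun_prop)]
  have : ∀ x, ENNReal.ofReal |m + s * x - m| = ENNReal.ofReal s * ENNReal.ofReal |x| := by
    intro x
    rw [← ENNReal.ofReal_mul hs, add_sub_cancel_left, abs_mul, abs_of_nonneg hs]
  simp only [this]
  rw [lintegral_const_mul _ (by fun_prop)]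
  exact (mul_le_mul_right lintegral_stdNormal_abs_le _).trans (by simp)

section SampleLaw

variable {A : Type*} [Fintype A]

theorem measurePreserving_sampleLaw (m : ℕ) (j : Fin m) (a : A) :
    MeasurePreserving (fun z : Fin m → A → ℝ => z j a) (sampleLaw A m) (gaussianReal 0 1) :=
  (measurePreserving_eval (fun _ : A => gaussianReal 0 1) a).comp
    (measurePreserving_eval (fun _ : Fin m => Measure.pi fun _ : A => gaussianReal 0 1) j)

theorem sampleLaw_forall_lt_le (m : ℕ) (a : A) (L : ℝ) :
    sampleLaw A m {z | ∀ j, z j a < L} ≤ ENNReal.ofReal (cdf (gaussianReal 0 1) L ^ m) := by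
  have hsub : {z : Fin m → A → ℝ | ∀ j, z j a < L} ⊆
      Set.univ.pi fun _ => (fun r : A → ℝ => r a) ⁻¹' Set.Iic L :=
    fun z hz j _ => (hz j).le
  refine (measure_mono hsub).trans (le_of_eq ?_)
  rw [Measure.pi_pi]
  have : (Measure.pi fun _ : A => gaussianReal 0 1) ((fun r : A → ℝ => r a) ⁻¹' Set.Iic L) =
      gaussianReal 0 1 (Set.Iic L) :=
    (measurePreserving_eval (fun _ : A => gaussianReal 0 1) a).measure_preimage
      measurableSet_Iic.nullMeasurableSet
  simp only [this, Finset.prod_const, Finset.card_univ, Fintype.card_fin]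
  rw [ENNReal.ofReal_pow (cdf_nonneg _ _), ofReal_cdf]

end SampleLaw

theorem clip01_mono {x y : ℝ} (h : x ≤ y) : clip01 x ≤ clip01 y :=
  max_le_max le_rfl (min_le_min h le_rfl)

theorem clip01_sub_le {x y : ℝ} (h : y ≤ x) : clip01 x - clip01 y ≤ x - y := by
  unfold clip01
  rcases max_cases (0 : ℝ) (min x 1) with h1 | h1 <;>
  rcases max_cases (0 : ℝ) (min y 1) with h2 | h2 <;>
  rcases min_cases x 1 with h3 | h3 <;> rcases min_cases y 1 with h4 | h4 <;> linarith

theorem ofReal_clip01_sub_le (x y : ℝ) :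
    ENNReal.ofReal (clip01 x - clip01 y) ≤ ENNReal.ofReal (x - y) := by
  rcases le_total y x with h | h
  · exact ENNReal.ofReal_le_ofReal (clip01_sub_le h)
  · rw [ENNReal.ofReal_of_nonpos (sub_nonpos.2 (clip01_mono h))]
    exact zero_le

section Optimism

variable {A : Type*} [Fintype A] (a : A) (μ : ℝ) {s : ℝ} (hs : 0 ≤ s) {v : ℝ≥0}
  (hv : (v : ℝ) = s ^ 2) {m : ℕ}
include hs hv

/-- Optimism: the true mean exceeds the imagined reward little, since the largest of the samples is
at least `μ + s L` up to the probability `Φ(L) ^ m`, and a Gaussian variable rarely exceeds this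
level. -/
theorem lintegral_clip_sub_imagined_le (hs1 : s ≤ 1) {L : ℝ} (hL : 0 ≤ L) :
    ∫⁻ x, ∫⁻ z, ENNReal.ofReal (clip01 x - clip01 (⨆ j : Fin m, (μ + s * z j a))) ∂sampleLaw A m
        ∂gaussianReal μ v ≤
      ENNReal.ofReal (cdf (gaussianReal 0 1) L ^ m) +
        ENNReal.ofReal (Real.exp (-L ^ 2 / 2)) := by
  have hE : MeasurableSet {z : Fin m → A → ℝ | ∀ j, z j a < L} := by
    simp only [Set.ofPred_forall]
    exact MeasurableSet.iInter fun j =>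
      (by fun_prop : Measurable fun z : Fin m → A → ℝ => z j a) measurableSet_Iio
  have hpt : ∀ x (z : Fin m → A → ℝ),
      ENNReal.ofReal (clip01 x - clip01 (⨆ j : Fin m, (μ + s * z j a))) ≤
        {z : Fin m → A → ℝ | ∀ j, z j a < L}.indicator 1 z +
          ENNReal.ofReal (x - (μ + s * L)) := by
    intro x z
    by_cases hz : ∀ j, z j a < L
    · rw [Set.indicator_of_mem (by exact hz)]
      refine le_add_right (ENNReal.ofReal_le_one.2 ?_)
      linarith [(clip01_mem x).2, (clip01_mem (⨆ j : Fin m, (μ + s * z j a))).1]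
    · refine le_add_left ?_
      push Not at hz
      obtain ⟨j, hj⟩ := hz
      refine (ofReal_clip01_sub_le _ _).trans (ENNReal.ofReal_le_ofReal ?_)
      have h1 : μ + s * z j a ≤ ⨆ j : Fin m, (μ + s * z j a) :=
        le_ciSup (f := fun j : Fin m => μ + s * z j a) (Set.finite_range _).bddAbove j
      have h2 : s * L ≤ s * z j a := mul_le_mul_of_nonneg_left hj hs
      linarith
  calc _ ≤ ∫⁻ x, ∫⁻ z, ({z : Fin m → A → ℝ | ∀ j, z j a < L}.indicator 1 z +
          ENNReal.ofReal (x - (μ + s * L))) ∂sampleLaw A m ∂gaussianReal μ v :=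
        lintegral_mono fun x => lintegral_mono fun z => hpt x z
    _ = sampleLaw A m {z | ∀ j, z j a < L} +
          ∫⁻ x, ENNReal.ofReal (x - (μ + s * L)) ∂gaussianReal μ v := by
        simp only [lintegral_add_right _ measurable_const, lintegral_const, measure_univ, mul_one,
          lintegral_indicator_one hE]
        rw [lintegral_add_left measurable_const]
        simp
    _ ≤ _ := by
        refine add_le_add (sampleLaw_forall_lt_le m a L)
          ((lintegral_gaussian_excess_le μ hs hv hL).trans (ENNReal.ofReal_le_ofReal ?_))
        exact mul_le_of_le_one_left (Real.exp_pos _).le hs1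

/-- Accuracy: the maximum of `m` standard normal variables is at most `L` plus the sum of their
excesses over `L = √(2 log m)`, each of which has mean at most `1 / m`. Hence the imagined reward
exceeds the true mean by at most `s (L + 1)`, and the true mean is within `s` of `μ`, on average. -/
theorem lintegral_imagined_sub_clip_le (hm : 1 ≤ m) :
    ∫⁻ x, ∫⁻ z, ENNReal.ofReal (clip01 (⨆ j : Fin m, (μ + s * z j a)) - clip01 x) ∂sampleLaw A m
        ∂gaussianReal μ v ≤ ENNReal.ofReal (s * (√(2 * Real.log m) + 2)) := by
  have : Nonempty (Fin m) := ⟨⟨0, hm⟩⟩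
  have hm0 : (0 : ℝ) < m := by exact_mod_cast hm
  have hlog : 0 ≤ Real.log m := Real.log_nonneg (by exact_mod_cast hm)
  set L := √(2 * Real.log m) with hLdef
  have hL : 0 ≤ L := Real.sqrt_nonneg _
  have hL2 : L ^ 2 = 2 * Real.log m := Real.sq_sqrt (by positivity)
  have hpt : ∀ x (z : Fin m → A → ℝ),
      ENNReal.ofReal (clip01 (⨆ j : Fin m, (μ + s * z j a)) - clip01 x) ≤
        ENNReal.ofReal s * (ENNReal.ofReal L + ∑ j, ENNReal.ofReal (z j a - L)) +
          ENNReal.ofReal |x - μ| := by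
    intro x z
    refine (ofReal_clip01_sub_le _ _).trans ?_
    have h1 : (⨆ j : Fin m, (μ + s * z j a)) ≤ μ + s * (L + ∑ j, max 0 (z j a - L)) := by
      refine ciSup_le fun j => ?_
      have h2 : max 0 (z j a - L) ≤ ∑ j, max 0 (z j a - L) :=
        Finset.single_le_sum (f := fun j => max 0 (z j a - L)) (fun j _ => le_max_left _ _)
          (Finset.mem_univ j)
      have h3 := le_max_right 0 (z j a - L)
      have := mul_le_mul_of_nonneg_left (by linarith : z j a ≤ L + ∑ j, max 0 (z j a - L)) hs
      linarith
    have h4 : (⨆ j : Fin m, (μ + s * z j a)) - x ≤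
        s * (L + ∑ j, max 0 (z j a - L)) + |x - μ| := by
      linarith [neg_abs_le (x - μ)]
    refine (ENNReal.ofReal_le_ofReal h4).trans (le_of_eq ?_)
    have h5 : 0 ≤ ∑ j, max 0 (z j a - L) := Finset.sum_nonneg fun j _ => le_max_left _ _
    rw [ENNReal.ofReal_add (mul_nonneg hs (add_nonneg hL h5)) (abs_nonneg _),
      ENNReal.ofReal_mul hs, ENNReal.ofReal_add hL h5,
      ENNReal.ofReal_sum_of_nonneg fun j _ => le_max_left _ _]
    congr 3
    refine Finset.sum_congr rfl fun j _ => ?_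
    rcases le_total (z j a - L) 0 with h | h
    · rw [max_eq_left h, ENNReal.ofReal_of_nonpos h, ENNReal.ofReal_zero]
    · rw [max_eq_right h]
  have hmz : ∀ j, Measurable fun z : Fin m → A → ℝ => ENNReal.ofReal (z j a - L) := by
    intro j; fun_prop
  have hz : ∀ j, ∫⁻ z, ENNReal.ofReal (z j a - L) ∂sampleLaw A m ≤ ENNReal.ofReal (1 / m) := by
    intro j
    rw [(measurePreserving_sampleLaw m j a).lintegral_comp
      (f := fun x => ENNReal.ofReal (x - L)) (by fun_prop)]
    refine (lintegral_stdNormal_excess_le hL).trans (le_of_eq ?_)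
    rw [hL2, neg_div, mul_div_cancel_left₀ _ two_ne_zero, Real.exp_neg, Real.exp_log hm0, one_div]
  calc _ ≤ ∫⁻ x, ∫⁻ z, (ENNReal.ofReal s * (ENNReal.ofReal L + ∑ j, ENNReal.ofReal (z j a - L)) +
          ENNReal.ofReal |x - μ|) ∂sampleLaw A m ∂gaussianReal μ v :=
        lintegral_mono fun x => lintegral_mono fun z => hpt x z
    _ = ENNReal.ofReal s * (ENNReal.ofReal L +
          ∑ j, ∫⁻ z, ENNReal.ofReal (z j a - L) ∂sampleLaw A m) +
          ∫⁻ x, ENNReal.ofReal |x - μ| ∂gaussianReal μ v := by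
        simp only [lintegral_add_right _ measurable_const, lintegral_const, measure_univ, mul_one]
        rw [lintegral_add_left measurable_const, lintegral_const, measure_univ, mul_one,
          lintegral_const_mul _ (by fun_prop), lintegral_add_left measurable_const,
          lintegral_finsetSum _ fun j _ => hmz j]
        simp
    _ ≤ ENNReal.ofReal s * (ENNReal.ofReal L + ∑ j : Fin m, ENNReal.ofReal (1 / m)) +
          ENNReal.ofReal s := by
        refine add_le_add (mul_le_mul_right (add_le_add_right ?_ _) _)
          (lintegral_gaussian_abs_sub_le μ hs hv)
        exact Finset.sum_le_sum fun j _ => hz j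
    _ = ENNReal.ofReal (s * (L + 2)) := by
        rw [← ENNReal.ofReal_sum_of_nonneg fun j _ => by positivity,
          ← ENNReal.ofReal_add hL (Finset.sum_nonneg fun j _ => by positivity),
          ← ENNReal.ofReal_mul hs, ← ENNReal.ofReal_add
            (mul_nonneg hs (add_nonneg hL (Finset.sum_nonneg fun j _ => by positivity))) hs]
        congr 1
        simp only [Finset.sum_const, Finset.card_univ, Fintype.card_fin, nsmul_eq_mul]
        field_simp
        ring

end Optimism

theorem cdf_stdNormal_pos (L : ℝ) : 0 < cdf (gaussianReal 0 1) L := by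
  rw [cdf_eq_real, measureReal_def, ENNReal.toReal_pos_iff]
  refine ⟨pos_iff_ne_zero.2 fun h => ?_, measure_lt_top _ _⟩
  have := gaussianReal_absolutelyContinuous' 0 (one_ne_zero : (1 : ℝ≥0) ≠ 0) h
  simp at this

/-- A lower bound for the Gaussian tail, from the mass of the interval `(L, L + 1]`. -/
theorem le_one_sub_cdf_stdNormal {L : ℝ} (hL : 0 ≤ L) :
    Real.exp (-L ^ 2) / 8 ≤ 1 - cdf (gaussianReal 0 1) L := by
  have h1 : gaussianReal 0 1 (Set.Ioc L (L + 1)) ≤ gaussianReal 0 1 (Set.Ioi L) :=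
    measure_mono fun x hx => hx.1
  have h2 : ENNReal.ofReal (gaussianPDFReal 0 1 (L + 1)) ≤
      gaussianReal 0 1 (Set.Ioc L (L + 1)) := by
    rw [gaussianReal_apply _ one_ne_zero]
    calc ENNReal.ofReal (gaussianPDFReal 0 1 (L + 1))
        = ∫⁻ x in Set.Ioc L (L + 1), ENNReal.ofReal (gaussianPDFReal 0 1 (L + 1)) := by simp
      _ ≤ _ := by
        refine setLIntegral_mono (measurable_gaussianPDF _ _) fun x hx => ?_
        refine ENNReal.ofReal_le_ofReal ?_
        simp only [gaussianPDFReal]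
        refine mul_le_mul_of_nonneg_left (Real.exp_le_exp.2 ?_) (by positivity)
        have : x ^ 2 ≤ (L + 1) ^ 2 := pow_le_pow_left₀ (hL.trans hx.1.le) hx.2 2
        simp only [NNReal.coe_one, sub_zero]
        linarith
  have h3 : gaussianReal 0 1 (Set.Ioi L) = ENNReal.ofReal (1 - cdf (gaussianReal 0 1) L) := by
    rw [← Set.compl_Iic, prob_compl_eq_one_sub measurableSet_Iic, ← ofReal_cdf,
      ENNReal.ofReal_sub _ (cdf_nonneg _ _), ENNReal.ofReal_one]
  rw [h3] at h1
  have h4 := (ENNReal.ofReal_le_ofReal_iff (sub_nonneg.2 (cdf_le_one _ _))).1 (h2.trans h1)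
  refine le_trans ?_ h4
  simp only [gaussianPDFReal, NNReal.coe_one, mul_one, sub_zero]
  -- the constant `8` exceeds `e √(2π)`
  have hpi : √(2 * Real.pi) ≤ 2.6 := by
    rw [Real.sqrt_le_left (by norm_num)]
    linarith [Real.pi_lt_d2]
  have hpi0 : 0 < √(2 * Real.pi) := by positivity
  have he : Real.exp 1 ≤ 2.7183 := by linarith [Real.exp_one_lt_d9]
  have h5 : Real.exp (-L ^ 2) ≤ Real.exp 1 * Real.exp (-(L + 1) ^ 2 / 2) := by
    rw [← Real.exp_add, Real.exp_le_exp]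
    nlinarith [sq_nonneg (L - 1)]
  rw [inv_mul_eq_div, div_le_div_iff₀ (by norm_num) hpi0]
  have h6 := Real.exp_pos (-(L + 1) ^ 2 / 2)
  calc Real.exp (-L ^ 2) * √(2 * Real.pi)
      ≤ (2.7183 * Real.exp (-(L + 1) ^ 2 / 2)) * 2.6 := by
        refine mul_le_mul (h5.trans (mul_le_mul_of_nonneg_right he h6.le)) hpi hpi0.le
          (by positivity)
    _ ≤ _ := by linarith

section SampleSize

variable {k s : ℕ} (hk : 2 ≤ k) (hs : 1 ≤ s)
include hk hs

theorem two_le_mul_sqrt : (2 : ℝ) ≤ k * √s := by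
  have h1 : (2 : ℝ) ≤ k := by exact_mod_cast hk
  have h2 : (1 : ℝ) ≤ √s := Real.one_le_sqrt.2 (by exact_mod_cast hs)
  nlinarith

theorem log_mul_sqrt_pos : 0 < Real.log (k * √s) :=
  Real.log_pos (by linarith [two_le_mul_sqrt hk hs])

theorem le_log_one_div_cdf :
    1 / (8 * (k * √s) ^ 2) ≤
      Real.log (1 / cdf (gaussianReal 0 1) (√(2 * Real.log (k * √s)))) := by
  have hK := two_le_mul_sqrt hk hs
  have hl := log_mul_sqrt_pos hk hs
  set K := k * √s with hKdef
  have h1 := le_one_sub_cdf_stdNormal (Real.sqrt_nonneg (2 * Real.log K))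
  rw [Real.sq_sqrt (by positivity)] at h1
  have h2 : Real.exp (-(2 * Real.log K)) = 1 / K ^ 2 := by
    rw [Real.exp_neg, two_mul, Real.exp_add, Real.exp_log (by linarith)]
    field_simp
  have h3 := Real.log_le_sub_one_of_pos (cdf_stdNormal_pos (√(2 * Real.log K)))
  rw [one_div (cdf _ _), Real.log_inv]
  have h4 : 1 / (8 * K ^ 2) = 1 / K ^ 2 / 8 := by field_simp
  rw [h2] at h1
  linarith

/-- The sample size is large enough for all samples of an action to stay below the level
`√(2 log (k √s))` with probability at most `1 / (k √s)`. -/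
theorem cdf_pow_le_of_sampleSize_le {m : ℕ} (hm : sampleSize k s ≤ m) :
    cdf (gaussianReal 0 1) (√(2 * Real.log (k * √s))) ^ m ≤ 1 / (k * √s) := by
  have hK := two_le_mul_sqrt hk hs
  have hlow := le_log_one_div_cdf hk hs
  have hm' : Real.log (k * √s) /
      Real.log (1 / cdf (gaussianReal 0 1) (√(2 * Real.log (k * √s)))) ≤ m := by
    refine (Nat.le_ceil _).trans ?_
    exact_mod_cast (le_max_right _ _).trans hm
  set K := k * √s with hKdef
  have hK0 : 0 < K := by linarith
  set F := cdf (gaussianReal 0 1) (√(2 * Real.log K)) with hF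
  have hF0 : 0 < F := cdf_stdNormal_pos _
  have hpos : 0 < Real.log (1 / F) := lt_of_lt_of_le (by positivity) hlow
  rw [div_le_iff₀ hpos, one_div, Real.log_inv] at hm'
  rw [← Real.log_le_log_iff (pow_pos hF0 m) (by positivity), Real.log_pow, one_div, Real.log_inv]
  linarith

/-- The sample size grows at most polynomially in the number of actions and the horizon: with
`K = k √s ≥ 2` it is at most `8 K ^ 3 + 1`, hence at most `K ^ 7`. -/
theorem log_le_of_le_sampleSize {m : ℕ} (hm1 : 1 ≤ m) (hm : m ≤ sampleSize k s) :
    Real.log m ≤ 7 * Real.log (k * s) := by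
  have hK := two_le_mul_sqrt hk hs
  have hlow := le_log_one_div_cdf hk hs
  have hl := log_mul_sqrt_pos hk hs
  have hss : √(s : ℝ) ≤ s := by
    have : (1 : ℝ) ≤ s := by exact_mod_cast hs
    rw [Real.sqrt_le_left (by linarith)]
    nlinarith
  have hKs : (k : ℝ) * √s ≤ k * s := mul_le_mul_of_nonneg_left hss (Nat.cast_nonneg _)
  have hm2 : (m : ℝ) ≤ max 1 (⌈Real.log (k * √s) /
      Real.log (1 / cdf (gaussianReal 0 1) (√(2 * Real.log (k * √s))))⌉₊ : ℝ) := by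
    exact_mod_cast hm
  set K := k * √s with hKdef
  have hK0 : 0 < K := by linarith
  have hx : Real.log K / Real.log (1 / cdf (gaussianReal 0 1) (√(2 * Real.log K))) ≤
      8 * K ^ 3 := by
    rw [div_le_iff₀ (lt_of_lt_of_le (by positivity) hlow)]
    have h1 : 8 * K ^ 3 * (1 / (8 * K ^ 2)) = K := by field_simp
    have h2 := mul_le_mul_of_nonneg_left hlow (by positivity : 0 ≤ 8 * K ^ 3)
    have h3 := Real.log_le_sub_one_of_pos hK0
    linarith
  have hx0 : 0 ≤ Real.log K / Real.log (1 / cdf (gaussianReal 0 1) (√(2 * Real.log K))) :=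
    div_nonneg hl.le (le_trans (by positivity) hlow)
  have hceil := (Nat.ceil_lt_add_one hx0).le
  have hK3 : (8 : ℝ) ≤ K ^ 3 := by
    have := pow_le_pow_left₀ (by norm_num) hK 3
    norm_num at this ⊢
    exact this
  have hmK : (m : ℝ) ≤ K ^ 7 := by
    have h16 : (16 : ℝ) ≤ K ^ 4 := by
      have := pow_le_pow_left₀ (by norm_num) hK 4
      norm_num at this ⊢
      exact this
    have h7 : K ^ 7 = K ^ 3 * K ^ 4 := by ring
    have h8 : 16 * K ^ 3 ≤ K ^ 7 := by rw [h7]; nlinarith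
    exact hm2.trans (max_le (by linarith) (by linarith))
  calc Real.log m ≤ Real.log (K ^ 7) := Real.log_le_log (by exact_mod_cast hm1) hmK
    _ = 7 * Real.log K := by rw [Real.log_pow]; norm_num
    _ ≤ 7 * Real.log (k * s) := by
        have := Real.log_le_log hK0 hKs
        linarith

end SampleSize

/-! ### The gap between true and imagined rewards -/

namespace GaussianGame

variable {A B Θ : Type*} [Fintype A] [Fintype B] [DecidableEq A] [DecidableEq B]
  [MeasurableSpace A] [MeasurableSingletonClass A] [MeasurableSpace B] [MeasurableSingletonClass B]
  [MeasurableSpace Θ] (G : GaussianGame A B Θ) {σ : ℝ≥0}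

/-- The amount by which one round can make the regret exceed the regret with respect to the imagined
rewards: the true rewards above the imagined ones, over all actions, and the imagined reward above
the true one at the action played. -/
def gap (θ : Θ) (b : B) (r : Round A B) : ℝ :=
  ∑ a, max 0 (G.meanReward θ a b - r.2 a) + max 0 (r.2 r.1.1 - G.meanReward θ r.1.1 b)

theorem gap_nonneg (θ : Θ) (b : B) (r : Round A B) : 0 ≤ G.gap θ b r :=
  add_nonneg (Finset.sum_nonneg fun _ _ => le_max_left _ _) (le_max_left _ _)

theorem sub_le_gap (θ : Θ) (b : B) (r : Round A B) (a : A) :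
    G.meanReward θ a b - G.meanReward θ r.1.1 b ≤ r.2 a - r.2 r.1.1 + G.gap θ b r := by
  have h1 : max 0 (G.meanReward θ a b - r.2 a) ≤ ∑ a, max 0 (G.meanReward θ a b - r.2 a) :=
    Finset.single_le_sum (f := fun a => max 0 (G.meanReward θ a b - r.2 a))
      (fun _ _ => le_max_left _ _) (Finset.mem_univ a)
  have h2 := le_max_right 0 (G.meanReward θ a b - r.2 a)
  have h3 := le_max_right 0 (r.2 r.1.1 - G.meanReward θ r.1.1 b)
  unfold gap
  linarith

theorem gap_le (θ : Θ) (b : B) (r : Round A B) (hr : ∀ a, r.2 a ∈ Set.Icc (0 : ℝ) 1) :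
    G.gap θ b r ≤ Fintype.card A + 1 := by
  have h : ∀ a, G.meanReward θ a b ∈ Set.Icc (0 : ℝ) 1 := fun a => clip01_mem _
  unfold gap
  refine add_le_add ?_ (max_le zero_le_one (by linarith [(h r.1.1).1, (hr r.1.1).2]))
  calc ∑ a, max 0 (G.meanReward θ a b - r.2 a) ≤ ∑ _a : A, (1 : ℝ) :=
        Finset.sum_le_sum fun a _ => max_le zero_le_one (by linarith [(h a).2, (hr a).1])
    _ = Fintype.card A := by simp

theorem ofReal_gap (θ : Θ) (b : B) (r : Round A B) : ENNReal.ofReal (G.gap θ b r) =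
    ∑ a, ENNReal.ofReal (G.meanReward θ a b - r.2 a) +
      ENNReal.ofReal (r.2 r.1.1 - G.meanReward θ r.1.1 b) := by
  have h : ∀ x : ℝ, ENNReal.ofReal (max 0 x) = ENNReal.ofReal x := fun x => by
    rw [ENNReal.ofReal_max, ENNReal.ofReal_zero]
    exact max_eq_right zero_le
  unfold gap
  rw [ENNReal.ofReal_add (Finset.sum_nonneg fun _ _ => le_max_left _ _) (le_max_left _ _),
    ENNReal.ofReal_sum_of_nonneg fun _ _ => le_max_left _ _]
  simp only [h]

@[fun_prop]
theorem measurable_meanReward {α : Type*} [MeasurableSpace α] {θ : α → Θ} (hθ : Measurable θ)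
    (a : A) (b : B) : Measurable fun p => G.meanReward (θ p) a b := by
  have hf := G.measurable_f
  exact measurable_clip01.comp (by fun_prop)

@[fun_prop]
theorem measurable_meanReward_index {α : Type*} [MeasurableSpace α] {θ : α → Θ} {a : α → A}
    (hθ : Measurable θ) (ha : Measurable a) (b : B) :
    Measurable fun p => G.meanReward (θ p) (a p) b :=
  measurable_eval_index (g := fun p a => G.meanReward (θ p) a b) (fun a => by fun_prop) ha

@[fun_prop]
theorem measurable_gap {α : Type*} [MeasurableSpace α] {θ : α → Θ} {r : α → Round A B}
    (hθ : Measurable θ) (hr : Measurable r) (b : B) :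
    Measurable fun p => G.gap (θ p) b (r p) := by
  have h1 := measurable_eval_index (g := fun p a => (r p).2 a) (z := fun p => (r p).1.1)
    (fun a => by fun_prop) (by fun_prop)
  unfold gap
  exact (Finset.measurable_sum _ fun a _ => by fun_prop).add
    (measurable_const.max (h1.sub (by fun_prop)))

/-- The posterior standard deviation as a function of the action pair. -/
def stdTerm (σ : ℝ≥0) (n : ℕ) (o : Fin n → Obs A B) (x : A × B) : ℝ := √(G.postVar σ n o x)

theorem measurable_stdTerm (n : ℕ) (x : A × B) :
    Measurable fun o : Fin n → Obs A B => G.stdTerm σ n o x :=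
  (G.measurable_postVar σ n measurable_id x).sqrt

theorem lintegral_postLaw_eval (hσ : 0 < σ) (n : ℕ) (o : Fin n → Obs A B) (x : A × B)
    {g : ℝ → ℝ≥0∞} (hg : Measurable g) : ∫⁻ e, g (e x) ∂G.postLaw σ n o =
      ∫⁻ y, g y ∂gaussianReal ((G.posterior σ n o).1 x) (G.postVar σ n o x).toNNReal :=
  (measurePreserving_eval_multivariateGaussian (μ := WithLp.toLp 2 (G.posterior σ n o).1)
    (G.posSemidef_posterior hσ n o) (i := x)).lintegral_comp hg

/-- Optimism at the level `√(2 log (|A| √(n + 1)))`: the two error terms are at most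
`1 / (|A| √(n + 1))` each. -/
theorem lintegral_meanReward_sub_imagined_le (hσ : 0 < σ) (hcov : ∀ x, G.cov x x ≤ 1)
    (hk : 2 ≤ Fintype.card A) {n m : ℕ} (hm : sampleSize (Fintype.card A) (n + 1) ≤ m)
    (h : Fin n → Round A B) (a : A) (b : B) :
    ∫⁻ e, ∫⁻ z, ENNReal.ofReal (clip01 (e (a, b)) - G.imagined σ n m (obsOf h) b z a)
        ∂sampleLaw A m ∂G.postLaw σ n (obsOf h) ≤
      ENNReal.ofReal (2 / (Fintype.card A * √((n + 1 : ℕ) : ℝ))) := by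
  have hv := G.postVar_nonneg hσ n (obsOf h) (a, b)
  have hK := two_le_mul_sqrt hk (Nat.le_add_left 1 n)
  have hlog := log_mul_sqrt_pos hk (Nat.le_add_left 1 n)
  have hcdf := cdf_pow_le_of_sampleSize_le hk (Nat.le_add_left 1 n) hm
  set K := (Fintype.card A : ℝ) * √((n + 1 : ℕ) : ℝ) with hKdef
  have hK0 : 0 < K := by linarith
  have himg : Measurable fun z : Fin m → A → ℝ => G.imagined σ n m (obsOf h) b z a :=
    (measurable_pi_apply a).comp (G.measurable_imagined σ n m b (h := fun _ => h)
      measurable_const measurable_id)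
  rw [G.lintegral_postLaw_eval hσ n (obsOf h) (a, b) (g := fun x => ∫⁻ z, ENNReal.ofReal
    (clip01 x - G.imagined σ n m (obsOf h) b z a) ∂sampleLaw A m)
    (Measurable.lintegral_prod_right' (f := fun q : ℝ × (Fin m → A → ℝ) => ENNReal.ofReal
      (clip01 q.1 - G.imagined σ n m (obsOf h) b q.2 a))
      ((measurable_clip01.comp measurable_fst).sub (himg.comp measurable_snd)).ennreal_ofReal)]
  refine (lintegral_clip_sub_imagined_le a ((G.posterior σ n (obsOf h)).1 (a, b))
    (s := √(G.postVar σ n (obsOf h) (a, b))) (Real.sqrt_nonneg _)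
    (v := (G.postVar σ n (obsOf h) (a, b)).toNNReal)
    (by rw [Real.sq_sqrt hv, Real.coe_toNNReal _ hv])
    (Real.sqrt_le_one.2 ((G.postVar_le_cov hσ n (obsOf h) (a, b)).trans (hcov _)))
    (Real.sqrt_nonneg (2 * Real.log K))).trans ?_
  rw [← ENNReal.ofReal_add (pow_nonneg (cdf_nonneg _ _) _) (Real.exp_pos _).le]
  refine ENNReal.ofReal_le_ofReal ?_
  have h2 : Real.exp (-√(2 * Real.log K) ^ 2 / 2) = 1 / K := by
    rw [Real.sq_sqrt (by positivity), neg_div, mul_div_cancel_left₀ _ two_ne_zero, Real.exp_neg,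
      Real.exp_log hK0, one_div]
  rw [h2]
  have h3 : 2 / K = 1 / K + 1 / K := by ring
  rw [h3]
  exact add_le_add hcdf le_rfl

theorem lintegral_imagined_sub_meanReward_le (hσ : 0 < σ) {n m : ℕ} (hm : 1 ≤ m) {c : ℝ}
    (hc : √(2 * Real.log m) + 2 ≤ c) (h : Fin n → Round A B) (a : A) (b : B) :
    ∫⁻ e, ∫⁻ z, ENNReal.ofReal (G.imagined σ n m (obsOf h) b z a - clip01 (e (a, b)))
        ∂sampleLaw A m ∂G.postLaw σ n (obsOf h) ≤
      ENNReal.ofReal c * ENNReal.ofReal (G.stdTerm σ n (obsOf h) (a, b)) := by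
  have hv := G.postVar_nonneg hσ n (obsOf h) (a, b)
  have himg : Measurable fun z : Fin m → A → ℝ => G.imagined σ n m (obsOf h) b z a :=
    (measurable_pi_apply a).comp (G.measurable_imagined σ n m b (h := fun _ => h)
      measurable_const measurable_id)
  rw [G.lintegral_postLaw_eval hσ n (obsOf h) (a, b) (g := fun x => ∫⁻ z, ENNReal.ofReal
    (G.imagined σ n m (obsOf h) b z a - clip01 x) ∂sampleLaw A m)
    (Measurable.lintegral_prod_right' (f := fun q : ℝ × (Fin m → A → ℝ) => ENNReal.ofReal
      (G.imagined σ n m (obsOf h) b q.2 a - clip01 q.1))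
      ((himg.comp measurable_snd).sub (measurable_clip01.comp measurable_fst)).ennreal_ofReal)]
  refine (lintegral_imagined_sub_clip_le a ((G.posterior σ n (obsOf h)).1 (a, b))
    (s := √(G.postVar σ n (obsOf h) (a, b))) (Real.sqrt_nonneg _)
    (v := (G.postVar σ n (obsOf h) (a, b)).toNNReal)
    (by rw [Real.sq_sqrt hv, Real.coe_toNNReal _ hv]) hm).trans ?_
  rw [← ENNReal.ofReal_mul (le_trans (by positivity) hc), mul_comm]
  exact ENNReal.ofReal_le_ofReal (mul_le_mul_of_nonneg_right hc (Real.sqrt_nonneg _))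

variable (adv : FullInfoAlgorithm A) (M : ℕ → ℕ) (b : ℕ → B)

theorem one_le_sampleSize (k s : ℕ) : 1 ≤ sampleSize k s := le_max_left _ _

/-- The gap of round `n` as a function of the mean rewards `e`, the past `h`, the action `a` of the
round and the variables `z` of the sampling step. -/
def gapOf (σ : ℝ≥0) (n m : ℕ) (b : B) (e : EuclideanSpace ℝ (A × B)) (h : Fin n → Round A B) (a : A)
    (z : Fin m → A → ℝ) : ℝ≥0∞ :=
  ∑ a', ENNReal.ofReal (clip01 (e (a', b)) - G.imagined σ n m (obsOf h) b z a') +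
    ENNReal.ofReal (G.imagined σ n m (obsOf h) b z a - clip01 (e (a, b)))

theorem measurable_gapOf (n m : ℕ) (b : B) (a : A) {α : Type*} [MeasurableSpace α]
    {e : α → EuclideanSpace ℝ (A × B)} {h : α → Fin n → Round A B} {z : α → Fin m → A → ℝ}
    (he : Measurable e) (hh : Measurable h) (hz : Measurable z) :
    Measurable fun q => G.gapOf σ n m b (e q) (h q) a (z q) := by
  have himg : ∀ a, Measurable fun q => G.imagined σ n m (obsOf (h q)) b (z q) a := fun a =>
    (measurable_pi_apply a).comp (G.measurable_imagined σ n m b hh hz)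
  have hclip : ∀ a, Measurable fun q => clip01 (e q (a, b)) := fun a =>
    measurable_clip01.comp (by fun_prop)
  exact (Finset.measurable_sum _ fun a' _ => ((hclip a').sub (himg a')).ennreal_ofReal).add
    ((himg a).sub (hclip a)).ennreal_ofReal

theorem lintegral_gapOf_le (hσ : 0 < σ) (hcov : ∀ x, G.cov x x ≤ 1)
    (hk : 2 ≤ Fintype.card A) {n m : ℕ} (hM : sampleSize (Fintype.card A) (n + 1) ≤ m) {c : ℝ}
    (hc : √(2 * Real.log m) + 2 ≤ c) (h : Fin n → Round A B) (a : A) (b : B) :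
    ∫⁻ e, ∫⁻ z, G.gapOf σ n m b e h a z ∂sampleLaw A m ∂G.postLaw σ n (obsOf h) ≤
      ENNReal.ofReal (2 / √((n + 1 : ℕ) : ℝ)) +
        ENNReal.ofReal c * ENNReal.ofReal (G.stdTerm σ n (obsOf h) (a, b)) := by
  have hm1 : 1 ≤ m := (one_le_sampleSize _ _).trans hM
  have hk0 : (0 : ℝ) < Fintype.card A := by exact_mod_cast (by omega : 0 < Fintype.card A)
  have m1 : ∀ a', Measurable fun q : EuclideanSpace ℝ (A × B) × (Fin m → A → ℝ) =>
      ENNReal.ofReal (clip01 (q.1 (a', b)) - G.imagined σ n m (obsOf h) b q.2 a') := fun a' =>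
    ((measurable_clip01.comp (by fun_prop)).sub ((measurable_pi_apply a').comp
      (G.measurable_imagined σ n m b (h := fun _ => h) measurable_const
        measurable_snd))).ennreal_ofReal
  have m2 : ∀ e : EuclideanSpace ℝ (A × B), ∀ a', Measurable fun z : Fin m → A → ℝ =>
      ENNReal.ofReal (clip01 (e (a', b)) - G.imagined σ n m (obsOf h) b z a') := fun e a' =>
    (m1 a').comp measurable_prodMk_left
  have hexp : ∀ e : EuclideanSpace ℝ (A × B), ∫⁻ z, G.gapOf σ n m b e h a z ∂sampleLaw A m =
      ∑ a', ∫⁻ z, ENNReal.ofReal (clip01 (e (a', b)) -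
        G.imagined σ n m (obsOf h) b z a') ∂sampleLaw A m +
      ∫⁻ z, ENNReal.ofReal (G.imagined σ n m (obsOf h) b z a -
        clip01 (e (a, b))) ∂sampleLaw A m := by
    intro e
    unfold gapOf
    rw [lintegral_add_left (Finset.measurable_sum _ fun a' _ => m2 e a'),
      lintegral_finsetSum _ fun a' _ => m2 e a']
  simp only [hexp]
  rw [lintegral_add_left (Finset.measurable_sum _ fun a' _ => (m1 a').lintegral_prod_right'),
    lintegral_finsetSum _ fun a' _ => (m1 a').lintegral_prod_right']
  refine add_le_add ?_ (G.lintegral_imagined_sub_meanReward_le hσ hm1 hc h a b)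
  refine (Finset.sum_le_sum fun a' _ =>
    G.lintegral_meanReward_sub_imagined_le hσ hcov hk hM h a' b).trans (le_of_eq ?_)
  rw [← ENNReal.ofReal_sum_of_nonneg fun a' _ => by positivity]
  congr 1
  simp only [Finset.sum_const, Finset.card_univ, nsmul_eq_mul]
  field_simp

/-- The expected gap of one round: given the past, the action is independent of the mean rewards
and of the samples, and the mean rewards have the Gaussian posterior from which the samples are
drawn. -/
theorem lintegral_gap_last_le (hσ : 0 < σ) (hcov : ∀ x, G.cov x x ≤ 1)
    (hk : 2 ≤ Fintype.card A) {n : ℕ} (hM : sampleSize (Fintype.card A) (n + 1) ≤ M n) {c : ℝ}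
    (hc : √(2 * Real.log (M n)) + 2 ≤ c) :
    ∫⁻ p, ENNReal.ofReal (G.gap p.1 (b n) (p.2 (Fin.last n))) ∂G.playLaw σ adv M b (n + 1) ≤
      ENNReal.ofReal (2 / √((n + 1 : ℕ) : ℝ)) + ENNReal.ofReal c *
        ∫⁻ p, ENNReal.ofReal (G.stdTerm σ n (fun i => (p.2 i.castSucc).1)
          ((p.2 (Fin.last n)).1.1, (p.2 (Fin.last n)).1.2.1)) ∂G.playLaw σ adv M b (n + 1) := by
  have hstd : Measurable fun h : Fin (n + 1) → Round A B => G.stdTerm σ n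
      (fun i => (h i.castSucc).1) ((h (Fin.last n)).1.1, (h (Fin.last n)).1.2.1) :=
    measurable_eval_index (g := fun (h : Fin (n + 1) → Round A B) x =>
      G.stdTerm σ n (fun i => (h i.castSucc).1) x)
      (fun x => (G.measurable_stdTerm n x).comp (by fun_prop)) (by fun_prop)
  have hstd₂ : Measurable fun p : Θ × (Fin (n + 1) → Round A B) =>
      ENNReal.ofReal (G.stdTerm σ n (fun i => (p.2 i.castSucc).1)
        ((p.2 (Fin.last n)).1.1, (p.2 (Fin.last n)).1.2.1)) :=
    (hstd.comp measurable_snd).ennreal_ofReal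
  have hstd' : ∀ a, Measurable fun p : Θ × (Fin n → Round A B) =>
      G.stdTerm σ n (obsOf p.2) (a, b n) := fun a =>
    (G.measurable_stdTerm n (a, b n)).comp (by unfold obsOf; fun_prop)
  have hmul : Measurable fun p : Θ × (Fin n → Round A B) =>
      ∑ a, ENNReal.ofReal (adv.prob n (advPast p.2) a) *
        ENNReal.ofReal (G.stdTerm σ n (obsOf p.2) (a, b n)) :=
    Finset.measurable_sum _ fun a _ => Measurable.mul (by fun_prop) (hstd' a).ennreal_ofReal
  have hg : Measurable fun q : EuclideanSpace ℝ (A × B) × (Fin n → Round A B) =>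
      ∑ a, ENNReal.ofReal (adv.prob n (advPast q.2) a) *
        ∫⁻ z, G.gapOf σ n (M n) (b n) q.1 q.2 a z ∂sampleLaw A (M n) :=
    Finset.measurable_sum _ fun a _ => Measurable.mul (by fun_prop)
      (G.measurable_gapOf n (M n) (b n) a (measurable_fst.comp measurable_fst)
        (measurable_snd.comp measurable_fst) measurable_snd).lintegral_prod_right'
  have hlhs : ∫⁻ p, ENNReal.ofReal (G.gap p.1 (b n) (p.2 (Fin.last n)))
      ∂G.playLaw σ adv M b (n + 1) = ∫⁻ p, ∑ a, ENNReal.ofReal (adv.prob n (advPast p.2) a) *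
        ∫⁻ z, G.gapOf σ n (M n) (b n) (G.f p.1) p.2 a z ∂sampleLaw A (M n)
          ∂G.playLaw σ adv M b n := by
    rw [lintegral_playLaw_succ _ _ _ _ _ _ (by fun_prop)]
    simp only [appendRound_last, ofReal_gap, lintegral_const, measure_univ, mul_one, gapOf,
      meanReward]
  have hrhs : ∫⁻ p, ENNReal.ofReal (G.stdTerm σ n (fun i => (p.2 i.castSucc).1)
      ((p.2 (Fin.last n)).1.1, (p.2 (Fin.last n)).1.2.1)) ∂G.playLaw σ adv M b (n + 1) =
      ∫⁻ p, ∑ a, ENNReal.ofReal (adv.prob n (advPast p.2) a) *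
        ENNReal.ofReal (G.stdTerm σ n (obsOf p.2) (a, b n)) ∂G.playLaw σ adv M b n := by
    rw [lintegral_playLaw_succ _ _ _ _ _ _ hstd₂]
    simp only [appendRound_last, appendRound_castSucc, lintegral_const, measure_univ, mul_one]
  have hconst : ENNReal.ofReal (2 / √((n + 1 : ℕ) : ℝ)) =
      ∫⁻ _, ENNReal.ofReal (2 / √((n + 1 : ℕ) : ℝ)) ∂G.playLaw σ adv M b n := by simp
  rw [hlhs, hrhs, G.lintegral_posterior adv M b hσ n hg, hconst, ← lintegral_const_mul _ hmul,
    ← lintegral_add_left measurable_const]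
  refine lintegral_mono fun p => ?_
  dsimp only
  have hFp : ∀ a, Measurable fun e : EuclideanSpace ℝ (A × B) =>
      ∫⁻ z, G.gapOf σ n (M n) (b n) e p.2 a z ∂sampleLaw A (M n) := fun a =>
    (G.measurable_gapOf n (M n) (b n) a (h := fun _ => p.2) measurable_fst measurable_const
      measurable_snd).lintegral_prod_right'
  rw [lintegral_finsetSum _ fun a _ => (hFp a).const_mul _]
  calc _ = ∑ a, ENNReal.ofReal (adv.prob n (advPast p.2) a) *
        ∫⁻ e, ∫⁻ z, G.gapOf σ n (M n) (b n) e p.2 a z ∂sampleLaw A (M n)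
          ∂G.postLaw σ n (obsOf p.2) :=
        Finset.sum_congr rfl fun a _ => lintegral_const_mul _ (hFp a)
    _ ≤ ∑ a, ENNReal.ofReal (adv.prob n (advPast p.2) a) *
        (ENNReal.ofReal (2 / √((n + 1 : ℕ) : ℝ)) +
        ENNReal.ofReal c * ENNReal.ofReal (G.stdTerm σ n (obsOf p.2) (a, b n))) :=
        Finset.sum_le_sum fun a _ =>
          mul_le_mul_right (G.lintegral_gapOf_le hσ hcov hk hM hc p.2 a (b n)) _
    _ = _ := by
        simp only [mul_add, Finset.sum_add_distrib]
        rw [← Finset.sum_mul, adv.sum_ofReal_prob, one_mul, Finset.mul_sum]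
        congr 1
        exact Finset.sum_congr rfl fun a _ => by ring

/-- The sum of the gaps of the rounds of a record of play. -/
def gapSum (n : ℕ) (p : Θ × (Fin n → Round A B)) : ℝ := ∑ t : Fin n, G.gap p.1 (b t) (p.2 t)

theorem measurable_gapSum (n : ℕ) : Measurable (G.gapSum b n) := by
  unfold gapSum; fun_prop

theorem gapSum_nonneg (n : ℕ) (p : Θ × (Fin n → Round A B)) : 0 ≤ G.gapSum b n p :=
  Finset.sum_nonneg fun _ _ => G.gap_nonneg _ _ _

/-- The optimism terms `2 / √(t + 1)` of the rounds add up to at most `4 √n`. -/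
theorem lintegral_gapSum_le (hσ : 0 < σ) (hcov : ∀ x, G.cov x x ≤ 1)
    (hk : 2 ≤ Fintype.card A) {c : ℝ} (n : ℕ)
    (hM : ∀ t < n, sampleSize (Fintype.card A) (t + 1) ≤ M t)
    (hc : ∀ t < n, √(2 * Real.log (M t)) + 2 ≤ c) :
    ∫⁻ p, ENNReal.ofReal (G.gapSum b n p) ∂G.playLaw σ adv M b n ≤
      ENNReal.ofReal (4 * √n) + ENNReal.ofReal c *
        ∫⁻ p, ENNReal.ofReal (histSum (G.stdTerm σ) n (obsOf p.2)) ∂G.playLaw σ adv M b n := by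
  have hmS : ∀ n, Measurable (histSum (G.stdTerm σ) n) := fun n =>
    measurable_histSum (fun n x => G.measurable_stdTerm n x) n
  have hS0 : ∀ n (o : Fin n → Obs A B), 0 ≤ histSum (G.stdTerm σ) n o := fun n o =>
    histSum_nonneg (fun _ _ _ => Real.sqrt_nonneg _) n o
  induction n with
  | zero => simp [gapSum]
  | succ n ih =>
    have ih' := ih (fun t ht => hM t (by omega)) fun t ht => hc t (by omega)
    have hstep := G.lintegral_gap_last_le adv M b hσ hcov hk (hM n (by omega)) (hc n (by omega))
    have hini : Measurable fun p : Θ × (Fin (n + 1) → Round A B) =>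
      (p.1, fun i : Fin n => p.2 i.castSucc) := by fun_prop
    have hobs : ∀ n : ℕ, Measurable fun p : Θ × (Fin n → Round A B) => obsOf p.2 := by
      intro n; unfold obsOf; fun_prop
    have mS : Measurable fun p : Θ × (Fin n → Round A B) =>
        ENNReal.ofReal (histSum (G.stdTerm σ) n (obsOf p.2)) :=
      ((hmS n).comp (hobs n)).ennreal_ofReal
    rw [← G.map_init_playLaw σ adv M b n,
      lintegral_map (G.measurable_gapSum b n).ennreal_ofReal hini, lintegral_map mS hini] at ih'
    have hl : ∀ p : Θ × (Fin (n + 1) → Round A B), ENNReal.ofReal (G.gapSum b (n + 1) p) =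
        ENNReal.ofReal (G.gapSum b n (p.1, fun i : Fin n => p.2 i.castSucc)) +
          ENNReal.ofReal (G.gap p.1 (b n) (p.2 (Fin.last n))) := by
      intro p
      rw [← ENNReal.ofReal_add (G.gapSum_nonneg b n _) (G.gap_nonneg _ _ _)]
      simp [gapSum, Fin.sum_univ_castSucc]
    have hr : ∀ p : Θ × (Fin (n + 1) → Round A B),
        ENNReal.ofReal (histSum (G.stdTerm σ) (n + 1) (obsOf p.2)) =
        ENNReal.ofReal (histSum (G.stdTerm σ) n
          (obsOf (p.1, fun i : Fin n => p.2 i.castSucc).2)) +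
        ENNReal.ofReal (G.stdTerm σ n (fun i => (p.2 i.castSucc).1)
          ((p.2 (Fin.last n)).1.1, (p.2 (Fin.last n)).1.2.1)) := by
      intro p
      exact ENNReal.ofReal_add (hS0 n _) (Real.sqrt_nonneg _)
    have m1 : Measurable fun p : Θ × (Fin (n + 1) → Round A B) =>
        ENNReal.ofReal (G.gapSum b n (p.1, fun i : Fin n => p.2 i.castSucc)) :=
      ((G.measurable_gapSum b n).comp hini).ennreal_ofReal
    have m2 : Measurable fun p : Θ × (Fin (n + 1) → Round A B) =>
        ENNReal.ofReal (histSum (G.stdTerm σ) n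
          (obsOf (p.1, fun i : Fin n => p.2 i.castSucc).2)) :=
      (((hmS n).comp (hobs n)).comp hini).ennreal_ofReal
    simp only [hl, hr]
    rw [lintegral_add_left m1, lintegral_add_left m2, mul_add]
    refine (add_le_add ih' hstep).trans ?_
    have hnum : 4 * √(n : ℝ) + 2 / √((n + 1 : ℕ) : ℝ) ≤ 4 * √((n + 1 : ℕ) : ℝ) := by
      have h1 : 0 < √((n + 1 : ℕ) : ℝ) := by positivity
      have h2 : √((n + 1 : ℕ) : ℝ) ^ 2 = n + 1 := by
        rw [Real.sq_sqrt (by positivity)]; push_cast; ring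
      have h3 : √(n : ℝ) ^ 2 = n := Real.sq_sqrt (by positivity)
      have h4 : 2 / √((n + 1 : ℕ) : ℝ) * √((n + 1 : ℕ) : ℝ) = 2 := div_mul_cancel₀ _ h1.ne'
      have h5 : 4 * √(n : ℝ) * √((n + 1 : ℕ) : ℝ) ≤ 2 * (n + (n + 1)) := by
        nlinarith [sq_nonneg (√(n : ℝ) - √((n + 1 : ℕ) : ℝ))]
      refine le_of_mul_le_mul_right ?_ h1
      rw [add_mul, h4]
      nlinarith
    have hnum' := ENNReal.ofReal_le_ofReal hnum
    rw [ENNReal.ofReal_add (by positivity) (by positivity)] at hnum'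
    calc _ = (ENNReal.ofReal (4 * √(n : ℝ)) + ENNReal.ofReal (2 / √((n + 1 : ℕ) : ℝ))) + _ :=
          add_add_add_comm _ _ _ _
      _ ≤ _ := add_le_add_left hnum' _

end GaussianGame

/-! ### From the gaps to the regret -/

theorem abs_ciSup_le {ι : Type*} [Finite ι] [Nonempty ι] {x : ι → ℝ} {c : ℝ} (h : ∀ i, |x i| ≤ c) :
    |⨆ i, x i| ≤ c := by
  obtain ⟨i⟩ := ‹Nonempty ι›
  exact abs_le.2 ⟨(abs_le.1 (h i)).1.trans (le_ciSup (Set.finite_range x).bddAbove i),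
    ciSup_le fun j => (abs_le.1 (h j)).2⟩

namespace GaussianGame

variable {A B Θ : Type*} [Fintype A] [Fintype B] [DecidableEq A] [DecidableEq B]
  [MeasurableSpace A] [MeasurableSingletonClass A] [MeasurableSpace B] [MeasurableSingletonClass B]
  [MeasurableSpace Θ] (G : GaussianGame A B Θ) {σ : ℝ≥0}
  (adv : FullInfoAlgorithm A) (M : ℕ → ℕ) (b : ℕ → B)

theorem abs_meanReward_sub_le (θ : Θ) (a a' : A) (b : B) :
    |G.meanReward θ a b - G.meanReward θ a' b| ≤ 1 :=
  abs_sub_le_one_of_mem_Icc (clip01_mem _) (clip01_mem _)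

theorem measurable_meanReward_sub (a : A) {n : ℕ} (t : Fin n) :
    Measurable fun p : Θ × (Fin n → Round A B) =>
      G.meanReward p.1 a (b t) - G.meanReward p.1 (p.2 t).1.1 (b t) :=
  Measurable.sub (by fun_prop) (measurable_eval_index
    (g := fun (p : Θ × (Fin n → Round A B)) a => G.meanReward p.1 a (b t))
    (fun a => by fun_prop) (by fun_prop))

theorem integrable_meanReward_sub (a : A) {n : ℕ} (t : Fin n) (θ : Θ) :
    Integrable (fun h => G.meanReward θ a (b t) - G.meanReward θ (h t).1.1 (b t))
      (G.law σ adv M b n θ) :=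
  Integrable.of_bound ((G.measurable_meanReward_sub b a t).comp
    measurable_prodMk_left).aestronglyMeasurable 1
    (Filter.Eventually.of_forall fun _ => G.abs_meanReward_sub_le _ _ _ _)

theorem ae_gapSum_le (n : ℕ) (θ : Θ) :
    ∀ᵐ h ∂G.law σ adv M b n θ, G.gapSum b n (θ, h) ≤ n * (Fintype.card A + 1) := by
  filter_upwards [G.ae_imagined_mem σ adv M b n θ] with h hh
  refine (Finset.sum_le_sum fun (t : Fin n) _ => G.gap_le θ (b t) (h t) (hh t)).trans ?_
  simp [mul_add]

theorem integrable_gapSum (n : ℕ) (θ : Θ) :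
    Integrable (fun h => G.gapSum b n (θ, h)) (G.law σ adv M b n θ) := by
  refine Integrable.of_bound ((G.measurable_gapSum b n).comp
    measurable_prodMk_left).aestronglyMeasurable (n * (Fintype.card A + 1)) ?_
  filter_upwards [G.ae_gapSum_le adv M b n θ] with h hh
  rwa [Real.norm_of_nonneg (G.gapSum_nonneg b n _)]

theorem integrable_gapSum_playLaw (n : ℕ) :
    Integrable (G.gapSum b n) (G.playLaw σ adv M b n) := by
  refine Integrable.of_bound (G.measurable_gapSum b n).aestronglyMeasurable
    (n * (Fintype.card A + 1)) ?_
  refine (Measure.ae_compProd_iff (measurableSet_le (G.measurable_gapSum b n).norm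
    measurable_const)).2 (Filter.Eventually.of_forall fun θ => ?_)
  filter_upwards [G.ae_gapSum_le adv M b n θ] with h hh
  rwa [Real.norm_of_nonneg (G.gapSum_nonneg b n _)]

/-- The regret exceeds the regret with respect to the imagined rewards by at most the expected sum
of the gaps. -/
theorem regret_le [Nonempty A] (T : ℕ) (θ : Θ) :
    G.regret σ adv M b T θ ≤
      G.fullRegret σ adv M b T θ + ∫ h, G.gapSum b T (θ, h) ∂G.law σ adv M b T θ := by
  refine ciSup_le fun a => ?_
  have h1 : ∫ h, regretOf (advPast h) a ∂G.law σ adv M b T θ ≤ G.fullRegret σ adv M b T θ :=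
    le_ciSup (f := fun a => ∫ h, regretOf (advPast h) a ∂G.law σ adv M b T θ)
      (Set.finite_range _).bddAbove a
  refine le_trans ?_ (add_le_add_left h1 _)
  rw [← integral_finsetSum _ fun t _ => G.integrable_meanReward_sub adv M b a t θ,
    ← integral_add (G.integrable_regretOf σ adv M b T θ a) (G.integrable_gapSum adv M b T θ)]
  refine integral_mono (integrable_finsetSum _ fun t _ =>
    G.integrable_meanReward_sub adv M b a t θ) ((G.integrable_regretOf σ adv M b T θ a).add
      (G.integrable_gapSum adv M b T θ)) fun h => ?_
  simp only [regretOf, gapSum, ← Finset.sum_add_distrib]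
  exact Finset.sum_le_sum fun t _ => G.sub_le_gap θ (b t) (h t) a

theorem integrable_regret [Nonempty A] (T : ℕ) :
    Integrable (G.regret σ adv M b T) G.prior := by
  refine Integrable.of_bound (Measurable.iSup fun a => Finset.measurable_sum _ fun t _ =>
    ((G.measurable_meanReward_sub b a
      t).stronglyMeasurable.integral_kernel_prod_right').measurable).aestronglyMeasurable T
    (Filter.Eventually.of_forall fun θ => abs_ciSup_le fun a => ?_)
  refine (Finset.abs_sum_le_sum_abs _ _).trans ?_
  refine (Finset.sum_le_sum fun t _ => (?_ : _ ≤ (1 : ℝ))).trans (by simp)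
  simpa using norm_integral_le_of_norm_le_const (μ := G.law σ adv M b T θ)
    (f := fun h => G.meanReward θ a (b t) - G.meanReward θ (h t).1.1 (b t)) (C := 1)
    (Filter.Eventually.of_forall fun h =>
      G.abs_meanReward_sub_le θ a (h t).1.1 (b t))

theorem integrable_fullRegret [Nonempty A] (T : ℕ) :
    Integrable (G.fullRegret σ adv M b T) G.prior := by
  refine Integrable.of_bound (Measurable.iSup fun a =>
    (((measurable_regretOf_advPast T a).comp (measurable_snd (α := Θ))).stronglyMeasurable
      |>.integral_kernel_prod_right').measurable).aestronglyMeasurable T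
    (Filter.Eventually.of_forall fun θ => abs_ciSup_le fun a => ?_)
  refine (norm_integral_le_of_norm_le_const (μ := G.law σ adv M b T θ)
    (f := fun h => regretOf (advPast h) a) (C := T)
    (G.ae_abs_regretOf_le σ adv M b T θ a)).trans (le_of_eq ?_)
  simp

theorem setIntegral_regret_le_add_gapSum [Nonempty A] (T : ℕ) (S : Set Θ) :
    ∫ θ in S, G.regret σ adv M b T θ ∂G.prior ≤
      ∫ θ in S, G.fullRegret σ adv M b T θ ∂G.prior +
        ∫ p, G.gapSum b T p ∂G.playLaw σ adv M b T := by
  have hint : Integrable (fun θ => ∫ h, G.gapSum b T (θ, h) ∂G.law σ adv M b T θ) G.prior :=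
    (G.integrable_gapSum_playLaw adv M b T).integral_compProd
  have h1 : ∫ θ in S, ∫ h, G.gapSum b T (θ, h) ∂G.law σ adv M b T θ ∂G.prior ≤
      ∫ p, G.gapSum b T p ∂G.playLaw σ adv M b T := by
    rw [playLaw, Measure.integral_compProd (G.integrable_gapSum_playLaw adv M b T)]
    exact setIntegral_le_integral hint (Filter.Eventually.of_forall fun θ =>
      integral_nonneg fun h => G.gapSum_nonneg b T _)
  refine le_trans ?_ (add_le_add_right h1 _)
  rw [← integral_add (G.integrable_fullRegret adv M b T).integrableOn hint.integrableOn]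
  exact integral_mono (G.integrable_regret adv M b T).integrableOn
    ((G.integrable_fullRegret adv M b T).integrableOn.add hint.integrableOn)
    fun θ => G.regret_le adv M b T θ

/-! ### Posterior standard deviations and information -/

theorem stdTerm_nonneg (n : ℕ) (o : Fin n → Obs A B) (x : A × B) : 0 ≤ G.stdTerm σ n o x :=
  Real.sqrt_nonneg _

theorem stdTerm_le_one (hσ : 0 < σ) (hcov : ∀ x, G.cov x x ≤ 1) (n : ℕ) (o : Fin n → Obs A B)
    (x : A × B) : G.stdTerm σ n o x ≤ 1 :=
  Real.sqrt_le_one.2 ((G.postVar_le_cov hσ n o x).trans (hcov x))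

/-- The elementary bound `u / (1 + u) ≤ log (1 + u)` at `u = postVar / σ²`. -/
theorem postVar_le_infoTerm (hσ : 0 < σ) (hcov : ∀ x, G.cov x x ≤ 1) (n : ℕ)
    (o : Fin n → Obs A B) (x : A × B) :
    G.postVar σ n o x ≤ 2 * ((σ : ℝ) ^ 2 + 1) * G.infoTerm σ n o x := by
  have hσ2 : (0 : ℝ) < (σ : ℝ) ^ 2 := by positivity
  have h0 := G.postVar_nonneg hσ n o x
  have h1 := (G.postVar_le_cov hσ n o x).trans (hcov x)
  have h2 := Real.one_sub_inv_le_log_of_pos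
    (x := 1 + G.postVar σ n o x / (σ : ℝ) ^ 2) (by positivity)
  have h3 : 1 - (1 + G.postVar σ n o x / (σ : ℝ) ^ 2)⁻¹ =
      G.postVar σ n o x / ((σ : ℝ) ^ 2 + G.postVar σ n o x) := by
    have : (σ : ℝ) ^ 2 + G.postVar σ n o x ≠ 0 := by positivity
    field_simp
    ring
  have h4 : G.postVar σ n o x / ((σ : ℝ) ^ 2 + 1) ≤
      G.postVar σ n o x / ((σ : ℝ) ^ 2 + G.postVar σ n o x) := by gcongr
  rw [h3] at h2
  have h5 := (div_le_iff₀ (by positivity)).1 (h4.trans h2)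
  unfold infoTerm
  linarith

/-- In the first round the posterior variance is the prior variance. -/
theorem le_histSum_postVar (hσ : 0 < σ) {v : ℝ} (hv : ∀ x, v ≤ G.cov x x) (n : ℕ)
    (o : Fin (n + 1) → Obs A B) : v ≤ histSum (G.postVar σ) (n + 1) o := by
  induction n with
  | zero => exact (hv _).trans (zero_add (G.cov _ _)).ge
  | succ n ih => exact (ih _).trans (le_add_of_nonneg_right (G.postVar_nonneg hσ _ _ _))

section Expectations

variable (hσ : 0 < σ) (hcov : ∀ x, G.cov x x ≤ 1)
include hσ hcov

theorem integrable_histSum_postVar (T : ℕ) :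
    Integrable (fun p => histSum (G.postVar σ) T (obsOf p.2)) (G.playLaw σ adv M b T) :=
  G.integrable_histSum adv M b (fun n x => G.measurable_postVar σ n measurable_id x)
    (G.postVar_nonneg hσ) (fun n o x => (G.postVar_le_cov hσ n o x).trans (hcov x)) T

theorem integrable_histSum_stdTerm (T : ℕ) :
    Integrable (fun p => histSum (G.stdTerm σ) T (obsOf p.2)) (G.playLaw σ adv M b T) :=
  G.integrable_histSum adv M b (fun n x => G.measurable_stdTerm n x)
    G.stdTerm_nonneg (G.stdTerm_le_one hσ hcov) T

theorem integral_histSum_postVar_le (T : ℕ) :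
    ∫ p, histSum (G.postVar σ) T (obsOf p.2) ∂G.playLaw σ adv M b T ≤
      2 * ((σ : ℝ) ^ 2 + 1) * (G.information σ adv M b T).toReal := by
  rw [(G.information_eq adv M b hσ hcov T).2, ← integral_const_mul]
  refine integral_mono (G.integrable_histSum_postVar adv M b hσ hcov T)
    ((G.integrable_histSum adv M b (fun n x => G.measurable_infoTerm n x)
      (G.infoTerm_nonneg hσ) (G.infoTerm_le hσ hcov) T).const_mul _) fun p => ?_
  simpa using histSum_le (φ := G.postVar σ) (ψ := G.infoTerm σ) (β := 0)
    (by simpa using G.postVar_le_infoTerm hσ hcov) T (obsOf p.2)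

/-- The Cauchy–Schwarz inequality for the sum over the rounds and the expectation. -/
theorem integral_histSum_stdTerm_le (T : ℕ)
    (hpos : 0 < ∫ p, histSum (G.postVar σ) T (obsOf p.2) ∂G.playLaw σ adv M b T) :
    ∫ p, histSum (G.stdTerm σ) T (obsOf p.2) ∂G.playLaw σ adv M b T ≤
      √T * √(∫ p, histSum (G.postVar σ) T (obsOf p.2) ∂G.playLaw σ adv M b T) := by
  set V := ∫ p, histSum (G.postVar σ) T (obsOf p.2) ∂G.playLaw σ adv M b T with hV
  rcases Nat.eq_zero_or_pos T with rfl | hT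
  · simp [histSum]
  have hT' : (0 : ℝ) < T := by exact_mod_cast hT
  have hsT : 0 < √(T : ℝ) := Real.sqrt_pos.2 hT'
  have hsV : 0 < √V := Real.sqrt_pos.2 hpos
  -- termwise inequality of arithmetic and geometric means, with the optimal weight
  set l := √(T : ℝ) / √V with hl
  have hl0 : 0 < l := by positivity
  have hterm : ∀ n (o : Fin n → Obs A B) x,
      G.stdTerm σ n o x ≤ l / 2 * G.postVar σ n o x + 1 / (2 * l) := by
    intro n o x
    have h1 : G.stdTerm σ n o x ^ 2 = G.postVar σ n o x := Real.sq_sqrt (G.postVar_nonneg hσ n o x)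
    rw [← h1, ← sub_nonneg]
    have : l / 2 * G.stdTerm σ n o x ^ 2 + 1 / (2 * l) - G.stdTerm σ n o x =
        (l * G.stdTerm σ n o x - 1) ^ 2 / (2 * l) := by
      field_simp
      ring
    rw [this]
    positivity
  have hint := G.integrable_histSum_postVar adv M b hσ hcov T
  calc _ ≤ ∫ p, (l / 2 * histSum (G.postVar σ) T (obsOf p.2) + T * (1 / (2 * l)))
        ∂G.playLaw σ adv M b T :=
        integral_mono (G.integrable_histSum_stdTerm adv M b hσ hcov T)
          ((hint.const_mul _).add (integrable_const _)) fun p => histSum_le hterm T (obsOf p.2)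
    _ = l / 2 * V + T * (1 / (2 * l)) := by
        rw [integral_add (hint.const_mul _) (integrable_const _), integral_const_mul]
        simp [hV]
    _ = √T * √V := by
        have h1 : V = √V ^ 2 := (Real.sq_sqrt hpos.le).symm
        have h2 : (T : ℝ) = √(T : ℝ) ^ 2 := (Real.sq_sqrt hT'.le).symm
        rw [hl]
        generalize √V = x at *
        generalize √(T : ℝ) = y at *
        rw [h1, h2]
        field_simp
        ring

theorem integral_gapSum_le (hk : 2 ≤ Fintype.card A) {c : ℝ} (hc0 : 0 ≤ c) (T : ℕ)
    (hM : ∀ t < T, sampleSize (Fintype.card A) (t + 1) ≤ M t)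
    (hc : ∀ t < T, √(2 * Real.log (M t)) + 2 ≤ c) :
    ∫ p, G.gapSum b T p ∂G.playLaw σ adv M b T ≤
      4 * √T + c * ∫ p, histSum (G.stdTerm σ) T (obsOf p.2) ∂G.playLaw σ adv M b T := by
  have h := G.lintegral_gapSum_le adv M b hσ hcov hk T hM hc
  have h0 : ∀ p : Θ × (Fin T → Round A B), 0 ≤ histSum (G.stdTerm σ) T (obsOf p.2) :=
    fun p => histSum_nonneg G.stdTerm_nonneg T _
  rw [← ofReal_integral_eq_lintegral_ofReal (G.integrable_gapSum_playLaw adv M b T)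
      (Filter.Eventually.of_forall (G.gapSum_nonneg b T)),
    ← ofReal_integral_eq_lintegral_ofReal (G.integrable_histSum_stdTerm adv M b hσ hcov T)
      (Filter.Eventually.of_forall h0), ← ENNReal.ofReal_mul hc0,
    ← ENNReal.ofReal_add (by positivity) (mul_nonneg hc0 (integral_nonneg h0))] at h
  exact (ENNReal.ofReal_le_ofReal_iff
    (add_nonneg (by positivity) (mul_nonneg hc0 (integral_nonneg h0)))).1 h

/-- The expected sum of the gaps is controlled by the information that Alice gains. The term `4 √T`
is absorbed because the first observation alone carries an amount of information that is bounded
below in terms of the variance `v`. -/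
theorem integral_gapSum_le_information {v : ℝ} (hv : 0 < v) (hvc : ∀ x, v ≤ G.cov x x)
    (hk : 2 ≤ Fintype.card A) {T : ℕ} (hT : 1 ≤ T)
    (hM : ∀ t < T, sampleSize (Fintype.card A) (t + 1) ≤ M t ∧
      M t ≤ sampleSize (Fintype.card A) T) :
    ∫ p, G.gapSum b T p ∂G.playLaw σ adv M b T ≤
      √(2 * ((σ : ℝ) ^ 2 + 1)) * (8 / √v + 8) *
        √(Real.log (Fintype.card A * T) * (G.information σ adv M b T).toReal * T) := by
  set L := Real.log (Fintype.card A * T) with hL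
  set I := (G.information σ adv M b T).toReal
  set V := ∫ p, histSum (G.postVar σ) T (obsOf p.2) ∂G.playLaw σ adv M b T with hV
  have hL4 : 1 / 4 ≤ L := by
    have h1 : (2 : ℝ) ≤ Fintype.card A * T := by
      exact_mod_cast (by nlinarith : 2 ≤ Fintype.card A * T)
    have h2 := Real.log_le_log (by norm_num) h1
    linarith [Real.log_two_gt_d9]
  have hsL : 1 ≤ 2 * √L := by
    have : (1 : ℝ) / 2 ≤ √L := Real.le_sqrt_of_sq_le (by linarith)
    linarith
  have hc : ∀ t < T, √(2 * Real.log (M t)) + 2 ≤ 8 * √L := by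
    intro t ht
    have h1 := log_le_of_le_sampleSize hk hT ((one_le_sampleSize _ _).trans (hM t ht).1) (hM t ht).2
    have h2 : √(2 * Real.log (M t)) ≤ 4 * √L := by
      refine Real.sqrt_le_iff.2 ⟨by positivity, ?_⟩
      rw [mul_pow, Real.sq_sqrt (by linarith)]
      linarith
    linarith
  have hvV : v ≤ V := by
    obtain ⟨n, rfl⟩ : ∃ n, T = n + 1 := ⟨T - 1, by omega⟩
    calc v = ∫ _, v ∂G.playLaw σ adv M b (n + 1) := by simp
      _ ≤ V := integral_mono (integrable_const _) (G.integrable_histSum_postVar adv M b hσ hcov _)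
          fun p => G.le_histSum_postVar hσ hvc n _
  have hgap := G.integral_gapSum_le adv M b hσ hcov hk (c := 8 * √L) (by positivity) T
    (fun t ht => (hM t ht).1) hc
  have hS := G.integral_histSum_stdTerm_le adv M b hσ hcov T (hv.trans_le hvV)
  have hVI : √V ≤ √(2 * ((σ : ℝ) ^ 2 + 1)) * √I := by
    rw [← Real.sqrt_mul (by positivity)]
    exact Real.sqrt_le_sqrt (G.integral_histSum_postVar_le adv M b hσ hcov T)
  have hsv : 0 < √v := Real.sqrt_pos.2 hv
  -- the factors `2 √L` and `√V / √v`, at least one each, absorb the term `4 √T`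
  have hone : 1 ≤ √V / √v := (one_le_div hsv).2 (Real.sqrt_le_sqrt hvV)
  have h4 : 4 * √(T : ℝ) ≤ 8 / √v * (√L * √T * √V) := by
    calc 4 * √(T : ℝ) = 4 * √(T : ℝ) * 1 * 1 := by ring
      _ ≤ 4 * √(T : ℝ) * (2 * √L) * (√V / √v) := by gcongr
      _ = _ := by ring
  calc _ ≤ 4 * √(T : ℝ) + 8 * √L * (√T * √V) := by
        refine hgap.trans ?_
        gcongr
    _ ≤ 8 / √v * (√L * √T * √V) + 8 * √L * (√T * √V) := by gcongr
    _ = (8 / √v + 8) * (√L * √T) * √V := by ring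
    _ ≤ (8 / √v + 8) * (√L * √T) * (√(2 * ((σ : ℝ) ^ 2 + 1)) * √I) := by gcongr
    _ = _ := by
        rw [mul_assoc L, Real.sqrt_mul (x := L) (by linarith),
          Real.sqrt_mul (x := I) ENNReal.toReal_nonneg]
        ring

/-- The integrated regret exceeds the integrated regret with respect to the imagined rewards by at
most the information term. The bound on the gaps needs at least two actions; for a single
action, or no round, both regrets vanish. -/
theorem setIntegral_regret_le [Nonempty A] {v : ℝ} (hv : 0 < v) (hvc : ∀ x, v ≤ G.cov x x) {T : ℕ}
    (hM : ∀ t < T, sampleSize (Fintype.card A) (t + 1) ≤ M t ∧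
      M t ≤ sampleSize (Fintype.card A) T) (S : Set Θ) :
    ∫ θ in S, G.regret σ adv M b T θ ∂G.prior ≤
      ∫ θ in S, G.fullRegret σ adv M b T θ ∂G.prior +
        √(2 * ((σ : ℝ) ^ 2 + 1)) * (8 / √v + 8) *
          √(Real.log (Fintype.card A * T) * (G.information σ adv M b T).toReal * T) := by
  rcases Nat.eq_zero_or_pos T with rfl | hT
  · simp [regret, fullRegret]
  rcases Nat.lt_or_ge (Fintype.card A) 2 with hk | hk
  · have hsub : Subsingleton A := Fintype.card_le_one_iff_subsingleton.1 (by omega)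
    have h1 : ∀ θ, G.regret σ adv M b T θ = 0 := fun θ => by
      have : ∀ (a a' : A) b, G.meanReward θ a b - G.meanReward θ a' b = 0 := fun a a' b => by
        rw [Subsingleton.elim a a', sub_self]
      simp [regret, this]
    have h2 : ∀ θ, G.fullRegret σ adv M b T θ = 0 := fun θ => by
      have : ∀ (r : A → ℝ) (a a' : A), r a - r a' = 0 := fun r a a' => by
        rw [Subsingleton.elim a a', sub_self]
      simp [fullRegret, this]
    simp only [h1, h2, integral_zero, zero_add]
    positivity
  · exact (G.setIntegral_regret_le_add_gapSum adv M b T S).trans (add_le_add_right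
      (G.integral_gapSum_le_information adv M b hσ hcov hv hvc hk hT hM) _)

/-- A bound on the full-information regret for every parameter yields a bound on the Bayesian
regret. -/
theorem integral_regret_le [Nonempty A] {v : ℝ} (hv : 0 < v) (hvc : ∀ x, v ≤ G.cov x x) {T : ℕ}
    (hM : ∀ t < T, sampleSize (Fintype.card A) (t + 1) ≤ M t ∧
      M t ≤ sampleSize (Fintype.card A) T) {r : ℝ} (hr : ∀ θ, G.fullRegret σ adv M b T θ ≤ r) :
    ∫ θ, G.regret σ adv M b T θ ∂G.prior ≤ r + √(2 * ((σ : ℝ) ^ 2 + 1)) * (8 / √v + 8) *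
      √(Real.log (Fintype.card A * T) * (G.information σ adv M b T).toReal * T) := by
  have h1 := G.setIntegral_regret_le adv M b hσ hcov hv hvc hM Set.univ
  rw [setIntegral_univ, setIntegral_univ] at h1
  have h2 : ∫ θ, G.fullRegret σ adv M b T θ ∂G.prior ≤ r := by
    simpa using integral_mono (G.integrable_fullRegret adv M b T) (integrable_const r) hr
  linarith

end Expectations

end GaussianGame

end UnknownGame

end


open UnknownGame in
theorem mainTheorem2 (σ : ℝ≥0) (hσ : 0 < σ) (v : ℝ) (hv : 0 < v) :
    ∃ C : ℝ, 0 ≤ C ∧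
      ∀ {A B Θ : Type*} [Fintype A] [Nonempty A] [Fintype B] [DecidableEq A] [DecidableEq B]
        [MeasurableSpace A] [MeasurableSingletonClass A] [MeasurableSpace B]
        [MeasurableSingletonClass B] [MeasurableSpace Θ]
        (G : GaussianGame A B Θ) (_ : ∀ x, v ≤ G.cov x x ∧ G.cov x x ≤ 1)
        (T : ℕ) (b : ℕ → B) (M : ℕ → ℕ)
        (_ : ∀ t < T, sampleSize (Fintype.card A) (t + 1) ≤ M t ∧
          M t ≤ sampleSize (Fintype.card A) T),
        (∀ adv : FullInfoAlgorithm A, G.information σ adv M b T ≠ ∞ ∧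
          ∀ S : Set Θ, MeasurableSet S →
            ∫ θ in S, G.regret σ adv M b T θ ∂G.prior ≤
              ∫ θ in S, G.fullRegret σ adv M b T θ ∂G.prior +
                C * √(Real.log (Fintype.card A * T) * (G.information σ adv M b T).toReal * T)) ∧
        (∀ adv : FullInfoAlgorithm A,
          adv = hedge A (fun _ => √(8 * Real.log (Fintype.card A) / T)) →
            (∀ θ, G.fullRegret σ adv M b T θ ≤ C * √(T * Real.log (Fintype.card A))) ∧
            ∫ θ, G.regret σ adv M b T θ ∂G.prior ≤
              C * (√(T * Real.log (Fintype.card A)) +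
                √(Real.log (Fintype.card A * T) * (G.information σ adv M b T).toReal * T))) ∧
        (∀ adv : FullInfoAlgorithm A, adv = regretMatching A →
            (∀ θ, G.fullRegret σ adv M b T θ ≤ C * √(T * Fintype.card A)) ∧
            ∫ θ, G.regret σ adv M b T θ ∂G.prior ≤
              C * (√(T * Fintype.card A) +
                √(Real.log (Fintype.card A * T) * (G.information σ adv M b T).toReal * T))) := by
  set c := √(2 * ((σ : ℝ) ^ 2 + 1)) * (8 / √v + 8) with hc
  have hc0 : 0 ≤ c := by positivity
  refine ⟨c + 2, by positivity, ?_⟩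
  intro A B Θ _ _ _ _ _ _ _ _ _ _ G hcov T b M hM
  have hcov1 : ∀ x, G.cov x x ≤ 1 := fun x => (hcov x).2
  have hcovv : ∀ x, v ≤ G.cov x x := fun x => (hcov x).1
  -- `c + 2` covers the constants of both terms of the Bayesian bound
  have key : ∀ {x r y R : ℝ}, 0 ≤ r → 0 ≤ y → R ≤ 2 * r → x ≤ R + c * y →
      x ≤ (c + 2) * (r + y) := by
    intro x r y R hr hy hR hx
    nlinarith [mul_nonneg hc0 hr]
  have bound : ∀ {r R : ℝ}, 0 ≤ r → R ≤ 2 * r → R ≤ (c + 2) * r := by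
    intro r R hr hR
    nlinarith [mul_nonneg hc0 hr]
  refine ⟨fun adv => ⟨(G.information_eq adv M b hσ hcov1 T).1, fun S _ => ?_⟩, ?_, ?_⟩
  · refine (G.setIntegral_regret_le adv M b hσ hcov1 hv hcovv hM S).trans ?_
    gcongr
    linarith
  · rintro adv rfl
    have hreg := G.fullRegret_hedge_le σ M b T
    exact ⟨fun θ => bound (Real.sqrt_nonneg _) (hreg θ),
      key (Real.sqrt_nonneg _) (Real.sqrt_nonneg _) le_rfl
        (G.integral_regret_le _ M b hσ hcov1 hv hcovv hM hreg)⟩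
  · rintro adv rfl
    have hreg := G.fullRegret_regretMatching_le σ M b T
    exact ⟨fun θ => bound (Real.sqrt_nonneg _)
        ((hreg θ).trans (by linarith [Real.sqrt_nonneg ((T : ℝ) * Fintype.card A)])),
      key (Real.sqrt_nonneg _) (Real.sqrt_nonneg _)
        (by linarith [Real.sqrt_nonneg ((T : ℝ) * Fintype.card A)])
        (G.integral_regret_le _ M b hσ hcov1 hv hcovv hM hreg)⟩
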